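/- Let $X$ be a closed (compact, connected) Riemann surface and $q$ a holomorphic quadratic differential on $X$, with the flat structure given by the charts in which $q=dz^2$, and let $\Sigma$ be the set of zeros of $q$. A \emph{saddle connection} is a straight (geodesic) segment $\gamma$ of positive length joining two points of $\Sigma$ (possibly equal) with no point of $\Sigma$ in its interior; if $\pm w\in\mathbb C$ is its holonomy vector, put $h(\gamma)=|\operatorname{Re}w|$, $v(\gamma)=|\operatorname{Im}w|$, and let $|w|$ be its length. For $t\in\mathbb R$ let $X_t$ be the flat surface obtained by post-composing the flat charts with the $\mathbb R$-linear map $z\mapsto e^{t/2}\operatorname{Re}z+ie^{-t/2}\operatorname{Im}z$. Given a saddle connection $\gamma$ in $X_t$, extend every vertical leaf that starts at a singularity until the first time it meets $\gamma$, and let $\Gamma$ be the union of these vertical critical segments with $\gamma$; the connected components of the complement of $\Gamma$ are the \emph{vertical strips} determined by $\gamma$. The \emph{width} of a strip is its extent in the horizontal direction, that is, the supremum of $|\operatorname{Re}w|$ over the holonomy vectors $w$ of the straight segments contained in the strip. \textbf{Proposition.} Let $h_0,c,\varepsilon,A>0$, $\kappa>1$ and $\delta\in\mathbb R$. There is a $t_0>1$,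 depending only on $h_0,c,\varepsilon,\kappa,\delta$ and $A$, such that the following holds for every $(X,q)$ as above whose flat area is at most $A$ (for instance, with $A=1$, for every $(X,q)$ of area one). Suppose that $(X,q)$ satisfies the Diophantine condition: every saddle connection $\gamma$ in $X$ with $h(\gamma)<h_0$ satisfies $v(\gamma)>1$ and $$h(\gamma)>\frac{c}{v(\gamma)\,(\log v(\gamma))^{\varepsilon}}.$$ Then for every $t>t_0$ and every saddle connection $\gamma$ in $X_t$ of length at most $\kappa$ such that $\delta>2m\varepsilon$, where $m$ is the number of vertical strips determined by $\gamma$, every vertical strip determined by $\gamma$ has width (in $X_t$) at least $t^{-\delta}$. -/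

import Mathlib

open Set Topology MeasureTheory
open scoped Manifold NNReal ENNReal

noncomputable section

/-- A holomorphic quadratic differential `q = q_φ(z) dz²` on a Riemann surface `X`: a holomorphic
coefficient in every holomorphic chart `φ`, transforming by the square of the derivative of the
coordinate changes. -/
structure QuadraticDifferential (X : Type*) [TopologicalSpace X] [ChartedSpace ℂ X]
    [IsManifold 𝓘(ℂ) 1 X] where
  coeff : OpenPartialHomeomorph X ℂ → ℂ → ℂ
  holomorphic : ∀ φ ∈ IsManifold.maximalAtlas 𝓘(ℂ) 1 X, DifferentiableOn ℂ (coeff φ) φ.target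
  transform : ∀ φ ∈ IsManifold.maximalAtlas 𝓘(ℂ) 1 X, ∀ ψ ∈ IsManifold.maximalAtlas 𝓘(ℂ) 1 X,
    ∀ p ∈ φ.source ∩ ψ.source,
      coeff φ (φ p) = coeff ψ (ψ p) * (deriv (fun z => ψ (φ.symm z)) (φ p)) ^ 2

/-- The data of a flat structure with singularities on a surface: the flat charts (natural
parameters) on the complement of the singular set, and the singular set. -/
structure FlatStructure (X : Type*) [TopologicalSpace X] where
  charts : Set (OpenPartialHomeomorph X ℂ)
  sing : Set X

/-- The flat structure of `q`: its charts are the holomorphic charts in which `q = dz²`, and its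
singularities are the zeros of `q`. -/
def QuadraticDifferential.flat {X : Type*} [TopologicalSpace X] [ChartedSpace ℂ X]
    [IsManifold 𝓘(ℂ) 1 X] (q : QuadraticDifferential X) : FlatStructure X where
  charts := {φ | φ ∈ IsManifold.maximalAtlas 𝓘(ℂ) 1 X ∧ ∀ z ∈ φ.target, q.coeff φ z = 1}
  sing := {p | q.coeff (chartAt ℂ p) (chartAt ℂ p p) = 0}

/-- The real-linear map `z ↦ e^{t/2} Re z + i e^{-t/2} Im z`. -/
def teichmullerStretch (t : ℝ) : ℂ ≃ₜ ℂ where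
  toFun z := ⟨Real.exp (t / 2) * z.re, Real.exp (-t / 2) * z.im⟩
  invFun z := ⟨Real.exp (-t / 2) * z.re, Real.exp (t / 2) * z.im⟩
  left_inv z := by
    apply Complex.ext <;> simp [← mul_assoc, ← Real.exp_add, neg_div]
  right_inv z := by
    apply Complex.ext <;> simp [← mul_assoc, ← Real.exp_add, neg_div]
  continuous_toFun := by
    simp only [Complex.mk_eq_add_mul_I]
    fun_prop
  continuous_invFun := by
    simp only [Complex.mk_eq_add_mul_I]
    fun_prop

namespace FlatStructure

variable {X : Type*} [TopologicalSpace X] (F : FlatStructure X)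

/-- The surface `X_t`: the flat charts are post-composed with the stretch map. The map `f_t` from
`X` to `X_t` is the identity of the underlying surface. -/
def evolve (t : ℝ) : FlatStructure X where
  charts := (fun φ => φ.transHomeomorph (teichmullerStretch t)) '' F.charts
  sing := F.sing

/-- The area: the supremum of the total area of finitely many flat charts with pairwise disjoint
domains. -/
def area : ℝ≥0∞ :=
  ⨆ (s : Finset (OpenPartialHomeomorph X ℂ)) (_ : ∀ φ ∈ s, φ ∈ F.charts)
    (_ : (s : Set (OpenPartialHomeomorph X ℂ)).PairwiseDisjoint (fun φ => φ.source)),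
    ∑ φ ∈ s, volume φ.target

/-- `σ`, restricted to `[0, 1]`, is a straight segment with holonomy vector `w`: around each
interior time it is affine with velocity `w` in some flat chart. In particular no interior point
is a singularity; endpoints may be. (As `-φ` is a flat chart whenever `φ` is one, `w` is
determined up to sign only.) -/
structure IsSegment (σ : ℝ → X) (w : ℂ) : Prop where
  continuousOn : ContinuousOn σ (Icc 0 1)
  affine : ∀ s ∈ Ioo (0 : ℝ) 1, ∃ φ ∈ F.charts, σ s ∈ φ.source ∧
    ∀ᶠ r in 𝓝 s, φ (σ r) = φ (σ s) + ((r - s : ℝ) : ℂ) * w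

/-- A saddle connection: a geodesic segment joining two singularities, with no singularity in its
interior. -/
structure SaddleConnection where
  path : ℝ → X
  hol : ℂ
  hol_ne_zero : hol ≠ 0
  isSegment : F.IsSegment path hol
  start_mem : path 0 ∈ F.sing
  end_mem : path 1 ∈ F.sing

/-- The width of a vertical strip `P`, i.e. its extent in the horizontal direction: the supremum
of the horizontal components of the straight segments contained in `P`. (The strip is an open
parallelogram with a pair of vertical sides, in general without a horizontal segment that joins
these two sides.) -/
def width (P : Set X) : ℝ≥0∞ :=
  ⨆ (σ : ℝ → X) (w : ℂ) (_ : F.IsSegment σ w) (_ : σ '' Icc 0 1 ⊆ P), ENNReal.ofReal |w.re|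

namespace SaddleConnection

variable {F} (γ : F.SaddleConnection)

/-- The horizontal component `h(γ)`. -/
def h : ℝ := |γ.hol.re|

/-- The vertical component `v(γ)`. -/
def v : ℝ := |γ.hol.im|

def length : ℝ := ‖γ.hol‖

/-- The subset of the surface traced by `γ`. -/
def support : Set X := γ.path '' Icc 0 1

/-- The union `Γ` of `γ` with the segments of critical vertical leaves that start at a singularity
and are extended until they first meet `γ`. -/
def graph : Set X :=
  γ.support ∪ {p | ∃ (σ : ℝ → X) (w : ℂ), F.IsSegment σ w ∧ w ≠ 0 ∧ w.re = 0 ∧ σ 0 ∈ F.sing ∧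
    (∀ s ∈ Ioo (0 : ℝ) 1, σ s ∉ γ.support) ∧ p ∈ σ '' Icc 0 1}

/-- The vertical strips determined by `γ`: the connected components of the complement of `Γ`. -/
def strips : Set (Set X) :=
  {P | ∃ x ∈ γ.graphᶜ, P = connectedComponentIn γ.graphᶜ x}

end SaddleConnection

/-- The Diophantine condition `h(γ) > c / (v(γ) (log v(γ))^ε)` for all saddle connections with
`h(γ) < h₀`. That the right-hand side makes sense, i.e. `v(γ) > 1`, is part of the condition. -/
def Diophantine (h₀ c ε : ℝ) : Prop :=
  ∀ γ : F.SaddleConnection, γ.h < h₀ →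
    1 < γ.v ∧ c / (γ.v * Real.log γ.v ^ ε) < γ.h

end FlatStructure

end

/-!
The complement of the critical graph `Γ` of a saddle connection `γ` is the union of the vertical
leaves between consecutive returns to `γ`, and the return time is constant on each strip. Hence the
number of return times is at most the number `m` of strips.

Suppose that a strip is thinner than `t ^ (-δ)` in `X_t`, and look at it in `X`, where `γ` has
vertical extent at most `κ e ^ (t / 2)` and the strip is thinner than `e ^ (-t / 2) t ^ (-δ)`. Let
`M k = e ^ (t / 2) t ^ (2 k ε - ε + η)` for `0 ≤ k ≤ m`, with `2 m ε + 2 η = δ`. If the return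
time of the strip is at most `M m`, a diagonal of the strip is a saddle connection which is as
narrow as the strip and of vertical extent at most `M m + κ e ^ (t / 2)`. Otherwise, by the
pigeonhole principle, one of the `m` intervals `(M k, M (k + 1)]` contains no return time. Over
the maximal interval of positions around the strip without singularities below height `M k`, no
leaf returns before height `M (k + 1)`. The lower half of the rectangle swept out is embedded, so
that the width of the interval is at most `2 A / M (k + 1)`; the singularities at its two ends span
a saddle connection of that width and of vertical extent at most `M k + κ e ^ (t / 2)`. This is the
dichotomy `exists_short_saddleConnection`. In either case the product of the two extents is at most
`o(1) t ^ (-ε)`, which the Diophantine condition excludes for large `t`, as `log v ≤ t`.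

The geometry is derived from the development of `γ`: the map `devMap` from a plane region, the union
of vertical segments starting on the real axis, which sends the real axis to `γ` and vertical lines
to the vertical leaves through `γ`. Its injectivity on rectangles below the return height bounds
their area (`mul_le_area`) and makes leaves return (`exists_bound_isReturn`). The set of points on
leaves from `γ` is open, and, up to singularities, it is the closure of the set of points on leaves
that return; as the surface is connected, that closure is everything (`closure_returning`,
`compl_graph`). Two singularities facing each other across a rectangle of the development are joined
by its chord (`exists_chord`).

The saddle connection must not be vertical; the Diophantine condition rules out vertical ones, since
its right-hand side is positive (`Diophantine.re_ne_zero`).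

The flat structure enters through `IsHalfTranslation` only: transition maps `± z + c`, and at each
singularity a coordinate `ξ` such that `ξ ^ n` is the square of a flat coordinate. For the flat
structure of `q` this is the local normal form of a quadratic differential
(`AnalyticAt.exists_normalForm`, `Nondegenerate.isHalfTranslation`); `q` is nondegenerate, because
the interior of a saddle connection consists of points where `q` does not vanish.
-/

noncomputable section

open Filter

/-! ### Developing maps of a half-translation structure -/

/-- Induction along a preconnected set: a property that is open and closed in `D` and holds at one
point of `D` holds on all of `D`. -/
theorem IsPreconnected.forall_of_open_closed {V : Type*} [TopologicalSpace V] {D : Set V}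
    (hD : IsPreconnected D) {P : V → Prop}
    (hopen : ∀ z ∈ D, P z → ∀ᶠ z' in 𝓝[D] z, P z')
    (hclosed : ∀ z ∈ D, (∃ᶠ z' in 𝓝[D] z, P z') → P z) {z₀ : V} (hz₀ : z₀ ∈ D) (h₀ : P z₀) :
    ∀ z ∈ D, P z := by
  have : PreconnectedSpace D := isPreconnected_iff_preconnectedSpace.mp hD
  have hcl : IsClopen {z : D | P z} := by
    constructor
    · rw [← isOpen_compl_iff, isOpen_iff_mem_nhds]
      intro z hz
      have h2 : ∀ᶠ z' in 𝓝[D] (z : V), ¬ P z' := by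
        by_contra h
        exact hz (hclosed z z.2 h)
      rw [nhdsWithin_eq_map_subtype_coe z.2] at h2
      exact h2
    · rw [isOpen_iff_mem_nhds]
      intro z hz
      have h2 := hopen z z.2 hz
      rw [nhdsWithin_eq_map_subtype_coe z.2] at h2
      exact h2
  have := hcl.eq_univ ⟨⟨z₀, hz₀⟩, h₀⟩
  intro z hz
  have h3 : (⟨z, hz⟩ : D) ∈ {z : D | P z} := this ▸ mem_univ _
  exact h3

namespace FlatStructure

variable {X : Type*} [TopologicalSpace X]
variable {V : Type*} [NormedAddCommGroup V] [NormedSpace ℝ V]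

/-- A conical coordinate at a singularity `p`: a chart `ξ` onto a disc, vanishing at `p`, such that
`ξ ^ n = ζ ^ 2` for the flat coordinate `ζ` measured from the singularity. Thus `p` is a cone point
of angle `n π`. -/
structure IsCone (F : FlatStructure X) (p : X) (ξ : OpenPartialHomeomorph X ℂ) (r : ℝ) (n : ℕ) :
    Prop where
  sing : p ∈ F.sing
  pos : 0 < r
  n_pos : 0 < n
  mem : p ∈ ξ.source
  map_zero : ξ p = 0
  target : ξ.target = Metric.ball 0 r
  flat : ∀ x ∈ ξ.source, x ≠ p → ∃ φ ∈ F.charts, x ∈ φ.source ∧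
      ∃ b : ℂ, ∀ᶠ y in 𝓝 x, ξ y ^ n = (φ y - b) ^ 2

/-- The properties of the flat structure of a nonzero holomorphic quadratic differential on which
the argument rests. The charts form a maximal atlas, on the complement of the singular set, whose
coordinate changes are locally `z ↦ ± z + b`, and the singularities have conical coordinates. -/
structure IsHalfTranslation (F : FlatStructure X) : Prop where
  transition : ∀ φ ∈ F.charts, ∀ ψ ∈ F.charts, ∀ x ∈ φ.source ∩ ψ.source,
    ∃ s : ℝ, (s = 1 ∨ s = -1) ∧ ∀ᶠ y in 𝓝 x, ψ y = ψ x + s • (φ y - φ x)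
  mem_charts : ∀ e : OpenPartialHomeomorph X ℂ,
    (∀ x ∈ e.source, ∃ φ ∈ F.charts, x ∈ φ.source ∧
      ∃ s : ℝ, (s = 1 ∨ s = -1) ∧ ∃ b : ℂ, ∀ᶠ y in 𝓝 x, e y = s • φ y + b) → e ∈ F.charts
  exists_chart : ∀ p ∉ F.sing, ∃ φ ∈ F.charts, p ∈ φ.source
  notMem_sing : ∀ φ ∈ F.charts, ∀ p ∈ φ.source, p ∉ F.sing
  exists_cone : ∀ p ∈ F.sing, ∃ ξ r n, F.IsCone p ξ r n

/-- `f` is a developing map with linear part `L` near `z`: in some flat chart it is the restriction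
of an affine map with linear part `L`. For `V = ℝ` these are straight paths, for `V = ℂ` and
invertible `L` they are local inverses of flat charts in a linear coordinate. -/
def IsDevAt (F : FlatStructure X) (L : V →L[ℝ] ℂ) (f : V → X) (z : V) : Prop :=
  ∃ φ ∈ F.charts, f z ∈ φ.source ∧
    ∀ᶠ z' in 𝓝 z, f z' ∈ φ.source ∧ φ (f z') = φ (f z) + L (z' - z)

variable {F : FlatStructure X} {L : V →L[ℝ] ℂ} {f g : V → X} {z z₁ : V}

theorem tendsto_affine (L : V →L[ℝ] ℂ) (c : ℂ) (z : V) :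
    Tendsto (fun z' => c + L (z' - z)) (𝓝 z) (𝓝 c) := by
  have : Continuous (fun z' => c + L (z' - z)) := by fun_prop
  simpa using this.tendsto z

theorem IsDevAt.continuousAt (h : F.IsDevAt L f z) : ContinuousAt f z := by
  obtain ⟨φ, hφ, hz, hev⟩ := h
  have h1 : Tendsto (fun z' => φ.symm (φ (f z) + L (z' - z))) (𝓝 z) (𝓝 (f z)) := by
    have h2 := (φ.continuousAt_symm (φ.map_source hz)).tendsto.comp (tendsto_affine L (φ (f z)) z)
    rwa [φ.left_inv hz] at h2
  refine h1.congr' ?_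
  filter_upwards [hev] with z' hz'
  rw [← hz'.2, φ.left_inv hz'.1]

theorem IsDevAt.congr (h : F.IsDevAt L f z) (hfg : f =ᶠ[𝓝 z] g) : F.IsDevAt L g z := by
  obtain ⟨φ, hφ, hz, hev⟩ := h
  refine ⟨φ, hφ, hfg.eq_of_nhds ▸ hz, ?_⟩
  filter_upwards [hev, hfg] with z' h1 h2
  rw [← h2, ← hfg.eq_of_nhds]
  exact h1

theorem IsDevAt.notMem_sing (hF : F.IsHalfTranslation) (h : F.IsDevAt L f z) : f z ∉ F.sing := by
  obtain ⟨φ, hφ, hz, -⟩ := h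
  exact hF.notMem_sing φ hφ _ hz

theorem IsDevAt.exists_sign (hF : F.IsHalfTranslation) (h : F.IsDevAt L f z)
    {ψ : OpenPartialHomeomorph X ℂ} (hψ : ψ ∈ F.charts) (hz : f z ∈ ψ.source) :
    ∃ s : ℝ, (s = 1 ∨ s = -1) ∧
      ∀ᶠ z' in 𝓝 z, f z' ∈ ψ.source ∧ ψ (f z') = ψ (f z) + s • L (z' - z) := by
  have hc := h.continuousAt
  obtain ⟨φ, hφ, hzφ, hev⟩ := h
  obtain ⟨s, hs, hev2⟩ := hF.transition φ hφ ψ hψ (f z) ⟨hzφ, hz⟩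
  refine ⟨s, hs, ?_⟩
  filter_upwards [hev, hc.eventually hev2, hc.eventually (ψ.open_source.mem_nhds hz)]
    with z' h1 h2 h3
  refine ⟨h3, ?_⟩
  rw [h2, h1.2, add_sub_cancel_left]

theorem IsDevAt.comp_affine {U : Type*} [NormedAddCommGroup U] [NormedSpace ℝ U] (A : U →L[ℝ] V)
    {z₀ : V} {u : U} (h : F.IsDevAt L f (z₀ + A u)) :
    F.IsDevAt (L.comp A) (fun u => f (z₀ + A u)) u := by
  obtain ⟨φ, hφ, hz, hev⟩ := h
  refine ⟨φ, hφ, hz, ?_⟩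
  have hc : Tendsto (fun u' => z₀ + A u') (𝓝 u) (𝓝 (z₀ + A u)) := by
    have : Continuous (fun u' => z₀ + A u') := by fun_prop
    exact this.tendsto u
  filter_upwards [hc.eventually hev] with u' hu'
  refine ⟨hu'.1, ?_⟩
  rw [hu'.2]
  simp

theorem IsHalfTranslation.neg_mem (hF : F.IsHalfTranslation) {φ : OpenPartialHomeomorph X ℂ}
    (hφ : φ ∈ F.charts) : φ.transHomeomorph (Homeomorph.neg ℂ) ∈ F.charts := by
  apply hF.mem_charts
  intro x hx
  exact ⟨φ, hφ, hx, -1, Or.inr rfl, 0, by simp⟩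

theorem IsDevAt.neg (hF : F.IsHalfTranslation) (h : F.IsDevAt L f z) : F.IsDevAt (-L) f z := by
  obtain ⟨φ, hφ, hz, hev⟩ := h
  refine ⟨_, hF.neg_mem hφ, hz, ?_⟩
  filter_upwards [hev] with z' hz'
  refine ⟨hz'.1, ?_⟩
  simp only [OpenPartialHomeomorph.transHomeomorph_apply, Function.comp_apply,
    Homeomorph.coe_neg, hz'.2]
  simp
  ring

theorem IsDevAt.eventuallyEq [T2Space X] (hF : F.IsHalfTranslation) (hL : Function.Injective L)
    (hf : F.IsDevAt L f z) (hg : F.IsDevAt L g z) (h : ∃ᶠ z' in 𝓝[≠] z, f z' = g z') :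
    f =ᶠ[𝓝 z] g := by
  have h0 : f z = g z := tendsto_nhds_unique_of_frequently_eq
    (hf.continuousAt.tendsto.mono_left nhdsWithin_le_nhds)
    (hg.continuousAt.tendsto.mono_left nhdsWithin_le_nhds) h
  obtain ⟨φ, hφ, hz, hev⟩ := hf
  obtain ⟨s, hs, hev2⟩ := hg.exists_sign hF hφ (h0 ▸ hz)
  have hs1 : s = 1 := by
    rcases hs with hs | hs
    · exact hs
    exfalso
    have h1 := (h.and_eventually ((hev.and hev2).filter_mono nhdsWithin_le_nhds)).and_eventually
      self_mem_nhdsWithin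
    obtain ⟨z', ⟨h1, h2, h3⟩, h4⟩ := h1.exists
    have h5 : L (z' - z) = s • L (z' - z) := by
      have := h2.2.symm.trans ((congrArg φ h1).trans h3.2)
      rw [h0] at this
      exact add_left_cancel this
    have h6 : L (z' - z) = L 0 := by
      rw [hs, neg_one_smul] at h5
      rw [map_zero]
      exact self_eq_neg.mp h5
    exact h4 (sub_eq_zero.mp (hL h6))
  filter_upwards [hev, hev2] with z' h1 h2
  apply φ.injOn h1.1 h2.1
  rw [h1.2, h2.2, hs1, one_smul, h0]

/-- Two developing maps that agree near one point of a preconnected set agree along that set. -/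
theorem IsDevAt.eventuallyEq_of_isPreconnected [T2Space X] [Nontrivial V]
    (hF : F.IsHalfTranslation) (hL : Function.Injective L) {D : Set V} (hD : IsPreconnected D)
    (hf : ∀ z ∈ D, F.IsDevAt L f z) (hg : ∀ z ∈ D, F.IsDevAt L g z) (hz : z ∈ D)
    (h : f =ᶠ[𝓝 z] g) : ∀ z' ∈ D, f =ᶠ[𝓝 z'] g := by
  refine hD.forall_of_open_closed (P := fun z => f =ᶠ[𝓝 z] g) ?_ ?_ hz h
  · intro z _ h
    exact h.eventuallyEq_nhds.filter_mono nhdsWithin_le_nhds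
  · intro z hz h
    refine (hf z hz).eventuallyEq hF hL (hg z hz) ?_
    rw [frequently_iff]
    intro U hU
    obtain ⟨W, hW, hWo, hzW⟩ := eventually_nhds_iff.mp (mem_nhdsWithin_iff_eventually.mp hU)
    obtain ⟨z', hz', hz'W⟩ := (h.and_eventually
      ((hWo.eventually_mem hzW).filter_mono nhdsWithin_le_nhds)).exists
    have h1 : ∀ᶠ z'' in 𝓝 z', f z'' = g z'' ∧ z'' ∈ W := hz'.and (hWo.eventually_mem hz'W)
    have h2 : ∃ z'', z'' ≠ z ∧ f z'' = g z'' ∧ z'' ∈ W := by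
      by_cases hzz : z' = z
      · have : (𝓝[≠] z').NeBot := inferInstance
        obtain ⟨z'', h3, h4⟩ := ((h1.filter_mono nhdsWithin_le_nhds).and
          (self_mem_nhdsWithin (a := z') (s := {z'}ᶜ))).exists
        exact ⟨z'', hzz ▸ h4, h3⟩
      · exact ⟨z', hzz, h1.self_of_nhds⟩
    obtain ⟨z'', h3, h4, h5⟩ := h2
    exact ⟨z'', hW z'' h5 h3, h4⟩

/-- Two developing maps through the same point differ, locally, by at most a rotation by `π`. -/
theorem IsDevAt.eventually_add_or_sub (hF : F.IsHalfTranslation) (hf : F.IsDevAt L f z)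
    (hg : F.IsDevAt L g z₁) (h : f z = g z₁) :
    (∀ᶠ v in 𝓝 (0 : V), f (z + v) = g (z₁ + v)) ∨ ∀ᶠ v in 𝓝 (0 : V), f (z + v) = g (z₁ - v) := by
  obtain ⟨φ, hφ, hz, hev⟩ := hf
  obtain ⟨s, hs, hev2⟩ := hg.exists_sign hF hφ (h ▸ hz)
  have t1 : Tendsto (fun v : V => z + v) (𝓝 0) (𝓝 z) := by
    have : Continuous (fun v : V => z + v) := by fun_prop
    simpa using this.tendsto 0
  have t2 : Tendsto (fun v : V => z₁ + v) (𝓝 0) (𝓝 z₁) := by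
    have : Continuous (fun v : V => z₁ + v) := by fun_prop
    simpa using this.tendsto 0
  have t3 : Tendsto (fun v : V => z₁ - v) (𝓝 0) (𝓝 z₁) := by
    have : Continuous (fun v : V => z₁ - v) := by fun_prop
    simpa using this.tendsto 0
  rcases hs with rfl | rfl
  · left
    filter_upwards [t1.eventually hev, t2.eventually hev2] with v h1 h2
    apply φ.injOn h1.1 h2.1
    rw [h1.2, h2.2, h]
    simp
  · right
    filter_upwards [t1.eventually hev, t3.eventually hev2] with v h1 h2
    apply φ.injOn h1.1 h2.1
    rw [h1.2, h2.2, h]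
    simp

theorem isDevAt_symm {φ : OpenPartialHomeomorph X ℂ} (hφ : φ ∈ F.charts) (L : V →L[ℝ] ℂ) {c : ℂ}
    {z z₀ : V} (h : c + L (z - z₀) ∈ φ.target) :
    F.IsDevAt L (fun z => φ.symm (c + L (z - z₀))) z := by
  refine ⟨φ, hφ, φ.map_target h, ?_⟩
  have hc : Continuous (fun z => c + L (z - z₀)) := by fun_prop
  filter_upwards [hc.continuousAt.eventually (φ.open_target.mem_nhds h)] with z' hz'
  refine ⟨φ.map_target hz', ?_⟩
  rw [φ.right_inv hz', φ.right_inv h]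
  simp
  ring

theorem IsDevAt.nhds_le_map [CompleteSpace V] (hL : Function.Surjective L)
    (h : F.IsDevAt L f z) : 𝓝 (f z) ≤ map f (𝓝 z) := by
  obtain ⟨φ, hφ, hz, hev⟩ := h
  intro s hs
  have hop : IsOpenMap (fun z' => φ (f z) + L (z' - z)) := by
    have h1 : IsOpenMap (fun z' : V => z' - z) := (Homeomorph.subRight z).isOpenMap
    have h2 : IsOpenMap (fun w : ℂ => φ (f z) + w) := (Homeomorph.addLeft (φ (f z))).isOpenMap
    exact h2.comp ((L.isOpenMap hL).comp h1)
  have h3 := hop.image_mem_nhds (Filter.inter_mem (Filter.mem_map.mp hs) hev)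
  simp only [sub_self, map_zero, add_zero] at h3
  filter_upwards [(φ.continuousAt hz).preimage_mem_nhds h3, φ.open_source.mem_nhds hz] with x hx hx2
  obtain ⟨z', ⟨h4, h5⟩, h6⟩ := hx
  have h7 : f z' = x := φ.injOn h5.1 hx2 (by rw [h5.2]; exact h6)
  rw [← h7]
  exact h4

theorem IsDevAt.exists_injOn (hL : Function.Injective L) (h : F.IsDevAt L f z) :
    ∃ U ∈ 𝓝 z, InjOn f U := by
  obtain ⟨φ, hφ, hz, hev⟩ := h
  refine ⟨_, hev, ?_⟩
  intro a ha b hb hab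
  have h1 := ha.2.symm.trans ((congrArg φ hab).trans hb.2)
  have h2 := hL (add_left_cancel h1)
  exact sub_left_injective h2

theorem isSegment_iff {σ : ℝ → X} {w : ℂ} : F.IsSegment σ w ↔ ContinuousOn σ (Icc 0 1) ∧
    ∀ s ∈ Ioo (0 : ℝ) 1, F.IsDevAt (ContinuousLinearMap.toSpanSingleton ℝ w) σ s := by
  constructor
  · intro h
    refine ⟨h.continuousOn, fun s hs => ?_⟩
    obtain ⟨φ, hφ, hz, hev⟩ := h.affine s hs
    have hc : ContinuousAt σ s := h.continuousOn.continuousAt (Icc_mem_nhds hs.1 hs.2)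
    refine ⟨φ, hφ, hz, ?_⟩
    filter_upwards [hev, hc.eventually (φ.open_source.mem_nhds hz)] with r h1 h2
    refine ⟨h2, ?_⟩
    rw [h1]
    simp
  · intro h
    refine ⟨h.1, fun s hs => ?_⟩
    obtain ⟨φ, hφ, hz, hev⟩ := h.2 s hs
    refine ⟨φ, hφ, hz, ?_⟩
    filter_upwards [hev] with r h1
    rw [h1.2]
    simp

end FlatStructure

namespace FlatStructure

variable {X : Type*} [TopologicalSpace X]

/-! ### Vertical development of a straight path -/

/-- The real-linear map sending the horizontal direction to `w` and fixing the vertical one. -/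
def shearMap (w : ℂ) : ℂ →L[ℝ] ℂ :=
  Complex.reCLM.smulRight w + Complex.imCLM.smulRight Complex.I

theorem shearMap_apply (w z : ℂ) : shearMap w z = z.re • w + z.im • Complex.I := rfl

@[simp] theorem shearMap_re (w z : ℂ) : (shearMap w z).re = z.re * w.re := by
  simp [shearMap_apply]

@[simp] theorem shearMap_im (w z : ℂ) : (shearMap w z).im = z.re * w.im + z.im := by
  simp [shearMap_apply]

theorem shearMap_injective {w : ℂ} (hw : w.re ≠ 0) : Function.Injective (shearMap w) := by
  intro a b hab
  have h1 := congrArg Complex.re hab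
  have h2 := congrArg Complex.im hab
  simp only [shearMap_re, shearMap_im] at h1 h2
  have h3 := mul_right_cancel₀ hw h1
  rw [h3] at h2
  exact Complex.ext h3 (add_left_cancel h2)

theorem shearMap_surjective {w : ℂ} (hw : w.re ≠ 0) : Function.Surjective (shearMap w) := by
  intro a
  refine ⟨⟨a.re / w.re, a.im - a.re / w.re * w.im⟩, ?_⟩
  apply Complex.ext <;> simp [hw]

theorem toSpanSingleton_injective {w : ℂ} (hw : w ≠ 0) :
    Function.Injective (ContinuousLinearMap.toSpanSingleton ℝ w) := by
  intro a b hab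
  simp only [ContinuousLinearMap.toSpanSingleton_apply] at hab
  exact smul_left_injective ℝ hw hab

/-- An open box around the vertical segment joining `z` to the real axis. -/
def devBox (z : ℂ) (η : ℝ) : Set ℂ :=
  {u | |u.re - z.re| < η ∧ min 0 z.im - η < u.im ∧ u.im < max 0 z.im + η}

theorem devBox_eq (z : ℂ) (η : ℝ) : devBox z η =
    Ioo (z.re - η) (z.re + η) ×ℂ Ioo (min 0 z.im - η) (max 0 z.im + η) := by
  ext u
  simp only [devBox, mem_ofPred_eq, Complex.mem_reProdIm, mem_Ioo, abs_lt]
  constructor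
  · rintro ⟨⟨h1, h2⟩, h3, h4⟩
    exact ⟨⟨by linarith, by linarith⟩, h3, h4⟩
  · rintro ⟨⟨h1, h2⟩, h3, h4⟩
    exact ⟨⟨by linarith, by linarith⟩, h3, h4⟩

theorem isOpen_devBox (z : ℂ) (η : ℝ) : IsOpen (devBox z η) := by
  rw [devBox_eq]
  exact isOpen_Ioo.reProdIm isOpen_Ioo

theorem convex_devBox (z : ℂ) (η : ℝ) : Convex ℝ (devBox z η) := by
  rw [devBox_eq]
  exact ((convex_Ioo _ _).is_linear_preimage Complex.reLm.isLinear).inter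
    ((convex_Ioo _ _).is_linear_preimage Complex.imLm.isLinear)

theorem mk_mem_devBox {z : ℂ} {η y : ℝ} (hη : 0 < η) (h1 : min 0 z.im ≤ y) (h2 : y ≤ max 0 z.im) :
    (⟨z.re, y⟩ : ℂ) ∈ devBox z η := by
  refine ⟨by simpa using hη, ?_, ?_⟩ <;> simp only <;> linarith

theorem self_mem_devBox {z : ℂ} {η : ℝ} (hη : 0 < η) : z ∈ devBox z η :=
  mk_mem_devBox hη (min_le_right _ _) (le_max_right _ _)

theorem exists_devBox_subset {z u : ℂ} {η : ℝ} (hu : u ∈ devBox z η) :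
    ∃ η' > 0, η' + |u.re - z.re| ≤ η ∧ devBox u η' ⊆ devBox z η := by
  obtain ⟨h1, h2, h3⟩ := hu
  refine ⟨min (η - |u.re - z.re|) (min (u.im - (min 0 z.im - η)) (max 0 z.im + η - u.im)),
    by simp only [gt_iff_lt, lt_min_iff]; exact ⟨by linarith, by linarith, by linarith⟩, ?_, ?_⟩
  · have := min_le_left (η - |u.re - z.re|)
      (min (u.im - (min 0 z.im - η)) (max 0 z.im + η - u.im))
    linarith
  · set η' := min (η - |u.re - z.re|) (min (u.im - (min 0 z.im - η)) (max 0 z.im + η - u.im))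
      with hη'
    have e1 : η' ≤ η - |u.re - z.re| := min_le_left _ _
    have e2 : η' ≤ u.im - (min 0 z.im - η) := (min_le_right _ _).trans (min_le_left _ _)
    have e3 : η' ≤ max 0 z.im + η - u.im := (min_le_right _ _).trans (min_le_right _ _)
    have e4 : min 0 z.im ≤ 0 := min_le_left _ _
    have e5 : 0 ≤ max 0 z.im := le_max_left _ _
    have e6 := abs_nonneg (u.re - z.re)
    rintro v ⟨g1, g2, g3⟩
    refine ⟨?_, ?_, ?_⟩
    · have := abs_sub_le v.re u.re z.re
      linarith
    · have : min 0 z.im - η ≤ min 0 u.im - η' := by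
        rcases min_choice 0 u.im with h | h <;> rw [h] <;> linarith
      linarith
    · have : max 0 u.im + η' ≤ max 0 z.im + η := by
        rcases max_choice 0 u.im with h | h <;> rw [h] <;> linarith
      linarith

/-- `β`, restricted to `(0, 1)`, is a straight path with velocity `w`. -/
def IsStraight (F : FlatStructure X) (β : ℝ → X) (w : ℂ) : Prop :=
  ∀ x ∈ Ioo (0 : ℝ) 1, F.IsDevAt (ContinuousLinearMap.toSpanSingleton ℝ w) β x

/-- `f` is a developing map on the box of size `η` at `z` that extends `β` on the real axis. -/
structure HasBox (F : FlatStructure X) (β : ℝ → X) (w : ℂ) (z : ℂ) (f : ℂ → X) (η : ℝ) :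
    Prop where
  pos : 0 < η
  dev : ∀ u ∈ devBox z η, F.IsDevAt (shearMap w) f u
  base : ∀ x : ℝ, |x - z.re| < η → x ∈ Ioo (0 : ℝ) 1 ∧ f x = β x

/-- The points reached from `β` by going along vertical leaves without meeting a singularity. The
point `x + i y` stands for the end of the vertical segment of (signed) length `y` starting at
`β x`. -/
def devDomain (F : FlatStructure X) (β : ℝ → X) (w : ℂ) : Set ℂ :=
  {z | ∃ f η, F.HasBox β w z f η}

open Classical in
/-- The vertical development of `β`: the map of `devDomain` to the surface that sends `x + i y` to
the end of the vertical segment of (signed) length `y` starting at `β x`. -/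
def devMap (F : FlatStructure X) (β : ℝ → X) (w : ℂ) (z : ℂ) : X :=
  if h : ∃ f η, F.HasBox β w z f η then h.choose z else β z.re

variable {F : FlatStructure X} {β : ℝ → X} {w : ℂ} {z u : ℂ} {f g : ℂ → X} {η η' : ℝ}

theorem HasBox.restrict (h : F.HasBox β w z f η) (hu : u ∈ devBox z η) :
    ∃ η', F.HasBox β w u f η' := by
  obtain ⟨η', h1, h2, h3⟩ := exists_devBox_subset hu
  refine ⟨η', h1, fun v hv => h.dev v (h3 hv), fun x hx => h.base x ?_⟩
  have := abs_sub_le x u.re z.re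
  linarith

/-- A developing map on a plane region is determined near a point of the real axis by its
restriction to the real axis. -/
theorem IsDevAt.eventuallyEq_of_real [T2Space X] (hF : F.IsHalfTranslation) (hw : w.re ≠ 0) {x : ℝ}
    (hf : F.IsDevAt (shearMap w) f x) (hg : F.IsDevAt (shearMap w) g x)
    (h : ∀ᶠ x' : ℝ in 𝓝 x, f x' = g x') : f =ᶠ[𝓝 (x : ℂ)] g := by
  refine hf.eventuallyEq hF (shearMap_injective hw) hg ?_
  have h1 : Tendsto (fun x' : ℝ => (x' : ℂ)) (𝓝[≠] x) (𝓝[≠] (x : ℂ)) := by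
    refine tendsto_nhdsWithin_iff.mpr
      ⟨(Complex.continuous_ofReal.tendsto x).mono_left nhdsWithin_le_nhds, ?_⟩
    filter_upwards [self_mem_nhdsWithin] with x' hx'
    simpa using hx'
  exact h1.frequently (h.filter_mono nhdsWithin_le_nhds).frequently

theorem HasBox.eventuallyEq [T2Space X] (hF : F.IsHalfTranslation) (hw : w.re ≠ 0)
    (h : F.HasBox β w z f η) (h' : F.HasBox β w z g η') : f =ᶠ[𝓝 z] g := by
  have hm : 0 < min η η' := lt_min h.pos h'.pos
  have hsub : devBox z (min η η') ⊆ devBox z η ∩ devBox z η' := by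
    rintro v ⟨h1, h2, h3⟩
    have e1 := min_le_left η η'
    have e2 := min_le_right η η'
    exact ⟨⟨by linarith, by linarith, by linarith⟩, ⟨by linarith, by linarith, by linarith⟩⟩
  have h0 : (z.re : ℂ) ∈ devBox z (min η η') :=
    mk_mem_devBox hm (min_le_left _ _) (le_max_left _ _)
  refine IsDevAt.eventuallyEq_of_isPreconnected hF (shearMap_injective hw)
    (convex_devBox z (min η η')).isPreconnected
    (fun u hu => h.dev u (hsub hu).1) (fun u hu => h'.dev u (hsub hu).2) h0 ?_ z
    (self_mem_devBox hm)
  refine IsDevAt.eventuallyEq_of_real hF hw (h.dev _ (hsub h0).1) (h'.dev _ (hsub h0).2) ?_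
  have : ∀ᶠ x' : ℝ in 𝓝 z.re, |x' - z.re| < min η η' := by
    have : Continuous (fun x' : ℝ => |x' - z.re|) := by fun_prop
    exact this.continuousAt.eventually (gt_mem_nhds (by simpa using hm))
  filter_upwards [this] with x' hx'
  rw [(h.base x' (hx'.trans_le (min_le_left _ _))).2,
    (h'.base x' (hx'.trans_le (min_le_right _ _))).2]

theorem HasBox.mem_devDomain (h : F.HasBox β w z f η) (hu : u ∈ devBox z η) :
    u ∈ F.devDomain β w := by
  obtain ⟨η', h'⟩ := h.restrict hu
  exact ⟨f, η', h'⟩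

theorem HasBox.devMap_eq [T2Space X] (hF : F.IsHalfTranslation) (hw : w.re ≠ 0)
    (h : F.HasBox β w z f η) (hu : u ∈ devBox z η) : F.devMap β w u = f u := by
  obtain ⟨η', h'⟩ := h.restrict hu
  have h2 : ∃ f η, F.HasBox β w u f η := ⟨f, η', h'⟩
  rw [devMap, dif_pos h2]
  obtain ⟨η'', h3⟩ := h2.choose_spec
  exact (h3.eventuallyEq hF hw h').eq_of_nhds

theorem isOpen_devDomain : IsOpen (F.devDomain β w) := by
  rw [isOpen_iff_mem_nhds]
  rintro z ⟨f, η, h⟩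
  filter_upwards [(isOpen_devBox z η).mem_nhds (self_mem_devBox h.pos)] with u hu
  exact h.mem_devDomain hu

theorem isDevAt_devMap [T2Space X] (hF : F.IsHalfTranslation) (hw : w.re ≠ 0)
    (hz : z ∈ F.devDomain β w) : F.IsDevAt (shearMap w) (F.devMap β w) z := by
  obtain ⟨f, η, h⟩ := hz
  refine (h.dev z (self_mem_devBox h.pos)).congr ?_
  filter_upwards [(isOpen_devBox z η).mem_nhds (self_mem_devBox h.pos)] with u hu
  exact (h.devMap_eq hF hw hu).symm

theorem re_mem_of_mem_devDomain (hz : z ∈ F.devDomain β w) : z.re ∈ Ioo (0 : ℝ) 1 := by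
  obtain ⟨f, η, h⟩ := hz
  exact (h.base z.re (by simpa using h.pos)).1

theorem devMap_ofReal [T2Space X] (hF : F.IsHalfTranslation) (hw : w.re ≠ 0) {x : ℝ}
    (hz : (x : ℂ) ∈ F.devDomain β w) : F.devMap β w x = β x := by
  obtain ⟨f, η, h⟩ := hz
  rw [h.devMap_eq hF hw (self_mem_devBox h.pos)]
  exact (h.base x (by simpa using h.pos)).2

theorem mk_mem_devDomain (hz : z ∈ F.devDomain β w) {y : ℝ} (h1 : min 0 z.im ≤ y)
    (h2 : y ≤ max 0 z.im) : (⟨z.re, y⟩ : ℂ) ∈ F.devDomain β w := by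
  obtain ⟨f, η, h⟩ := hz
  exact h.mem_devDomain (mk_mem_devBox h.pos h1 h2)

theorem ofReal_mem_devDomain (hβ : F.IsStraight β w) {x : ℝ}
    (hx : x ∈ Ioo (0 : ℝ) 1) : (x : ℂ) ∈ F.devDomain β w := by
  obtain ⟨φ, hφ, hz, hev⟩ := hβ x hx
  have hc : Continuous (fun u : ℂ => φ (β x) + shearMap w (u - x)) := by fun_prop
  have h1 : ∀ᶠ u in 𝓝 (x : ℂ), φ (β x) + shearMap w (u - x) ∈ φ.target := by
    refine hc.continuousAt.eventually (φ.open_target.mem_nhds ?_)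
    simpa using φ.map_source hz
  have h2 : ∀ᶠ x' : ℝ in 𝓝 x, x' ∈ Ioo (0 : ℝ) 1 ∧
      (β x' ∈ φ.source ∧ φ (β x') = φ (β x) + ContinuousLinearMap.toSpanSingleton ℝ w (x' - x)) :=
    (isOpen_Ioo.eventually_mem hx).and hev
  obtain ⟨ε₁, hε₁, h1⟩ := Metric.eventually_nhds_iff.mp h1
  obtain ⟨ε₂, hε₂, h2⟩ := Metric.eventually_nhds_iff.mp h2
  refine ⟨fun u => φ.symm (φ (β x) + shearMap w (u - x)), min (ε₁ / 2) ε₂, ?_⟩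
  refine ⟨by positivity, ?_, ?_⟩
  · rintro u ⟨g1, g2, g3⟩
    apply isDevAt_symm hφ
    apply h1
    simp only [Complex.ofReal_re, Complex.ofReal_im, min_self, max_self, zero_add, zero_sub]
      at g1 g2 g3
    have e := min_le_left (ε₁ / 2) ε₂
    have e2 : |u.im| < ε₁ / 2 := abs_lt.mpr ⟨by linarith, by linarith⟩
    rw [Complex.dist_eq]
    refine (Complex.norm_le_abs_re_add_abs_im _).trans_lt ?_
    simp only [Complex.sub_re, Complex.sub_im, Complex.ofReal_re, Complex.ofReal_im, sub_zero]
    linarith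
  · intro x' hx'
    simp only [Complex.ofReal_re] at hx'
    obtain ⟨h3, h4, h5⟩ := h2 (y := x') (by
      rw [Real.dist_eq]
      exact hx'.trans_le (min_le_right _ _))
    refine ⟨h3, ?_⟩
    have : φ (β x) + shearMap w ((x' : ℂ) - x) = φ (β x') := by
      rw [h5]
      simp [shearMap_apply]
    rw [this, φ.left_inv h4]

/-- Going up a vertical leaf, the development can be continued past height `h` as long as the leaf
accumulates there at a nonsingular point. -/
theorem mem_devDomain_of_mapClusterPt [T2Space X] (hF : F.IsHalfTranslation) (hw : w.re ≠ 0)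
    {x h : ℝ} (hh : 0 < h) (hdom : ∀ y ∈ Ico 0 h, (⟨x, y⟩ : ℂ) ∈ F.devDomain β w) {p : X}
    (hp : p ∉ F.sing) (hcl : MapClusterPt p (𝓝[<] h) (fun y : ℝ => F.devMap β w ⟨x, y⟩)) :
    (⟨x, h⟩ : ℂ) ∈ F.devDomain β w := by
  obtain ⟨ψ, hψ, hpψ⟩ := hF.exists_chart p hp
  obtain ⟨r, hr, hball⟩ := Metric.isOpen_iff.mp ψ.open_target _ (ψ.map_source hpψ)
  -- `shearMap w` shrinks a ball of radius `ρ` into a ball of radius `r / 2`.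
  obtain ⟨ρ, hρ, hLρ⟩ : ∃ ρ > 0, ∀ v : ℂ, ‖v‖ < ρ → ‖shearMap w v‖ < r / 2 := by
    have h1 := (shearMap w).continuous.tendsto 0
    rw [map_zero] at h1
    obtain ⟨ρ, hρ, h2⟩ := Metric.eventually_nhds_iff.mp
      (h1.eventually (Metric.ball_mem_nhds (0 : ℂ) (half_pos hr)))
    refine ⟨ρ, hρ, fun v hv => ?_⟩
    simpa using h2 (y := v) (by simpa using hv)
  have hN : ψ.source ∩ ψ ⁻¹' Metric.ball (ψ p) (r / 2) ∈ 𝓝 p :=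
    inter_mem (ψ.open_source.mem_nhds hpψ)
      ((ψ.continuousAt hpψ).preimage_mem_nhds (Metric.ball_mem_nhds _ (half_pos hr)))
  have hlt : ∀ᶠ y in 𝓝[<] h, y ∈ Ioo (max 0 (h - ρ / 2)) h :=
    Ioo_mem_nhdsLT (max_lt hh (by linarith))
  obtain ⟨y, ⟨hy1, hy2⟩, hy3, hy4⟩ :=
    ((mapClusterPt_iff_frequently.mp hcl _ hN).and_eventually hlt).exists
  have hy0 : 0 < y := (le_max_left _ _).trans_lt hy3
  have hyρ : h - ρ / 2 < y := (le_max_right _ _).trans_lt hy3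
  set z : ℂ := ⟨x, y⟩ with hzdef
  obtain ⟨f, η, hbox⟩ := hdom y ⟨hy0.le, hy4⟩
  have hfz : F.devMap β w z = f z := hbox.devMap_eq hF hw (self_mem_devBox hbox.pos)
  rw [hfz] at hy1 hy2
  obtain ⟨s, hs, hev⟩ := (hbox.dev z (self_mem_devBox hbox.pos)).exists_sign hF hψ hy1
  let g : ℂ → X := fun u => ψ.symm (ψ (f z) + (s • shearMap w) (u - z))
  have hgball : ∀ u ∈ Metric.ball z ρ, ψ (f z) + (s • shearMap w) (u - z) ∈ ψ.target := by
    intro u hu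
    apply hball
    have e1 := hLρ (u - z) (by simpa [Complex.dist_eq] using hu)
    have e2 : ‖(s • shearMap w) (u - z)‖ = ‖shearMap w (u - z)‖ := by
      rw [smul_apply, norm_smul]
      rcases hs with rfl | rfl <;> simp
    rw [mem_preimage, Metric.mem_ball, dist_eq_norm] at hy2
    rw [Metric.mem_ball, dist_eq_norm]
    calc ‖ψ (f z) + (s • shearMap w) (u - z) - ψ p‖
        = ‖(ψ (f z) - ψ p) + (s • shearMap w) (u - z)‖ := by congr 1; ring
      _ ≤ ‖ψ (f z) - ψ p‖ + ‖(s • shearMap w) (u - z)‖ := norm_add_le _ _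
      _ < r := by rw [e2]; linarith
  have hgdev : ∀ u ∈ Metric.ball z ρ, F.IsDevAt (shearMap w) g u := by
    intro u hu
    have h1 : F.IsDevAt (s • shearMap w) g u := isDevAt_symm hψ _ (hgball u hu)
    rcases hs with rfl | rfl
    · simpa using h1
    · have h2 := h1.neg hF
      convert h2 using 1
      ext v
      simp
  have hfg : f =ᶠ[𝓝 z] g := by
    filter_upwards [hev] with u hu
    change f u = ψ.symm (ψ (f z) + (s • shearMap w) (u - z))
    rw [smul_apply, ← hu.2, ψ.left_inv hu.1]
  have hagree : ∀ u ∈ devBox z η ∩ Metric.ball z ρ, f =ᶠ[𝓝 u] g :=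
    IsDevAt.eventuallyEq_of_isPreconnected hF (shearMap_injective hw)
      ((convex_devBox z η).inter (convex_ball z ρ)).isPreconnected
      (fun u hu => hbox.dev u hu.1) (fun u hu => hgdev u hu.2)
      ⟨self_mem_devBox hbox.pos, Metric.mem_ball_self hρ⟩ hfg
  classical
  let k : ℂ → X := fun u => if u ∈ devBox z η then f u else g u
  have hkf : ∀ u ∈ devBox z η, k =ᶠ[𝓝 u] f := by
    intro u hu
    filter_upwards [(isOpen_devBox z η).mem_nhds hu] with v hv
    exact if_pos hv
  have hkg : ∀ u ∈ Metric.ball z ρ, k =ᶠ[𝓝 u] g := by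
    intro u hu
    filter_upwards [Metric.isOpen_ball.mem_nhds hu] with v hv
    by_cases hv' : v ∈ devBox z η
    · exact (if_pos hv').trans (hagree v ⟨hv', hv⟩).eq_of_nhds
    · exact if_neg hv'
  refine ⟨k, min η (min (ρ / 4) y), ?_, ?_, ?_⟩
  · exact lt_min hbox.pos (lt_min (by linarith) hy0)
  · rintro u ⟨g1, g2, g3⟩
    have e1 := min_le_left η (min (ρ / 4) y)
    have e2 : min η (min (ρ / 4) y) ≤ ρ / 4 := (min_le_right _ _).trans (min_le_left _ _)
    simp only [min_eq_left hh.le, max_eq_right hh.le] at g1 g2 g3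
    by_cases hu : u.im < y + η
    · have : u ∈ devBox z η := by
        refine ⟨by simp only [hzdef]; linarith, ?_, ?_⟩
        · simp only [hzdef, min_eq_left hy0.le]; linarith
        · simp only [hzdef, max_eq_right hy0.le]; linarith
      exact (hbox.dev u this).congr (hkf u this).symm
    · have : u ∈ Metric.ball z ρ := by
        rw [Metric.mem_ball, Complex.dist_eq]
        refine (Complex.norm_le_abs_re_add_abs_im _).trans_lt ?_
        simp only [Complex.sub_re, Complex.sub_im, hzdef]
        have e3 : |u.im - y| < 3 * ρ / 4 := by
          rw [abs_lt]
          have := hbox.pos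
          constructor <;> linarith
        linarith
      exact (hgdev u this).congr (hkg u this).symm
  · intro x' hx'
    simp only at hx'
    have h1 := hbox.base x' (hx'.trans_le (min_le_left _ _))
    refine ⟨h1.1, ?_⟩
    have : (x' : ℂ) ∈ devBox z η := by
      refine ⟨by simpa [hzdef] using hx'.trans_le (min_le_left _ _), ?_, ?_⟩
      · simp [hzdef, min_eq_left hy0.le, hbox.pos]
      · simp only [hzdef, max_eq_right hy0.le, Complex.ofReal_im]
        have := hbox.pos
        linarith
    change (if (x' : ℂ) ∈ devBox z η then f x' else g x') = _
    rw [if_pos this]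
    exact h1.2

/-! ### Reversal of the base path -/

theorem IsStraight.reverse (hF : F.IsHalfTranslation) (hβ : F.IsStraight β w) :
    F.IsStraight (fun x => β (1 - x)) w := by
  intro x hx
  have h1 : (1 : ℝ) - x ∈ Ioo (0 : ℝ) 1 := ⟨by linarith [hx.2], by linarith [hx.1]⟩
  have h2 := hβ _ h1
  have h3 : F.IsDevAt (ContinuousLinearMap.toSpanSingleton ℝ w) β
      (1 + (-ContinuousLinearMap.id ℝ ℝ) x) := by
    simpa [sub_eq_add_neg] using h2
  have h4 := (h3.comp_affine).neg hF
  have e1 : -((ContinuousLinearMap.toSpanSingleton ℝ w).comp (-ContinuousLinearMap.id ℝ ℝ)) =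
      ContinuousLinearMap.toSpanSingleton ℝ w := by
    ext; simp
  rw [e1] at h4
  simpa [sub_eq_add_neg] using h4

theorem HasBox.reverse (hF : F.IsHalfTranslation) (h : F.HasBox β w z f η) :
    F.HasBox (fun x => β (1 - x)) w (1 - z) (fun u => f (1 - u)) η := by
  refine ⟨h.pos, ?_, ?_⟩
  · rintro u ⟨h1, h2, h3⟩
    have hu : 1 - u ∈ devBox z η := by
      simp only [Complex.sub_re, Complex.one_re, Complex.sub_im, Complex.one_im, zero_sub]
        at h1 h2 h3
      refine ⟨?_, ?_, ?_⟩
      · rw [← abs_neg]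
        convert h1 using 2
        simp
        ring
      · have := max_neg_neg 0 z.im
        rw [neg_zero] at this
        simp
        linarith
      · have := min_neg_neg 0 z.im
        rw [neg_zero] at this
        simp
        linarith
    have h3 : F.IsDevAt (shearMap w) f (1 + (-ContinuousLinearMap.id ℝ ℂ) u) := by
      simpa [sub_eq_add_neg] using h.dev _ hu
    have h4 := (h3.comp_affine).neg hF
    have e1 : -((shearMap w).comp (-ContinuousLinearMap.id ℝ ℂ)) = shearMap w := by
      ext u; simp
    rw [e1] at h4
    simpa [sub_eq_add_neg] using h4
  · intro x hx
    have h1 := h.base (1 - x) (by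
      rw [← abs_neg]
      convert hx using 2
      simp
      ring)
    refine ⟨⟨by linarith [h1.1.2], by linarith [h1.1.1]⟩, ?_⟩
    have := h1.2
    push_cast at this
    exact this

theorem one_sub_mem_devDomain (hF : F.IsHalfTranslation) (hz : z ∈ F.devDomain β w) :
    1 - z ∈ F.devDomain (fun x => β (1 - x)) w := by
  obtain ⟨f, η, h⟩ := hz
  exact ⟨_, η, h.reverse hF⟩

theorem devMap_reverse [T2Space X] (hF : F.IsHalfTranslation) (hw : w.re ≠ 0)
    (hz : z ∈ F.devDomain β w) :
    F.devMap (fun x => β (1 - x)) w (1 - z) = F.devMap β w z := by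
  obtain ⟨f, η, h⟩ := hz
  rw [h.devMap_eq hF hw (self_mem_devBox h.pos),
    (h.reverse hF).devMap_eq hF hw (self_mem_devBox h.pos)]
  simp

end FlatStructure

namespace FlatStructure

variable {X : Type*} [TopologicalSpace X]
variable {V : Type*} [NormedAddCommGroup V] [NormedSpace ℝ V]
variable {F : FlatStructure X} {β : ℝ → X} {w : ℂ}
variable {p : X} {ξ : OpenPartialHomeomorph X ℂ} {r : ℝ} {n : ℕ}

/-! ### Behaviour near a singularity -/

namespace IsCone

theorem notMem_sing (hF : F.IsHalfTranslation) (hc : F.IsCone p ξ r n) {x : X} (hx : x ∈ ξ.source)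
    (hxp : x ≠ p) : x ∉ F.sing := by
  obtain ⟨φ, hφ, h, -⟩ := hc.flat x hx hxp
  exact hF.notMem_sing φ hφ x h

theorem exists_radius (hc : F.IsCone p ξ r n) {U : Set X} (hU : U ∈ 𝓝 p) :
    ∃ ρ > 0, ρ < r ∧ ∀ x ∈ ξ.source, ‖ξ x‖ < ρ → x ∈ U := by
  have h1 : ξ.symm ⁻¹' U ∈ 𝓝 (0 : ℂ) := by
    have h2 := ξ.continuousAt_symm (ξ.map_source hc.mem)
    rw [hc.map_zero] at h2
    apply h2
    rwa [← hc.map_zero, ξ.left_inv hc.mem]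
  obtain ⟨ε, hε, h2⟩ := Metric.mem_nhds_iff.mp h1
  refine ⟨min ε (r / 2), lt_min hε (half_pos hc.pos),
    (min_le_right _ _).trans_lt (half_lt_self hc.pos), fun x hx hxε => ?_⟩
  have h3 := h2 (show ξ x ∈ Metric.ball 0 ε by simpa using hxε.trans_le (min_le_left _ _))
  rwa [mem_preimage, ξ.left_inv hx] at h3

theorem isOpen_ball (ρ : ℝ) : IsOpen {x | x ∈ ξ.source ∧ ‖ξ x‖ < ρ} := by
  have h := ξ.isOpen_inter_preimage (Metric.isOpen_ball (x := (0 : ℂ)) (ε := ρ))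
  convert h using 1
  ext x
  simp

theorem ball_mem_nhds (hc : F.IsCone p ξ r n) {ρ : ℝ} (hρ : 0 < ρ) :
    {x | x ∈ ξ.source ∧ ‖ξ x‖ < ρ} ∈ 𝓝 p :=
  (isOpen_ball ρ).mem_nhds ⟨hc.mem, by simpa [hc.map_zero] using hρ⟩

/-- Compact subsets of the disc pull back to compact subsets of the surface. -/
theorem isCompact_preimage [T2Space X] (hc : F.IsCone p ξ r n) {K : Set ℂ} (hK : IsCompact K)
    (hKr : ∀ z ∈ K, ‖z‖ < r) : IsCompact {x | x ∈ ξ.source ∧ ξ x ∈ K} := by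
  have hsub : K ⊆ ξ.target := by
    rw [hc.target]
    intro z hz
    simpa using hKr z hz
  have h1 : IsCompact (ξ.symm '' K) := hK.image_of_continuousOn (ξ.continuousOn_symm.mono hsub)
  convert h1 using 1
  ext x
  constructor
  · rintro ⟨h2, h3⟩
    exact ⟨ξ x, h3, ξ.left_inv h2⟩
  · rintro ⟨z, hz, rfl⟩
    exact ⟨ξ.map_target (hsub hz), by rwa [ξ.right_inv (hsub hz)]⟩

/-- Along a developing map, the function `ξ ^ n` is the square of a flat coordinate. -/
theorem exists_eq_sq [Nontrivial V] (hF : F.IsHalfTranslation) (hc : F.IsCone p ξ r n)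
    {L : V →L[ℝ] ℂ} (hL : Function.Injective L) {D : Set V} (hD : IsPreconnected D) {f : V → X}
    (hf : ∀ z ∈ D, F.IsDevAt L f z) (hsrc : ∀ z ∈ D, f z ∈ ξ.source) :
    ∃ b : ℂ, ∀ z ∈ D, ∀ᶠ z' in 𝓝 z, ξ (f z') ^ n = (L z' - b) ^ 2 := by
  have hloc : ∀ z ∈ D, ∃ b : ℂ, ∀ᶠ z' in 𝓝 z, ξ (f z') ^ n = (L z' - b) ^ 2 := by
    intro z hz
    have hns := (hf z hz).notMem_sing hF
    obtain ⟨φ, hφ, hzφ, b, hb⟩ := hc.flat (f z) (hsrc z hz) (fun h => hns (h ▸ hc.sing))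
    obtain ⟨s, hs, hev⟩ := (hf z hz).exists_sign hF hφ hzφ
    refine ⟨L z - s • (φ (f z) - b), ?_⟩
    filter_upwards [(hf z hz).continuousAt.eventually hb, hev] with z' h1 h2
    rw [h1, h2.2]
    rcases hs with rfl | rfl
    · simp
      ring
    · simp
      ring
  rcases D.eq_empty_or_nonempty with rfl | ⟨z₀, hz₀⟩
  · exact ⟨0, by simp⟩
  obtain ⟨b, hb⟩ := hloc z₀ hz₀
  refine ⟨b, hD.forall_of_open_closed
    (P := fun z => ∀ᶠ z' in 𝓝 z, ξ (f z') ^ n = (L z' - b) ^ 2) ?_ ?_ hz₀ hb⟩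
  · intro z _ h
    exact (eventually_eventually_nhds.mpr h).filter_mono nhdsWithin_le_nhds
  · intro z hz h
    obtain ⟨b₁, hb₁⟩ := hloc z hz
    have h1 := h.and_eventually
      ((eventually_eventually_nhds.mpr hb₁).filter_mono nhdsWithin_le_nhds)
    obtain ⟨z', h2, h3⟩ := h1.exists
    have hbb : b = b₁ := by
      by_contra hne
      have h4 : ∀ᶠ z'' in 𝓝 z', L z'' = (b + b₁) / 2 := by
        filter_upwards [h2, h3] with z'' h5 h6
        have h7 : (b₁ - b) * (2 * L z'' - (b + b₁)) = 0 := by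
          linear_combination h6 - h5
        rcases mul_eq_zero.mp h7 with h8 | h8
        · exact absurd (sub_eq_zero.mp h8).symm hne
        · linear_combination h8 / 2
      have h5 := h4.self_of_nhds
      have : (𝓝[≠] z').NeBot := inferInstance
      obtain ⟨z'', h6, h7⟩ := ((h4.filter_mono nhdsWithin_le_nhds).and
        (self_mem_nhdsWithin (a := z') (s := {z'}ᶜ))).exists
      exact h7 (hL (h6.trans h5.symm))
    rw [hbb]
    exact hb₁

/-- A short straight path that starts near a singularity stays near it: by `exists_eq_sq`, the
square root of `ξ ^ n` varies along the path by at most `‖b‖`. -/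
theorem stay [T2Space X] (hF : F.IsHalfTranslation) (hc : F.IsCone p ξ r n) {b : ℂ} (hb : b ≠ 0)
    {c : ℝ → X}
    (hdev : ∀ θ ∈ Icc (0 : ℝ) 1, F.IsDevAt (ContinuousLinearMap.toSpanSingleton ℝ b) c θ)
    (h0 : c 0 ∈ ξ.source) {d ρ : ℝ} (hd0 : 0 ≤ d) (hd : ‖ξ (c 0)‖ ^ n ≤ d ^ 2) (hρ0 : 0 ≤ ρ)
    (hρ : ρ ≤ r) (hlt : (‖b‖ + d) ^ 2 < ρ ^ n) :
    ∀ θ ∈ Icc (0 : ℝ) 1, c θ ∈ ξ.source ∧ ‖ξ (c θ)‖ < ρ := by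
  have hcont : ContinuousOn c (Icc 0 1) := fun θ hθ => (hdev θ hθ).continuousAt.continuousWithinAt
  set U : Set X := {x | x ∈ ξ.source ∧ ‖ξ x‖ < ρ} with hU
  by_contra hcon
  push Not at hcon
  have hne : (Icc (0 : ℝ) 1 ∩ c ⁻¹' Uᶜ).Nonempty := by
    obtain ⟨θ, hθ, h1⟩ := hcon
    exact ⟨θ, hθ, fun h2 => absurd h2.2 (not_lt.mpr (h1 h2.1))⟩
  have hclosed : IsClosed (Icc (0 : ℝ) 1 ∩ c ⁻¹' Uᶜ) :=
    hcont.preimage_isClosed_of_isClosed isClosed_Icc (isOpen_ball ρ).isClosed_compl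
  obtain ⟨θ, ⟨hθ, hθU⟩, hmin⟩ := (isCompact_Icc.of_isClosed_subset hclosed
    inter_subset_left).exists_isLeast hne
  have hbn : 0 < ‖b‖ := norm_pos_iff.mpr hb
  have hθ0 : 0 < θ := by
    rcases hθ.1.lt_or_eq with h | h
    · exact h
    exfalso
    rw [← h] at hθU
    refine hθU ⟨h0, lt_of_pow_lt_pow_left₀ n hρ0 (hd.trans_lt (lt_of_le_of_lt ?_ hlt))⟩
    exact pow_le_pow_left₀ hd0 (by linarith) 2
  have hlow : ∀ s ∈ Ico 0 θ, c s ∈ U := by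
    intro s hs
    by_contra h
    exact absurd (hmin ⟨⟨hs.1, hs.2.le.trans hθ.2⟩, h⟩) (not_le.mpr hs.2)
  obtain ⟨e, he⟩ := hc.exists_eq_sq hF (toSpanSingleton_injective hb)
    (isPreconnected_Ico (a := (0 : ℝ)) (b := θ))
    (fun s hs => hdev s ⟨hs.1, hs.2.le.trans hθ.2⟩) (fun s hs => (hlow s hs).1)
  have he0 : ‖e‖ ≤ d := by
    have h1 := congrArg norm (he 0 ⟨le_rfl, hθ0⟩).self_of_nhds
    simp only [ContinuousLinearMap.toSpanSingleton_apply, zero_smul, zero_sub, norm_pow,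
      norm_neg] at h1
    rw [h1] at hd
    exact abs_le_of_sq_le_sq' hd hd0 |>.2
  have hK : IsCompact {x | x ∈ ξ.source ∧ ξ x ∈ {z : ℂ | ‖z‖ ^ n ≤ (‖b‖ + d) ^ 2}} := by
    have hlt' : ∀ z ∈ {z : ℂ | ‖z‖ ^ n ≤ (‖b‖ + d) ^ 2}, ‖z‖ < ρ := fun z hz =>
      lt_of_pow_lt_pow_left₀ n hρ0 (lt_of_le_of_lt hz hlt)
    refine hc.isCompact_preimage ?_ (fun z hz => (hlt' z hz).trans_le hρ)
    refine (isCompact_closedBall (0 : ℂ) ρ).of_isClosed_subset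
      (isClosed_le (by fun_prop) continuous_const) ?_
    intro z hz
    simpa using (hlt' z hz).le
  have hmem : ∀ᶠ s in 𝓝[<] θ,
      c s ∈ {x | x ∈ ξ.source ∧ ξ x ∈ {z : ℂ | ‖z‖ ^ n ≤ (‖b‖ + d) ^ 2}} := by
    filter_upwards [Ico_mem_nhdsLT hθ0] with s hs
    refine ⟨(hlow s hs).1, ?_⟩
    have h1 := congrArg norm (he s hs).self_of_nhds
    simp only [ContinuousLinearMap.toSpanSingleton_apply, norm_pow] at h1
    change ‖ξ (c s)‖ ^ n ≤ (‖b‖ + d) ^ 2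
    rw [h1]
    refine pow_le_pow_left₀ (norm_nonneg _) ((norm_sub_le _ _).trans (add_le_add ?_ he0)) 2
    rw [norm_smul, Real.norm_of_nonneg hs.1]
    exact mul_le_of_le_one_left hbn.le (hs.2.le.trans hθ.2)
  have hlim := hK.isClosed.mem_of_tendsto
    ((hdev θ hθ).continuousAt.tendsto.mono_left nhdsWithin_le_nhds) hmem
  exact hθU ⟨hlim.1, lt_of_pow_lt_pow_left₀ n hρ0 (lt_of_le_of_lt hlim.2 hlt)⟩

end IsCone

/-- A path whose cluster points at the end of its interval of definition are all singularities
converges to one of them. -/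
theorem exists_tendsto_sing [T2Space X] [CompactSpace X] (hF : F.IsHalfTranslation) {a h : ℝ}
    (hah : a < h) {u : ℝ → X} (hu : ContinuousOn u (Ico a h))
    (hcl : ∀ p, MapClusterPt p (𝓝[<] h) u → p ∈ F.sing) :
    ∃ p ∈ F.sing, Tendsto u (𝓝[<] h) (𝓝 p) := by
  obtain ⟨p, hp⟩ := exists_clusterPt_of_compactSpace (map u (𝓝[<] h))
  have hps := hcl p hp
  refine ⟨p, hps, ?_⟩
  obtain ⟨ξ, r, n, hc⟩ := hF.exists_cone p hps
  intro U hU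
  obtain ⟨ρ, hρ, hρr, hρU⟩ := hc.exists_radius hU
  have hKs : IsCompact {x | x ∈ ξ.source ∧ ξ x ∈ Metric.sphere (0 : ℂ) ρ} :=
    hc.isCompact_preimage (isCompact_sphere _ _) (fun z hz => by
      rw [mem_sphere_zero_iff_norm] at hz
      rwa [hz])
  have hKb : IsCompact {x | x ∈ ξ.source ∧ ξ x ∈ Metric.closedBall (0 : ℂ) ρ} :=
    hc.isCompact_preimage (isCompact_closedBall _ _) (fun z hz => by
      rw [mem_closedBall_zero_iff] at hz
      exact hz.trans_lt hρr)
  have hev : ∀ᶠ y in 𝓝[<] h, u y ∉ {x | x ∈ ξ.source ∧ ξ x ∈ Metric.sphere (0 : ℂ) ρ} := by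
    by_contra hcon
    obtain ⟨x, hx, hx2⟩ := hKs.exists_mapClusterPt_of_frequently hcon
    refine hc.notMem_sing hF hx.1 ?_ (hcl x hx2)
    rintro rfl
    have := hx.2
    rw [hc.map_zero, mem_sphere_zero_iff_norm, norm_zero] at this
    exact hρ.ne this
  obtain ⟨y₁, hy₁, hy₁h⟩ := (mem_nhdsLT_iff_exists_Ioo_subset' hah).mp hev
  set y₂ := max a y₁ with hy₂
  have hy₂h : y₂ < h := max_lt hah hy₁
  have hfreq := mapClusterPt_iff_frequently.mp hp _ (hc.ball_mem_nhds hρ)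
  obtain ⟨y₃, hy₃, hy₃m⟩ := (hfreq.and_eventually (Ioo_mem_nhdsLT hy₂h)).exists
  have hsub : u '' Ioo y₂ h ⊆ {x | x ∈ ξ.source ∧ ‖ξ x‖ < ρ} := by
    have hpre : IsPreconnected (u '' Ioo y₂ h) :=
      isPreconnected_Ioo.image u (hu.mono (fun y hy => ⟨(le_max_left _ _).trans hy.1.le, hy.2⟩))
    refine IsPreconnected.subset_left_of_subset_union (IsCone.isOpen_ball ρ)
      hKb.isClosed.isOpen_compl ?_ ?_ ⟨_, ⟨y₃, hy₃m, rfl⟩, hy₃⟩ hpre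
    · rw [disjoint_compl_right_iff_subset]
      rintro x ⟨h1, h2⟩
      exact ⟨h1, by simpa using h2.le⟩
    · rintro _ ⟨y, hy, rfl⟩
      by_cases h1 : u y ∈ {x | x ∈ ξ.source ∧ ξ x ∈ Metric.closedBall (0 : ℂ) ρ}
      · left
        refine ⟨h1.1, lt_of_le_of_ne (by simpa using h1.2) ?_⟩
        intro h2
        refine hy₁h ⟨(le_max_right _ _).trans_lt hy.1, hy.2⟩ ⟨h1.1, by simpa using h2⟩
      · exact Or.inr h1
  rw [mem_map]
  filter_upwards [Ioo_mem_nhdsLT hy₂h] with y hy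
  obtain ⟨h1, h2⟩ := hsub ⟨y, hy, rfl⟩
  exact hρU _ h1 h2

/-- The upward vertical leaf from `β x` ends, at height `h`, at the singularity `p`. -/
structure IsTop (F : FlatStructure X) (β : ℝ → X) (w : ℂ) (x h : ℝ) (p : X) : Prop where
  pos : 0 < h
  dom : ∀ y ∈ Ico 0 h, (⟨x, y⟩ : ℂ) ∈ F.devDomain β w
  sing : p ∈ F.sing
  tendsto : Tendsto (fun y : ℝ => F.devMap β w ⟨x, y⟩) (𝓝[<] h) (𝓝 p)

theorem continuous_mk (x : ℝ) : Continuous (fun y : ℝ => (⟨x, y⟩ : ℂ)) := by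
  simp only [Complex.mk_eq_add_mul_I]
  fun_prop

theorem continuous_mk' (y : ℝ) : Continuous (fun x : ℝ => (⟨x, y⟩ : ℂ)) := by
  simp only [Complex.mk_eq_add_mul_I]
  fun_prop

theorem mk_mem_devDomain_of_le {x y y' : ℝ} (hz : (⟨x, y⟩ : ℂ) ∈ F.devDomain β w) (h0 : 0 ≤ y')
    (h : y' ≤ y) : (⟨x, y'⟩ : ℂ) ∈ F.devDomain β w :=
  mk_mem_devDomain hz ((min_le_left _ _).trans h0) (h.trans (le_max_right _ _))

theorem continuousAt_devMap_mk [T2Space X] (hF : F.IsHalfTranslation) (hw : w.re ≠ 0) {x y : ℝ}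
    (hz : (⟨x, y⟩ : ℂ) ∈ F.devDomain β w) :
    ContinuousAt (fun y : ℝ => F.devMap β w ⟨x, y⟩) y :=
  ContinuousAt.comp (f := fun y : ℝ => (⟨x, y⟩ : ℂ)) (isDevAt_devMap hF hw hz).continuousAt
    (continuous_mk x).continuousAt

/-- A vertical leaf goes up forever or ends at a singularity. -/
theorem forall_mem_or_exists_isTop [T2Space X] [CompactSpace X] (hF : F.IsHalfTranslation)
    (hw : w.re ≠ 0) (hβ : F.IsStraight β w) {x : ℝ} (hx : x ∈ Ioo (0 : ℝ) 1) :
    (∀ y : ℝ, 0 ≤ y → (⟨x, y⟩ : ℂ) ∈ F.devDomain β w) ∨ ∃ h p, F.IsTop β w x h p := by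
  by_cases hall : ∀ y : ℝ, 0 ≤ y → (⟨x, y⟩ : ℂ) ∈ F.devDomain β w
  · exact Or.inl hall
  right
  have hcl : IsClosed (Ici (0 : ℝ) ∩ (fun y : ℝ => (⟨x, y⟩ : ℂ)) ⁻¹' (F.devDomain β w)ᶜ) :=
    isClosed_Ici.inter (isOpen_devDomain.isClosed_compl.preimage (continuous_mk x))
  have hne : (Ici (0 : ℝ) ∩ (fun y : ℝ => (⟨x, y⟩ : ℂ)) ⁻¹' (F.devDomain β w)ᶜ).Nonempty := by
    push Not at hall
    obtain ⟨y, h1, h2⟩ := hall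
    exact ⟨y, h1, h2⟩
  have hbdd : BddBelow (Ici (0 : ℝ) ∩ (fun y : ℝ => (⟨x, y⟩ : ℂ)) ⁻¹' (F.devDomain β w)ᶜ) :=
    ⟨0, fun y hy => hy.1⟩
  have hmem := hcl.csInf_mem hne hbdd
  set h := sInf (Ici (0 : ℝ) ∩ (fun y : ℝ => (⟨x, y⟩ : ℂ)) ⁻¹' (F.devDomain β w)ᶜ) with hh
  have hbase : (⟨x, 0⟩ : ℂ) ∈ F.devDomain β w := ofReal_mem_devDomain hβ hx
  have hpos : 0 < h := by
    rcases (mem_Ici.mp hmem.1).lt_or_eq with h1 | h1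
    · exact h1
    · exfalso
      have := hmem.2
      rw [← h1] at this
      exact this hbase
  have hdom : ∀ y ∈ Ico 0 h, (⟨x, y⟩ : ℂ) ∈ F.devDomain β w := by
    intro y hy
    by_contra h1
    exact absurd (csInf_le hbdd ⟨hy.1, h1⟩) (not_le.mpr hy.2)
  obtain ⟨p, hp, hpt⟩ := exists_tendsto_sing hF hpos
    (fun y hy => (continuousAt_devMap_mk hF hw (hdom y hy)).continuousWithinAt)
    (fun p hp => by
      by_contra hps
      exact hmem.2 (mem_devDomain_of_mapClusterPt hF hw hpos hdom hps hp))
  exact ⟨h, p, hpos, hdom, hp, hpt⟩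

theorem IsTop.lt_of_mem [T2Space X] (hF : F.IsHalfTranslation) (hw : w.re ≠ 0) {x h y : ℝ}
    (ht : F.IsTop β w x h p) (hy : (⟨x, y⟩ : ℂ) ∈ F.devDomain β w) : y < h := by
  by_contra hcon
  have h1 := mk_mem_devDomain_of_le hy ht.pos.le (not_lt.mp hcon)
  have h2 := (continuousAt_devMap_mk hF hw h1).tendsto.mono_left
    (nhdsWithin_le_nhds (s := Iio h))
  have h3 := tendsto_nhds_unique h2 ht.tendsto
  exact (isDevAt_devMap hF hw h1).notMem_sing hF (h3 ▸ ht.sing)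

theorem IsTop.height_le [T2Space X] (hF : F.IsHalfTranslation) (hw : w.re ≠ 0) {x h h' : ℝ}
    {p' : X} (ht : F.IsTop β w x h p) (ht' : F.IsTop β w x h' p') : h ≤ h' := by
  by_contra hcon
  exact absurd (ht'.lt_of_mem hF hw (ht.dom h' ⟨ht'.pos.le, not_le.mp hcon⟩)) (lt_irrefl _)

theorem IsTop.height_eq [T2Space X] (hF : F.IsHalfTranslation) (hw : w.re ≠ 0) {x h h' : ℝ}
    {p' : X} (ht : F.IsTop β w x h p) (ht' : F.IsTop β w x h' p') : h = h' :=
  le_antisymm (ht.height_le hF hw ht') (ht'.height_le hF hw ht)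

end FlatStructure

namespace FlatStructure

variable {X : Type*} [TopologicalSpace X]
variable {V : Type*} [NormedAddCommGroup V] [NormedSpace ℝ V]
variable {F : FlatStructure X} {β : ℝ → X} {w : ℂ} {p : X}

/-! ### Saddle connections as chords of the development -/

theorem IsDevAt.comp_line {L : V →L[ℝ] ℂ} {f : V → X} {z v : V} {s : ℝ}
    (h : F.IsDevAt L f (z + s • v)) :
    F.IsDevAt (ContinuousLinearMap.toSpanSingleton ℝ (L v)) (fun s : ℝ => f (z + s • v)) s := by
  have h1 := IsDevAt.comp_affine (ContinuousLinearMap.toSpanSingleton ℝ v) (z₀ := z) (u := s)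
    (by simpa using h)
  have e : L.comp (ContinuousLinearMap.toSpanSingleton ℝ v) =
      ContinuousLinearMap.toSpanSingleton ℝ (L v) := by
    ext
    simp
  rw [e] at h1
  simpa using h1

/-- A straight path on `(0, 1)` with limits at both ends extends to a segment. -/
theorem IsStraight.exists_isSegment {f : ℝ → X} {w : ℂ} {p₀ p₁ : X} (hf : F.IsStraight f w)
    (ht₀ : Tendsto f (𝓝[>] 0) (𝓝 p₀)) (ht₁ : Tendsto f (𝓝[<] 1) (𝓝 p₁)) :
    ∃ σ : ℝ → X, F.IsSegment σ w ∧ σ 0 = p₀ ∧ σ 1 = p₁ ∧ ∀ s ∈ Ioo (0 : ℝ) 1, σ s = f s := by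
  classical
  let σ : ℝ → X := fun s => if s ≤ 0 then p₀ else if 1 ≤ s then p₁ else f s
  have hσ : ∀ s ∈ Ioo (0 : ℝ) 1, σ s = f s := fun s hs => by
    simp only [σ]
    rw [if_neg (not_le.mpr hs.1), if_neg (not_le.mpr hs.2)]
  have hσ0 : σ 0 = p₀ := if_pos le_rfl
  have hσ1 : σ 1 = p₁ := by simp [σ]
  have hev : ∀ s ∈ Ioo (0 : ℝ) 1, f =ᶠ[𝓝 s] σ := by
    intro s hs
    filter_upwards [isOpen_Ioo.mem_nhds hs] with s' hs'
    exact (hσ s' hs').symm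
  have hdev : F.IsStraight σ w := fun s hs => (hf s hs).congr (hev s hs)
  refine ⟨σ, isSegment_iff.mpr ⟨?_, hdev⟩, hσ0, hσ1, hσ⟩
  intro s hs
  rcases hs.1.eq_or_lt with h | h
  · rw [← h, continuousWithinAt_Icc_iff_Ici one_pos, ← continuousWithinAt_Ioi_iff_Ici]
    change Tendsto σ _ (𝓝 (σ 0))
    rw [hσ0]
    refine ht₀.congr' ?_
    filter_upwards [Ioo_mem_nhdsGT one_pos] with s' hs'
    exact (hσ s' hs').symm
  rcases hs.2.eq_or_lt with h' | h'
  · rw [h', continuousWithinAt_Icc_iff_Iic one_pos, ← continuousWithinAt_Iio_iff_Iic]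
    change Tendsto σ _ (𝓝 (σ 1))
    rw [hσ1]
    refine ht₁.congr' ?_
    filter_upwards [Ioo_mem_nhdsLT one_pos] with s' hs'
    exact (hσ s' hs').symm
  · exact (hdev s ⟨h, h'⟩).continuousAt.continuousWithinAt

theorem exists_saddleConnection {f : ℝ → X} {w : ℂ} (hw : w ≠ 0) {p₀ p₁ : X} (h₀ : p₀ ∈ F.sing)
    (h₁ : p₁ ∈ F.sing) (hf : F.IsStraight f w) (ht₀ : Tendsto f (𝓝[>] 0) (𝓝 p₀))
    (ht₁ : Tendsto f (𝓝[<] 1) (𝓝 p₁)) : ∃ γ : F.SaddleConnection, γ.hol = w := by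
  obtain ⟨σ, h1, h2, h3, -⟩ := hf.exists_isSegment ht₀ ht₁
  exact ⟨⟨σ, w, hw, h1, h2 ▸ h₀, h3 ▸ h₁⟩, rfl⟩

/-- If the development tends to a singularity along one side of a triangle, at a vertex, then it
does so along the other side: points of the two sides are joined by short straight paths. -/
theorem tendsto_of_corner [T2Space X] (hF : F.IsHalfTranslation) (hw : w.re ≠ 0)
    (hp : p ∈ F.sing) {z₀ u₀ u₁ : ℂ} (hu : u₀ ≠ u₁) {s₁ : ℝ} (hs₁ : 0 < s₁)
    (hdom : ∀ s ∈ Ioo 0 s₁, ∀ θ ∈ Icc (0 : ℝ) 1,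
      z₀ + s • (u₀ + θ • (u₁ - u₀)) ∈ F.devDomain β w)
    (ht : Tendsto (fun s : ℝ => F.devMap β w (z₀ + s • u₀)) (𝓝[>] 0) (𝓝 p)) :
    Tendsto (fun s : ℝ => F.devMap β w (z₀ + s • u₁)) (𝓝[>] 0) (𝓝 p) := by
  obtain ⟨ξ, r, n, hc⟩ := hF.exists_cone p hp
  intro U hU
  obtain ⟨ρ, hρ, hρr, hρU⟩ := hc.exists_radius hU
  have h1 : Tendsto (fun s : ℝ => ‖ξ (F.devMap β w (z₀ + s • u₀))‖ ^ n) (𝓝[>] 0) (𝓝 0) := by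
    have h2 := (((ξ.continuousAt hc.mem).tendsto.comp ht).norm).pow n
    simpa [hc.map_zero, hc.n_pos.ne'] using h2
  have h2 : Tendsto (fun s : ℝ => (‖shearMap w (s • (u₁ - u₀))‖ +
      √(‖ξ (F.devMap β w (z₀ + s • u₀))‖ ^ n)) ^ 2) (𝓝[>] 0) (𝓝 0) := by
    have h3 : Tendsto (fun s : ℝ => ‖shearMap w (s • (u₁ - u₀))‖) (𝓝[>] 0) (𝓝 0) := by
      have : Continuous (fun s : ℝ => ‖shearMap w (s • (u₁ - u₀))‖) := by fun_prop
      simpa using (this.tendsto 0).mono_left nhdsWithin_le_nhds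
    have h4 := (h3.add ((Real.continuous_sqrt.tendsto 0).comp h1)).pow 2
    simpa using h4
  have hρn : 0 < ρ ^ n := pow_pos hρ n
  rw [mem_map]
  filter_upwards [h2.eventually (gt_mem_nhds hρn), Ioo_mem_nhdsGT hs₁,
    ht.eventually (ξ.open_source.mem_nhds hc.mem)] with s g1 g2 g3
  have hb : shearMap w (s • (u₁ - u₀)) ≠ 0 := by
    rw [Ne, map_eq_zero_iff _ (shearMap_injective hw), smul_eq_zero]
    push Not
    exact ⟨g2.1.ne', sub_ne_zero.mpr hu.symm⟩
  have key := hc.stay hF hb (c := fun θ : ℝ => F.devMap β w ((z₀ + s • u₀) + θ • (s • (u₁ - u₀))))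
    (d := √(‖ξ (F.devMap β w (z₀ + s • u₀))‖ ^ n)) (ρ := ρ) ?_
    (by simp only [zero_smul, add_zero]; exact g3)
    (Real.sqrt_nonneg _) ?_ hρ.le hρr.le g1 1 ⟨zero_le_one, le_rfl⟩
  · have e : (z₀ + s • u₀) + (1 : ℝ) • (s • (u₁ - u₀)) = z₀ + s • u₁ := by
      rw [one_smul, smul_sub]; abel
    rw [e] at key
    exact hρU _ key.1 key.2
  · intro θ hθ
    apply IsDevAt.comp_line
    apply isDevAt_devMap hF hw
    have := hdom s g2 θ hθ
    convert this using 1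
    rw [smul_add, smul_comm θ s, add_assoc]
  · rw [Real.sq_sqrt (by positivity)]
    simp

namespace SaddleConnection

variable (γ : F.SaddleConnection)

theorem isStraight : F.IsStraight γ.path γ.hol := (isSegment_iff.mp γ.isSegment).2

theorem continuousOn : ContinuousOn γ.path (Icc 0 1) := γ.isSegment.continuousOn

theorem tendsto_start : Tendsto γ.path (𝓝[>] 0) (𝓝 (γ.path 0)) := by
  have h := γ.continuousOn 0 ⟨le_rfl, zero_le_one⟩
  rw [continuousWithinAt_Icc_iff_Ici one_pos, ← continuousWithinAt_Ioi_iff_Ici] at h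
  exact h

theorem tendsto_end : Tendsto γ.path (𝓝[<] 1) (𝓝 (γ.path 1)) := by
  have h := γ.continuousOn 1 ⟨zero_le_one, le_rfl⟩
  rw [continuousWithinAt_Icc_iff_Iic one_pos, ← continuousWithinAt_Iio_iff_Iic] at h
  exact h

/-- The point at height `h` above `γ x` is a singularity, for the upward development of `γ`: either
an endpoint of `γ`, at height zero, or the first singularity on the leaf going up from `γ x`. -/
inductive IsEnd : ℝ → ℝ → Prop
  | left : IsEnd 0 0
  | right : IsEnd 1 0
  | top {x h : ℝ} {p : X} (hx : x ∈ Ioo (0 : ℝ) 1) (ht : F.IsTop γ.path γ.hol x h p) : IsEnd x h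

variable {γ}

theorem tendsto_top [T2Space X] {x h : ℝ} (ht : F.IsTop γ.path γ.hol x h p) :
    Tendsto (fun s : ℝ => F.devMap γ.path γ.hol (⟨x, h⟩ + s • (⟨0, -1⟩ : ℂ))) (𝓝[>] 0) (𝓝 p) := by
  have h1 : Tendsto (fun s : ℝ => h - s) (𝓝[>] 0) (𝓝[<] h) := by
    refine tendsto_nhdsWithin_iff.mpr ⟨?_, ?_⟩
    · have : Continuous (fun s : ℝ => h - s) := by fun_prop
      simpa using (this.tendsto 0).mono_left nhdsWithin_le_nhds
    · filter_upwards [self_mem_nhdsWithin] with s hs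
      exact sub_lt_self h hs
  refine (ht.tendsto.comp h1).congr (fun s => ?_)
  simp only [Function.comp_apply]
  congr 1
  apply Complex.ext <;> simp [sub_eq_add_neg]

/-- Two singularities above `γ` such that the development is defined on the rectangle between
them are joined by a saddle connection. -/
theorem exists_chord [T2Space X] (hF : F.IsHalfTranslation) (hw : γ.hol.re ≠ 0)
    {a b h k M : ℝ} (ha : γ.IsEnd a h) (hb : γ.IsEnd b k) (hab : a < b) (hM : h ≤ M) (kM : k ≤ M)
    (hdom : ∀ x ∈ Ioo a b, ∀ y ∈ Icc 0 M, (⟨x, y⟩ : ℂ) ∈ F.devDomain γ.path γ.hol) :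
    ∃ γ' : F.SaddleConnection, γ'.hol = shearMap γ.hol ⟨b - a, k - h⟩ := by
  have h0 : 0 ≤ h := by
    cases ha with
    | left => exact le_rfl
    | right => exact le_rfl
    | top hx ht => exact ht.pos.le
  have k0 : 0 ≤ k := by
    cases hb with
    | left => exact le_rfl
    | right => exact le_rfl
    | top hx ht => exact ht.pos.le
  -- Convergence to the singularity at the left end of the chord. It is known along one other
  -- direction `u₀`, namely that of `γ` at an endpoint of `γ` and the downward vertical one at the
  -- end of a leaf; `tendsto_of_corner` transports it to the chord.
  have hleft : ∃ p ∈ F.sing, Tendsto (fun s : ℝ => F.devMap γ.path γ.hol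
      (⟨a, h⟩ + s • (⟨b - a, k - h⟩ : ℂ))) (𝓝[>] 0) (𝓝 p) := by
    cases ha with
    | left =>
      refine ⟨γ.path 0, γ.start_mem, ?_⟩
      have hb1 : b ≤ 1 := by
        cases hb with
        | left => exact absurd hab (lt_irrefl _)
        | right => exact le_rfl
        | top hx ht => exact hx.2.le
      refine tendsto_of_corner hF hw γ.start_mem (u₀ := ⟨b / 2, 0⟩) ?_ one_pos ?_ ?_
      · intro h2
        have := congrArg Complex.re h2
        simp only at this
        linarith
      · rintro s ⟨hs0, hs1⟩ θ ⟨hθ0, hθ1⟩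
        have e2 : s * (1 + θ) < 2 := by nlinarith
        have hdom' := hdom (s * (1 + θ) * (b / 2)) ⟨by positivity, by nlinarith⟩
          (s * (θ * k)) ⟨by positivity, by
            have h2 : s * θ ≤ 1 := mul_le_one₀ hs1.le hθ0 hθ1
            calc s * (θ * k) = (s * θ) * k := by ring
              _ ≤ 1 * k := mul_le_mul_of_nonneg_right h2 k0
              _ ≤ M := by linarith⟩
        convert hdom' using 1
        apply Complex.ext
        · simp; ring
        · simp
      · have h2 : Tendsto (fun s : ℝ => s * (b / 2)) (𝓝[>] 0) (𝓝[>] 0) := by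
          refine tendsto_nhdsWithin_iff.mpr ⟨?_, ?_⟩
          · have : Continuous (fun s : ℝ => s * (b / 2)) := by fun_prop
            simpa using (this.tendsto 0).mono_left nhdsWithin_le_nhds
          · filter_upwards [self_mem_nhdsWithin] with s hs
            exact mul_pos hs (half_pos hab)
        refine (γ.tendsto_start.comp h2).congr' ?_
        filter_upwards [Ioo_mem_nhdsGT one_pos] with s hs
        have h3 : s * (b / 2) ∈ Ioo (0 : ℝ) 1 := ⟨mul_pos hs.1 (half_pos hab), by
          nlinarith [hs.1, hs.2]⟩
        have h4 := devMap_ofReal hF hw (ofReal_mem_devDomain γ.isStraight h3)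
        simp only [Function.comp_apply]
        rw [← h4]
        congr 1
        apply Complex.ext <;> simp
    | right =>
      exfalso
      cases hb with
      | left => linarith
      | right => linarith
      | top hx ht => linarith [hx.2]
    | @top _ _ p hx ht =>
      refine ⟨p, ht.sing, ?_⟩
      refine tendsto_of_corner hF hw ht.sing (u₀ := ⟨0, -1⟩) ?_ (lt_min one_pos ht.pos) ?_
        (tendsto_top ht)
      · intro h2
        have := congrArg Complex.re h2
        simp only at this
        linarith
      · rintro s ⟨hs0, hs1⟩ θ ⟨hθ0, hθ1⟩
        have hs1' := hs1.trans_le (min_le_left _ _)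
        have hsh := hs1.trans_le (min_le_right _ _)
        have e : (⟨a, h⟩ : ℂ) + s • ((⟨0, -1⟩ : ℂ) + θ • ((⟨b - a, k - h⟩ : ℂ) - ⟨0, -1⟩)) =
            ⟨a + s * θ * (b - a), (1 - θ) * (h - s) + θ * ((1 - s) * h + s * k)⟩ := by
          apply Complex.ext
          · simp; ring
          · simp; ring
        rw [e]
        rcases hθ0.eq_or_lt with rfl | hθ
        · convert ht.dom (h - s) ⟨by linarith, by linarith⟩ using 1
          apply Complex.ext <;> simp
        · have hsθ : s * θ < 1 := by nlinarith
          have hsθ0 : 0 < s * θ := by positivity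
          have g1 : (1 - s) * h + s * k ≤ M := by nlinarith
          have g2 : 0 ≤ (1 - s) * h + s * k := by
            have : 0 ≤ 1 - s := by linarith
            positivity
          have g3 : 0 ≤ 1 - θ := by linarith
          refine hdom _ ⟨by nlinarith, by nlinarith⟩ _ ⟨?_, ?_⟩
          · have : 0 ≤ h - s := by linarith
            positivity
          · have e1 : (1 - θ) * (h - s) ≤ (1 - θ) * M :=
              mul_le_mul_of_nonneg_left (by linarith) g3
            have e2 := mul_le_mul_of_nonneg_left g1 hθ0
            linarith
  have hright : ∃ p ∈ F.sing, Tendsto (fun s : ℝ => F.devMap γ.path γ.hol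
      (⟨b, k⟩ + s • (⟨a - b, h - k⟩ : ℂ))) (𝓝[>] 0) (𝓝 p) := by
    cases hb with
    | right =>
      refine ⟨γ.path 1, γ.end_mem, ?_⟩
      have ha0 : 0 ≤ a := by
        cases ha with
        | left => exact le_rfl
        | right => exact absurd hab (lt_irrefl _)
        | top hx ht => exact hx.1.le
      refine tendsto_of_corner hF hw γ.end_mem (u₀ := ⟨(a - 1) / 2, 0⟩) ?_ one_pos ?_ ?_
      · intro h2
        have := congrArg Complex.re h2
        simp only at this
        linarith
      · rintro s ⟨hs0, hs1⟩ θ ⟨hθ0, hθ1⟩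
        have e1 : 0 < s * (1 + θ) := by positivity
        have e2 : s * (1 + θ) < 2 := by nlinarith
        have hdom' := hdom (1 - s * (1 + θ) * ((1 - a) / 2)) ⟨by nlinarith, by nlinarith⟩
          (s * (θ * h)) ⟨by positivity, by
            have h2 : s * θ ≤ 1 := mul_le_one₀ hs1.le hθ0 hθ1
            calc s * (θ * h) = (s * θ) * h := by ring
              _ ≤ 1 * h := mul_le_mul_of_nonneg_right h2 h0
              _ ≤ M := by linarith⟩
        convert hdom' using 1
        apply Complex.ext
        · simp; ring
        · simp
      · have h2 : Tendsto (fun s : ℝ => 1 + s * ((a - 1) / 2)) (𝓝[>] 0) (𝓝[<] 1) := by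
          refine tendsto_nhdsWithin_iff.mpr ⟨?_, ?_⟩
          · have : Continuous (fun s : ℝ => 1 + s * ((a - 1) / 2)) := by fun_prop
            simpa using (this.tendsto 0).mono_left nhdsWithin_le_nhds
          · filter_upwards [self_mem_nhdsWithin] with s hs
            have hs' : 0 < s := hs
            simp only [mem_Iio]
            nlinarith
        refine (γ.tendsto_end.comp h2).congr' ?_
        filter_upwards [Ioo_mem_nhdsGT one_pos] with s hs
        have h3 : 1 + s * ((a - 1) / 2) ∈ Ioo (0 : ℝ) 1 := ⟨by nlinarith [hs.1, hs.2], by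
          nlinarith [hs.1, hs.2]⟩
        have h4 := devMap_ofReal hF hw (ofReal_mem_devDomain γ.isStraight h3)
        simp only [Function.comp_apply]
        rw [← h4]
        congr 1
        apply Complex.ext <;> simp
    | left =>
      exfalso
      cases ha with
      | left => linarith
      | right => linarith
      | top hx ht => linarith [hx.1]
    | @top _ _ p hx ht =>
      refine ⟨p, ht.sing, ?_⟩
      refine tendsto_of_corner hF hw ht.sing (u₀ := ⟨0, -1⟩) ?_ (lt_min one_pos ht.pos) ?_
        (tendsto_top ht)
      · intro h2
        have := congrArg Complex.re h2
        simp only at this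
        linarith
      · rintro s ⟨hs0, hs1⟩ θ ⟨hθ0, hθ1⟩
        have hs1' := hs1.trans_le (min_le_left _ _)
        have hsh := hs1.trans_le (min_le_right _ _)
        have e : (⟨b, k⟩ : ℂ) + s • ((⟨0, -1⟩ : ℂ) + θ • ((⟨a - b, h - k⟩ : ℂ) - ⟨0, -1⟩)) =
            ⟨b - s * θ * (b - a), (1 - θ) * (k - s) + θ * ((1 - s) * k + s * h)⟩ := by
          apply Complex.ext
          · simp; ring
          · simp; ring
        rw [e]
        rcases hθ0.eq_or_lt with rfl | hθ
        · convert ht.dom (k - s) ⟨by linarith, by linarith⟩ using 1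
          apply Complex.ext <;> simp
        · have hsθ : s * θ < 1 := by nlinarith
          have hsθ0 : 0 < s * θ := by positivity
          have g1 : (1 - s) * k + s * h ≤ M := by nlinarith
          have g2 : 0 ≤ (1 - s) * k + s * h := by
            have : 0 ≤ 1 - s := by linarith
            positivity
          have g3 : 0 ≤ 1 - θ := by linarith
          refine hdom _ ⟨by nlinarith, by nlinarith⟩ _ ⟨?_, ?_⟩
          · have : 0 ≤ k - s := by linarith
            positivity
          · have e1 : (1 - θ) * (k - s) ≤ (1 - θ) * M :=
              mul_le_mul_of_nonneg_left (by linarith) g3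
            have e2 := mul_le_mul_of_nonneg_left g1 hθ0
            linarith
  obtain ⟨p₀, hp₀, ht₀⟩ := hleft
  obtain ⟨p₁, hp₁, ht₁⟩ := hright
  refine exists_saddleConnection (f := fun s : ℝ => F.devMap γ.path γ.hol
    (⟨a, h⟩ + s • (⟨b - a, k - h⟩ : ℂ))) ?_ hp₀ hp₁ ?_ ht₀ ?_
  · rw [Ne, map_eq_zero_iff _ (shearMap_injective hw)]
    intro h2
    have := congrArg Complex.re h2
    simp only [Complex.zero_re] at this
    linarith
  · rintro s ⟨hs0, hs1⟩
    apply IsDevAt.comp_line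
    apply isDevAt_devMap hF hw
    have e : (⟨a, h⟩ : ℂ) + s • (⟨b - a, k - h⟩ : ℂ) =
        ⟨a + s * (b - a), (1 - s) * h + s * k⟩ := by
      apply Complex.ext
      · simp
      · simp; ring
    rw [e]
    have : 0 ≤ 1 - s := by linarith
    refine hdom _ ⟨by nlinarith, by nlinarith⟩ _ ⟨by positivity, by nlinarith⟩
  · have h2 : Tendsto (fun s : ℝ => 1 - s) (𝓝[<] 1) (𝓝[>] 0) := by
      refine tendsto_nhdsWithin_iff.mpr ⟨?_, ?_⟩
      · have : Continuous (fun s : ℝ => 1 - s) := by fun_prop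
        simpa using (this.tendsto 1).mono_left nhdsWithin_le_nhds
      · filter_upwards [self_mem_nhdsWithin] with s hs
        exact sub_pos.mpr (mem_Iio.mp hs)
    refine (ht₁.comp h2).congr (fun s => ?_)
    simp only [Function.comp_apply]
    congr 1
    apply Complex.ext
    · simp; ring
    · simp; ring

end SaddleConnection

end FlatStructure

namespace FlatStructure

variable {X : Type*} [TopologicalSpace X]
variable {V : Type*} [NormedAddCommGroup V] [NormedSpace ℝ V]
variable {F : FlatStructure X} {w : ℂ} {p : X}

/-! ### First returns to a saddle connection -/

section Comparison

variable {L : V →L[ℝ] ℂ} {f g : V → X} {a b : V} {D : Set V}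

theorem IsDevAt.comp_add_left {u : V} (h : F.IsDevAt L f (a + u)) :
    F.IsDevAt L (fun u => f (a + u)) u := by
  simpa using IsDevAt.comp_affine (ContinuousLinearMap.id ℝ V) (z₀ := a) (u := u) (by simpa using h)

theorem IsDevAt.comp_sub_left (hF : F.IsHalfTranslation) {u : V} (h : F.IsDevAt L f (a - u)) :
    F.IsDevAt L (fun u => f (a - u)) u := by
  have h1 := (IsDevAt.comp_affine (-ContinuousLinearMap.id ℝ V) (z₀ := a) (u := u)
    (by simpa [sub_eq_add_neg] using h)).neg hF
  have e : -(L.comp (-ContinuousLinearMap.id ℝ V)) = L := by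
    ext
    simp
  rw [e] at h1
  simpa [sub_eq_add_neg] using h1

theorem eq_of_eventually_add [T2Space X] [Nontrivial V] (hF : F.IsHalfTranslation)
    (hL : Function.Injective L) (hD : IsPreconnected D) (h0 : (0 : V) ∈ D)
    (hf : ∀ v ∈ D, F.IsDevAt L f (a + v)) (hg : ∀ v ∈ D, F.IsDevAt L g (b + v))
    (h : ∀ᶠ v in 𝓝 (0 : V), f (a + v) = g (b + v)) : ∀ v ∈ D, f (a + v) = g (b + v) :=
  fun v hv => (IsDevAt.eventuallyEq_of_isPreconnected hF hL hD (fun v hv => (hf v hv).comp_add_left)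
    (fun v hv => (hg v hv).comp_add_left) h0 h v hv).eq_of_nhds

theorem eq_of_eventually_sub [T2Space X] [Nontrivial V] (hF : F.IsHalfTranslation)
    (hL : Function.Injective L) (hD : IsPreconnected D) (h0 : (0 : V) ∈ D)
    (hf : ∀ v ∈ D, F.IsDevAt L f (a + v)) (hg : ∀ v ∈ D, F.IsDevAt L g (b - v))
    (h : ∀ᶠ v in 𝓝 (0 : V), f (a + v) = g (b - v)) : ∀ v ∈ D, f (a + v) = g (b - v) :=
  fun v hv => (IsDevAt.eventuallyEq_of_isPreconnected hF hL hD (fun v hv => (hf v hv).comp_add_left)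
    (fun v hv => (hg v hv).comp_sub_left hF) h0 h v hv).eq_of_nhds

end Comparison

/-- The linear part of vertical paths. -/
abbrev vert : ℝ →L[ℝ] ℂ := ContinuousLinearMap.toSpanSingleton ℝ Complex.I

theorem vert_injective : Function.Injective vert := toSpanSingleton_injective Complex.I_ne_zero

theorem isDevAt_vert [T2Space X] (hF : F.IsHalfTranslation) {β : ℝ → X} (hw : w.re ≠ 0) {x y : ℝ}
    (h : (⟨x, y⟩ : ℂ) ∈ F.devDomain β w) :
    F.IsDevAt vert (fun y : ℝ => F.devMap β w ⟨x, y⟩) y := by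
  have e : ∀ y : ℝ, (x : ℂ) + y • Complex.I = ⟨x, y⟩ := fun y => by
    apply Complex.ext <;> simp
  have h1 := IsDevAt.comp_line (L := shearMap w) (f := F.devMap β w) (z := (x : ℂ))
    (v := Complex.I) (s := y) (by rw [e]; exact isDevAt_devMap hF hw h)
  have e2 : shearMap w Complex.I = Complex.I := by
    simp [shearMap_apply]
  simpa only [e, e2] using h1

namespace SaddleConnection

variable (γ : F.SaddleConnection)

/-- A point of `γ` that is not a singularity is an interior point. -/
theorem exists_of_mem_support {γ : F.SaddleConnection} {q : X} (hq : q ∈ γ.support)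
    (hs : q ∉ F.sing) : ∃ x ∈ Ioo (0 : ℝ) 1, γ.path x = q := by
  obtain ⟨x, hx, rfl⟩ := hq
  refine ⟨x, ⟨lt_of_le_of_ne hx.1 ?_, lt_of_le_of_ne hx.2 ?_⟩, rfl⟩
  · rintro rfl
    exact hs γ.start_mem
  · rintro rfl
    exact hs γ.end_mem

theorem path_notMem_sing (hF : F.IsHalfTranslation) {x : ℝ} (hx : x ∈ Ioo (0 : ℝ) 1) :
    γ.path x ∉ F.sing := (γ.isStraight x hx).notMem_sing hF

theorem isCompact_support : IsCompact γ.support :=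
  isCompact_Icc.image_of_continuousOn γ.continuousOn

theorem path_mem_support {x : ℝ} (hx : x ∈ Ioo (0 : ℝ) 1) : γ.path x ∈ γ.support :=
  ⟨x, Ioo_subset_Icc_self hx, rfl⟩

/-- A saddle connection does not cross itself: at a self-intersection it would either be periodic,
and never reach its end, or turn back on itself. -/
theorem path_injOn [T2Space X] (hF : F.IsHalfTranslation) : InjOn γ.path (Ioo 0 1) := by
  have hL := toSpanSingleton_injective γ.hol_ne_zero
  have key : ∀ s ∈ Ioo (0 : ℝ) 1, ∀ s' ∈ Ioo (0 : ℝ) 1, s < s' → γ.path s ≠ γ.path s' := by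
    intro s hs s' hs' hlt heq
    rcases (γ.isStraight s hs).eventually_add_or_sub hF (γ.isStraight s' hs') heq with h | h
    -- Equal directions: the path started at `s` runs into the endpoint of `γ` at the interior
    -- time `s + (1 - s')`.
    · have hD := eq_of_eventually_add hF hL (isPreconnected_Ico (a := (0 : ℝ)) (b := 1 - s'))
        ⟨le_rfl, by linarith [hs'.2]⟩
        (fun v hv => γ.isStraight _ ⟨by linarith [hs.1, hv.1], by linarith [hv.2]⟩)
        (fun v hv => γ.isStraight _ ⟨by linarith [hs'.1, hv.1], by linarith [hv.2]⟩) h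
      have hmem : s + (1 - s') ∈ Ioo (0 : ℝ) 1 := ⟨by linarith [hs.1, hs'.2], by linarith⟩
      have t1 : Tendsto (fun v => γ.path (s + v)) (𝓝[<] (1 - s')) (𝓝 (γ.path (s + (1 - s')))) := by
        have : ContinuousAt (fun v => γ.path (s + v)) (1 - s') :=
          ((γ.isStraight _ hmem).comp_add_left).continuousAt
        exact this.tendsto.mono_left nhdsWithin_le_nhds
      have t2 : Tendsto (fun v => γ.path (s' + v)) (𝓝[<] (1 - s')) (𝓝 (γ.path 1)) := by
        refine γ.tendsto_end.comp (tendsto_nhdsWithin_iff.mpr ⟨?_, ?_⟩)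
        · have : Continuous (fun v : ℝ => s' + v) := by fun_prop
          simpa using (this.tendsto (1 - s')).mono_left nhdsWithin_le_nhds
        · filter_upwards [self_mem_nhdsWithin] with v hv
          have : v < 1 - s' := hv
          simp only [mem_Iio]
          linarith
      have t3 : Tendsto (fun v => γ.path (s + v)) (𝓝[<] (1 - s')) (𝓝 (γ.path 1)) := by
        refine t2.congr' ?_
        filter_upwards [Ico_mem_nhdsLT (show (0 : ℝ) < 1 - s' by linarith [hs'.2])] with v hv
        exact (hD v hv).symm
      exact γ.path_notMem_sing hF hmem (tendsto_nhds_unique t1 t3 ▸ γ.end_mem)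
    -- Opposite directions: the path turns back at the time `(s + s') / 2`, where it is injective.
    · have hD := eq_of_eventually_sub hF hL (isPreconnected_Icc (a := (0 : ℝ)) (b := s' - s))
        ⟨le_rfl, by linarith⟩
        (fun v hv => γ.isStraight _ ⟨by linarith [hs.1, hv.1], by linarith [hv.2, hs'.2]⟩)
        (fun v hv => γ.isStraight _ ⟨by linarith [hs.1, hv.2], by linarith [hv.1, hs'.2]⟩) h
      have hmid : (s + s') / 2 ∈ Ioo (0 : ℝ) 1 :=
        ⟨by linarith [hs.1, hs'.1], by linarith [hs.2, hs'.2]⟩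
      obtain ⟨U, hU, hinj⟩ := (γ.isStraight _ hmid).exists_injOn hL
      obtain ⟨ε, hε, hball⟩ := Metric.mem_nhds_iff.mp hU
      set ε' := min (ε / 2) ((s' - s) / 2) with hε'
      have e1 : ε' ≤ ε / 2 := min_le_left _ _
      have e2 : ε' ≤ (s' - s) / 2 := min_le_right _ _
      have e3 : 0 < ε' := lt_min (half_pos hε) (by linarith)
      have h3 := hD ((s' - s) / 2 + ε') ⟨by linarith, by linarith⟩
      have h4 := hinj (hball (show (s + ((s' - s) / 2 + ε')) ∈ Metric.ball ((s + s') / 2) ε by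
        rw [Metric.mem_ball, Real.dist_eq, abs_lt]
        constructor <;> linarith)) (hball (show s' - ((s' - s) / 2 + ε') ∈ _ by
        rw [Metric.mem_ball, Real.dist_eq, abs_lt]
        constructor <;> linarith)) h3
      linarith
  intro s hs s' hs' heq
  rcases lt_trichotomy s s' with h | h | h
  · exact absurd heq (key s hs s' hs' h)
  · exact h
  · exact absurd heq.symm (key s' hs' s hs h)

/-- The same saddle connection, traversed backwards. Its holonomy vector can be taken to be the
same one, as holonomy vectors are determined up to sign; the leaves going up from the reverse are
those going down from the original. -/
def reverse (hF : F.IsHalfTranslation) : F.SaddleConnection where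
  path s := γ.path (1 - s)
  hol := γ.hol
  hol_ne_zero := γ.hol_ne_zero
  isSegment := isSegment_iff.mpr ⟨by
    refine γ.continuousOn.comp (by fun_prop) ?_
    intro s hs
    exact ⟨by linarith [hs.2], by linarith [hs.1]⟩, γ.isStraight.reverse hF⟩
  start_mem := by simpa using γ.end_mem
  end_mem := by simpa using γ.start_mem

theorem reverse_support (hF : F.IsHalfTranslation) : (γ.reverse hF).support = γ.support := by
  ext q
  constructor
  · rintro ⟨s, hs, rfl⟩
    exact ⟨1 - s, ⟨by linarith [hs.2], by linarith [hs.1]⟩, rfl⟩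
  · rintro ⟨s, hs, rfl⟩
    refine ⟨1 - s, ⟨by linarith [hs.2], by linarith [hs.1]⟩, ?_⟩
    simp [reverse]

/-- The domain of the vertical development of `γ`. -/
abbrev dom : Set ℂ := F.devDomain γ.path γ.hol

/-- The vertical development of `γ`. -/
abbrev dev (z : ℂ) : X := F.devMap γ.path γ.hol z

variable {γ}

theorem ofReal_mem_dom {x : ℝ} (hx : x ∈ Ioo (0 : ℝ) 1) : (⟨x, 0⟩ : ℂ) ∈ γ.dom :=
  ofReal_mem_devDomain γ.isStraight hx

theorem dev_ofReal [T2Space X] (hF : F.IsHalfTranslation) (hw : γ.hol.re ≠ 0) {x : ℝ}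
    (hx : x ∈ Ioo (0 : ℝ) 1) : γ.dev ⟨x, 0⟩ = γ.path x :=
  devMap_ofReal hF hw (ofReal_mem_dom hx)

/-- Near an interior point of `γ`, the development meets `γ` only along the real axis. -/
theorem eventually_dev_mem_support [T2Space X] (hF : F.IsHalfTranslation) (hw : γ.hol.re ≠ 0)
    {x : ℝ} (hx : x ∈ Ioo (0 : ℝ) 1) :
    ∀ᶠ z in 𝓝 (⟨x, 0⟩ : ℂ), γ.dev z ∈ γ.support ↔ z.im = 0 := by
  have hdev := isDevAt_devMap hF hw (ofReal_mem_dom (γ := γ) hx)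
  obtain ⟨U, hU, hinj⟩ := hdev.exists_injOn (shearMap_injective hw)
  obtain ⟨W, hWU, hWo, hxW⟩ := mem_nhds_iff.mp hU
  set I : Set ℝ := (fun s : ℝ => (⟨s, 0⟩ : ℂ)) ⁻¹' W ∩ Ioo 0 1 with hI
  have hIo : IsOpen I := (hWo.preimage (continuous_mk' 0)).inter isOpen_Ioo
  have hK : IsCompact (γ.path '' (Icc 0 1 \ I)) :=
    (isCompact_Icc.diff hIo).image_of_continuousOn (γ.continuousOn.mono sdiff_subset)
  have hxK : γ.dev ⟨x, 0⟩ ∉ γ.path '' (Icc 0 1 \ I) := by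
    rw [dev_ofReal hF hw hx]
    rintro ⟨s, ⟨hs, hsI⟩, heq⟩
    obtain ⟨s', hs', h'⟩ := exists_of_mem_support (γ := γ) (q := γ.path s) ⟨s, hs, rfl⟩
      (heq ▸ γ.path_notMem_sing hF hx)
    have hs01 : s ∈ Ioo (0 : ℝ) 1 := by
      have hns : γ.path s ∉ F.sing := heq ▸ γ.path_notMem_sing hF hx
      refine ⟨lt_of_le_of_ne hs.1 ?_, lt_of_le_of_ne hs.2 ?_⟩
      · rintro rfl
        exact hns γ.start_mem
      · rintro rfl
        exact hns γ.end_mem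
    have := γ.path_injOn hF hs01 hx heq
    exact hsI (this ▸ ⟨hxW, hx⟩)
  have h1 := hdev.continuousAt.eventually (hK.isClosed.isOpen_compl.mem_nhds hxK)
  have h2 : ∀ᶠ z : ℂ in 𝓝 (⟨x, 0⟩ : ℂ), z.re ∈ Ioo (0 : ℝ) 1 :=
    Complex.continuous_re.continuousAt.eventually (isOpen_Ioo.mem_nhds hx)
  filter_upwards [h1, h2, hWo.mem_nhds hxW] with z g1 g2 g3
  constructor
  · rintro ⟨s, hs, hsz⟩
    have hsI : s ∈ I := by
      by_contra h
      exact g1 ⟨s, ⟨hs, h⟩, hsz⟩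
    have := hinj (hWU hsI.1) (hWU g3) ((dev_ofReal hF hw hsI.2).trans hsz)
    rw [← this]
  · intro h0
    have : z = ⟨z.re, 0⟩ := Complex.ext rfl h0
    rw [this, dev_ofReal hF hw g2]
    exact γ.path_mem_support g2

/-- Near a point of `γ`, the development meets `γ` only along the line parallel to the real axis. -/
theorem eventually_mem_support [T2Space X] (hF : F.IsHalfTranslation) (hw : γ.hol.re ≠ 0)
    {f : ℂ → X} {z : ℂ} (hf : F.IsDevAt (shearMap γ.hol) f z) (hz : f z ∈ γ.support) :
    ∀ᶠ v in 𝓝 (0 : ℂ), f (z + v) ∈ γ.support ↔ v.im = 0 := by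
  obtain ⟨x, hx, hxz⟩ := exists_of_mem_support hz (hf.notMem_sing hF)
  have h1 := eventually_dev_mem_support hF hw hx
  have hdev := isDevAt_devMap hF hw (ofReal_mem_dom (γ := γ) hx)
  rcases hf.eventually_add_or_sub hF hdev (by rw [← hxz]; exact (dev_ofReal hF hw hx).symm)
    with h | h
  · have t : Tendsto (fun v : ℂ => (⟨x, 0⟩ : ℂ) + v) (𝓝 0) (𝓝 ⟨x, 0⟩) := by
      have : Continuous (fun v : ℂ => (⟨x, 0⟩ : ℂ) + v) := by fun_prop
      simpa using this.tendsto 0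
    filter_upwards [h, t.eventually h1] with v g1 g2
    rw [g1, g2]
    simp
  · have t : Tendsto (fun v : ℂ => (⟨x, 0⟩ : ℂ) - v) (𝓝 0) (𝓝 ⟨x, 0⟩) := by
      have : Continuous (fun v : ℂ => (⟨x, 0⟩ : ℂ) - v) := by fun_prop
      simpa using this.tendsto 0
    filter_upwards [h, t.eventually h1] with v g1 g2
    rw [g1, g2]
    simp

variable (γ) in
/-- The leaf going up from `γ x` returns to `γ` for the first time at height `R`. -/
structure IsReturn (x R : ℝ) : Prop where
  pos : 0 < R
  mem_dom : (⟨x, R⟩ : ℂ) ∈ γ.dom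
  mem : γ.dev ⟨x, R⟩ ∈ γ.support
  notMem : ∀ y ∈ Ioo 0 R, γ.dev ⟨x, y⟩ ∉ γ.support

variable (γ) in
/-- The positions `x` for which the leaf going up from `γ x` meets a singularity before it returns
to `γ`. -/
def blocked : Set ℝ :=
  {x | x ∈ Ioo (0 : ℝ) 1 ∧ ∃ h p, F.IsTop γ.path γ.hol x h p ∧
    ∀ y ∈ Ioo 0 h, γ.dev ⟨x, y⟩ ∉ γ.support}

theorem IsReturn.mem_Ioo {x R : ℝ} (h : γ.IsReturn x R) : x ∈ Ioo (0 : ℝ) 1 :=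
  re_mem_of_mem_devDomain h.mem_dom

theorem IsReturn.le {x R R' : ℝ} (h : γ.IsReturn x R) (h' : γ.IsReturn x R') : R ≤ R' := by
  by_contra hcon
  exact h.notMem R' ⟨h'.pos, not_le.mp hcon⟩ h'.mem

theorem IsReturn.eq {x R R' : ℝ} (h : γ.IsReturn x R) (h' : γ.IsReturn x R') : R = R' :=
  le_antisymm (h.le h') (h'.le h)

theorem IsReturn.notMem_blocked [T2Space X] (hF : F.IsHalfTranslation) (hw : γ.hol.re ≠ 0)
    {x R : ℝ} (h : γ.IsReturn x R) : x ∉ γ.blocked := by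
  rintro ⟨-, k, p, ht, hno⟩
  exact hno R ⟨h.pos, ht.lt_of_mem hF hw h.mem_dom⟩ h.mem

/-- The initial behaviour of the leaves going up from `γ` is locally constant. -/
theorem eventually_initial [T2Space X] (hF : F.IsHalfTranslation) (hw : γ.hol.re ≠ 0) {x τ : ℝ}
    (hdom : (⟨x, τ⟩ : ℂ) ∈ γ.dom) (hno : ∀ y ∈ Ioo 0 τ, γ.dev ⟨x, y⟩ ∉ γ.support) :
    ∀ᶠ x' in 𝓝 x, (⟨x', τ⟩ : ℂ) ∈ γ.dom ∧ (∀ y ∈ Ioo 0 τ, γ.dev ⟨x', y⟩ ∉ γ.support) ∧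
      (γ.dev ⟨x', τ⟩ ∈ γ.support ↔ γ.dev ⟨x, τ⟩ ∈ γ.support) := by
  have hx : x ∈ Ioo (0 : ℝ) 1 := re_mem_of_mem_devDomain hdom
  have hpair : Continuous (fun q : ℝ × ℝ => (⟨q.1, q.2⟩ : ℂ)) := by
    simp only [Complex.mk_eq_add_mul_I]
    fun_prop
  have hlocal : ∀ y ∈ Icc (0 : ℝ) τ, ∀ᶠ q : ℝ × ℝ in 𝓝 (x, y),
      q.2 ∈ Ioo 0 τ → γ.dev ⟨q.1, q.2⟩ ∉ γ.support := by
    intro y hy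
    have hy' : (⟨x, y⟩ : ℂ) ∈ γ.dom := mk_mem_devDomain_of_le hdom hy.1 hy.2
    rcases hy.1.eq_or_lt with rfl | hy0
    · filter_upwards [(hpair.tendsto (x, 0)).eventually (eventually_dev_mem_support hF hw hx)]
        with q h1 h2 h3
      exact h2.1.ne' (h1.mp h3)
    · by_cases hm : γ.dev ⟨x, y⟩ ∈ γ.support
      · have hyτ : y = τ := by
          by_contra h
          exact hno y ⟨hy0, lt_of_le_of_ne hy.2 h⟩ hm
        have t : Tendsto (fun q : ℝ × ℝ => (⟨q.1, q.2⟩ : ℂ) - ⟨x, y⟩) (𝓝 (x, y)) (𝓝 0) := by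
          have : Continuous (fun q : ℝ × ℝ => (⟨q.1, q.2⟩ : ℂ) - ⟨x, y⟩) := by fun_prop
          simpa using this.tendsto (x, y)
        filter_upwards [t.eventually (eventually_mem_support hF hw (isDevAt_devMap hF hw hy') hm)]
          with q h1 h2 h3
        rw [add_sub_cancel] at h1
        have := h1.mp h3
        simp only [Complex.sub_im] at this
        linarith [h2.2]
      · have hc := (isDevAt_devMap hF hw hy').continuousAt
        have h1 := hc.eventually (γ.isCompact_support.isClosed.isOpen_compl.mem_nhds hm)
        filter_upwards [(hpair.tendsto (x, y)).eventually h1] with q h2 _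
        exact h2
  have h1 := isCompact_Icc.eventually_forall_of_forall_eventually (x₀ := x)
    (P := fun x' y => y ∈ Ioo 0 τ → γ.dev ⟨x', y⟩ ∉ γ.support) hlocal
  have hcx : Tendsto (fun x' : ℝ => (⟨x', τ⟩ : ℂ)) (𝓝 x) (𝓝 ⟨x, τ⟩) :=
    (continuous_mk' τ).tendsto x
  have h2 := hcx.eventually (isOpen_devDomain.mem_nhds hdom)
  have h3 : ∀ᶠ x' in 𝓝 x, (γ.dev ⟨x', τ⟩ ∈ γ.support ↔ γ.dev ⟨x, τ⟩ ∈ γ.support) := by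
    by_cases hm : γ.dev ⟨x, τ⟩ ∈ γ.support
    · have t : Tendsto (fun x' : ℝ => (⟨x', τ⟩ : ℂ) - ⟨x, τ⟩) (𝓝 x) (𝓝 0) := by
        have := hcx.sub_const (⟨x, τ⟩ : ℂ)
        simpa using this
      filter_upwards [t.eventually (eventually_mem_support hF hw (isDevAt_devMap hF hw hdom) hm)]
        with x' h1
      rw [add_sub_cancel] at h1
      simp only [hm, iff_true]
      rw [h1]
      simp
    · have hc := (isDevAt_devMap hF hw hdom).continuousAt
      have h1 := hc.eventually (γ.isCompact_support.isClosed.isOpen_compl.mem_nhds hm)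
      filter_upwards [hcx.eventually h1] with x' h2
      exact iff_of_false h2 hm
  filter_upwards [h1, h2, h3] with x' g1 g2 g3
  exact ⟨g2, fun y hy => g1 y ⟨hy.1.le, hy.2.le⟩ hy, g3⟩

theorem IsReturn.eventually [T2Space X] (hF : F.IsHalfTranslation) (hw : γ.hol.re ≠ 0) {x R : ℝ}
    (h : γ.IsReturn x R) : ∀ᶠ x' in 𝓝 x, γ.IsReturn x' R := by
  filter_upwards [eventually_initial hF hw h.mem_dom h.notMem] with x' hx'
  exact ⟨h.pos, hx'.1, hx'.2.2.mpr h.mem, hx'.2.1⟩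

theorem eventually_not_isReturn [T2Space X] (hF : F.IsHalfTranslation) (hw : γ.hol.re ≠ 0)
    {x M : ℝ} (hM : 0 < M) (hdom : (⟨x, M⟩ : ℂ) ∈ γ.dom)
    (hno : ∀ y ∈ Ioc 0 M, γ.dev ⟨x, y⟩ ∉ γ.support) :
    ∀ᶠ x' in 𝓝 x, ∀ R ≤ M, ¬ γ.IsReturn x' R := by
  filter_upwards [eventually_initial hF hw hdom (fun y hy => hno y ⟨hy.1, hy.2.le⟩)]
    with x' hx' R hR hret
  rcases hR.lt_or_eq with h | rfl
  · exact hx'.2.1 R ⟨hret.pos, h⟩ hret.mem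
  · exact hno R ⟨hM, le_rfl⟩ (hx'.2.2.mp hret.mem)

theorem exists_isReturn_of_mem [T2Space X] (hF : F.IsHalfTranslation) (hw : γ.hol.re ≠ 0)
    {x y : ℝ} (hy : 0 < y) (hdom : (⟨x, y⟩ : ℂ) ∈ γ.dom) (hm : γ.dev ⟨x, y⟩ ∈ γ.support) :
    ∃ R ≤ y, γ.IsReturn x R := by
  have hx : x ∈ Ioo (0 : ℝ) 1 := re_mem_of_mem_devDomain hdom
  have h1 : ∀ᶠ s : ℝ in 𝓝 0, γ.dev ⟨x, s⟩ ∈ γ.support ↔ s = 0 :=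
    ((continuous_mk x).tendsto 0).eventually (eventually_dev_mem_support hF hw hx)
  obtain ⟨ε, hε, h2⟩ := Metric.eventually_nhds_iff.mp h1
  have hno : ∀ s ∈ Ioo 0 ε, γ.dev ⟨x, s⟩ ∉ γ.support := by
    intro s hs h3
    have := (h2 (y := s) (by rw [Real.dist_eq, sub_zero, abs_of_pos hs.1]; exact hs.2)).mp h3
    exact hs.1.ne' this
  have hεy : ε ≤ y := by
    by_contra h
    exact hno y ⟨hy, not_le.mp h⟩ hm
  have hcont : ContinuousOn (fun s : ℝ => γ.dev ⟨x, s⟩) (Icc ε y) := fun s hs =>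
    (continuousAt_devMap_mk hF hw
      (mk_mem_devDomain_of_le hdom (hε.le.trans hs.1) hs.2)).continuousWithinAt
  have hcl : IsClosed (Icc ε y ∩ (fun s : ℝ => γ.dev ⟨x, s⟩) ⁻¹' γ.support) :=
    hcont.preimage_isClosed_of_isClosed isClosed_Icc γ.isCompact_support.isClosed
  obtain ⟨R, hR, hmin⟩ := (isCompact_Icc.of_isClosed_subset hcl inter_subset_left).exists_isLeast
    ⟨y, ⟨hεy, le_rfl⟩, hm⟩
  refine ⟨R, hR.1.2, hε.trans_le hR.1.1,
    mk_mem_devDomain_of_le hdom (hε.le.trans hR.1.1) hR.1.2, hR.2, ?_⟩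
  intro s hs hsm
  rcases lt_or_ge s ε with h | h
  · exact hno s ⟨hs.1, h⟩ hsm
  · exact absurd (hmin ⟨⟨h, hs.2.le.trans hR.1.2⟩, hsm⟩) (not_le.mpr hs.2)

/-- A leaf that is not blocked at height at most `M` either returns by height `M` or reaches that
height without having met `γ`. -/
theorem exists_isReturn_or [T2Space X] [CompactSpace X] (hF : F.IsHalfTranslation)
    (hw : γ.hol.re ≠ 0) {x M : ℝ} (hM : 0 < M) (hx : x ∈ Ioo (0 : ℝ) 1)
    (hb : x ∈ γ.blocked → ∀ h p, F.IsTop γ.path γ.hol x h p → M < h) :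
    (∃ R ≤ M, γ.IsReturn x R) ∨
      ((⟨x, M⟩ : ℂ) ∈ γ.dom ∧ ∀ y ∈ Ioc 0 M, γ.dev ⟨x, y⟩ ∉ γ.support) := by
  by_cases hdom : (⟨x, M⟩ : ℂ) ∈ γ.dom
  · by_cases hno : ∀ y ∈ Ioc 0 M, γ.dev ⟨x, y⟩ ∉ γ.support
    · exact Or.inr ⟨hdom, hno⟩
    · push Not at hno
      obtain ⟨y, hy, hm⟩ := hno
      obtain ⟨R, hR, hret⟩ := exists_isReturn_of_mem hF hw hy.1
        (mk_mem_devDomain_of_le hdom hy.1.le hy.2) hm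
      exact Or.inl ⟨R, hR.trans hy.2, hret⟩
  · rcases forall_mem_or_exists_isTop hF hw γ.isStraight hx with hall | ⟨h, p, ht⟩
    · exact absurd (hall M hM.le) hdom
    have hhM : h ≤ M := by
      by_contra hcon
      exact hdom (ht.dom M ⟨hM.le, not_le.mp hcon⟩)
    by_cases hno : ∀ y ∈ Ioo 0 h, γ.dev ⟨x, y⟩ ∉ γ.support
    · exact absurd (hb ⟨hx, h, p, ht, hno⟩ h p ht) (not_lt.mpr hhM)
    · push Not at hno
      obtain ⟨y, hy, hm⟩ := hno
      obtain ⟨R, hR, hret⟩ := exists_isReturn_of_mem hF hw hy.1 (ht.dom y ⟨hy.1.le, hy.2⟩) hm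
      exact Or.inl ⟨R, hR.trans (hy.2.le.trans hhM), hret⟩

/-- On an interval of positions none of which is blocked at height at most `M`, either all leaves
return by height `M` or none does. -/
theorem forall_exists_isReturn [T2Space X] [CompactSpace X] (hF : F.IsHalfTranslation)
    (hw : γ.hol.re ≠ 0) {J : Set ℝ} (hJ : IsPreconnected J) (hJ01 : J ⊆ Ioo 0 1) {M : ℝ}
    (hb : ∀ x ∈ J, x ∈ γ.blocked → ∀ h p, F.IsTop γ.path γ.hol x h p → M < h) {x₀ R₀ : ℝ}
    (hx₀ : x₀ ∈ J) (hR₀ : R₀ ≤ M) (hret : γ.IsReturn x₀ R₀) :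
    ∀ x ∈ J, ∃ R ≤ M, γ.IsReturn x R := by
  have hM : 0 < M := hret.pos.trans_le hR₀
  refine hJ.forall_of_open_closed (P := fun x => ∃ R ≤ M, γ.IsReturn x R) ?_ ?_ hx₀ ⟨R₀, hR₀, hret⟩
  · rintro x - ⟨R, hR, h⟩
    filter_upwards [(h.eventually hF hw).filter_mono nhdsWithin_le_nhds] with x' h'
    exact ⟨R, hR, h'⟩
  · intro x hx hfreq
    rcases exists_isReturn_or hF hw hM (hJ01 hx) (hb x hx) with h | ⟨h1, h2⟩
    · exact h
    · obtain ⟨x', ⟨R, hR, h3⟩, h4⟩ := (hfreq.and_eventually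
        ((eventually_not_isReturn hF hw hM h1 h2).filter_mono nhdsWithin_le_nhds)).exists
      exact absurd h3 (h4 R hR)

/-- The return time is constant on an interval without blocked positions: the leaves over such an
interval belong to one strip. -/
theorem IsReturn.eq_on [T2Space X] [CompactSpace X] (hF : F.IsHalfTranslation)
    (hw : γ.hol.re ≠ 0) {J : Set ℝ} (hJ : IsPreconnected J) (hJ01 : J ⊆ Ioo 0 1)
    (hb : ∀ x ∈ J, x ∉ γ.blocked) {x₀ R : ℝ} (hx₀ : x₀ ∈ J) (hret : γ.IsReturn x₀ R) :
    ∀ x ∈ J, γ.IsReturn x R := by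
  intro x hx
  obtain ⟨R', hR', h'⟩ := forall_exists_isReturn hF hw hJ hJ01 (fun x hx h => absurd h (hb x hx))
    hx₀ le_rfl hret x hx
  obtain ⟨R'', hR'', h''⟩ := forall_exists_isReturn hF hw hJ hJ01
    (fun x hx h => absurd h (hb x hx)) hx le_rfl h' x₀ hx₀
  have : R' = R := le_antisymm hR' ((hret.eq h'').le.trans hR'')
  exact this ▸ h'

/-- A blocked position that is a limit of positions with return height at most `M` is blocked at
height at most `M`. -/
theorem top_le_of_frequently [T2Space X] (hF : F.IsHalfTranslation) (hw : γ.hol.re ≠ 0)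
    {x h M : ℝ} (hx : x ∈ γ.blocked) (ht : F.IsTop γ.path γ.hol x h p)
    (hfreq : ∃ᶠ x' in 𝓝 x, ∃ R ≤ M, γ.IsReturn x' R) : h ≤ M := by
  by_contra hcon
  push Not at hcon
  obtain ⟨-, k, p', ht', hno⟩ := hx
  have hkh := ht.height_eq hF hw ht'
  have hM : 0 < M := by
    obtain ⟨x', R, hR, h3⟩ := hfreq.exists
    exact h3.pos.trans_le hR
  obtain ⟨x', ⟨R, hR, h3⟩, h4⟩ := (hfreq.and_eventually
    (eventually_not_isReturn hF hw hM (ht.dom M ⟨hM.le, hcon⟩)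
      (fun y hy => hno y ⟨hy.1, hy.2.trans_lt (hkh ▸ hcon)⟩))).exists
  exact h4 R hR h3

end SaddleConnection

end FlatStructure

namespace FlatStructure

variable {X : Type*} [TopologicalSpace X]
variable {F : FlatStructure X} {w : ℂ} {p : X}

/-! ### Area, and recurrence of the vertical leaves -/

theorem det_shearMap (w : ℂ) : LinearMap.det (shearMap w : ℂ →ₗ[ℝ] ℂ) = w.re := by
  rw [← LinearMap.det_toMatrix Complex.basisOneI, Matrix.det_fin_two]
  simp [LinearMap.toMatrix_apply]

theorem volume_reProdIm (s t : Set ℝ) : volume (s ×ℂ t) = volume s * volume t := by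
  have h : s ×ℂ t = Complex.measurableEquivRealProd ⁻¹' (s ×ˢ t) := by
    ext z
    simp [Complex.mem_reProdIm]
  rw [h, Complex.volume_preserving_equiv_real_prod.measure_preimage_equiv,
    Measure.volume_eq_prod, Measure.prod_prod]

/-- An injective developing map on an open plane region is the inverse of a flat chart. -/
theorem volume_image_le_area [T2Space X] (hF : F.IsHalfTranslation) (hw : w.re ≠ 0) {f : ℂ → X}
    {Q : Set ℂ} (hQ : IsOpen Q) (hf : ∀ z ∈ Q, F.IsDevAt (shearMap w) f z) (hinj : InjOn f Q) :
    ENNReal.ofReal |w.re| * volume Q ≤ F.area := by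
  let Lh : ℂ ≃ₜ ℂ := (LinearEquiv.ofBijective (shearMap w : ℂ →ₗ[ℝ] ℂ)
    ⟨shearMap_injective hw, shearMap_surjective hw⟩).toContinuousLinearEquiv.toHomeomorph
  have hLh : ∀ z, Lh z = shearMap w z := fun z => rfl
  have hopen : IsOpenMap (((hinj.toPartialEquiv f Q).source).domRestrict
      (hinj.toPartialEquiv f Q)) := by
    rw [isOpenMap_iff_nhds_le]
    rintro ⟨z, hz⟩
    have h1 := (hf z hz).nhds_le_map (shearMap_surjective hw)
    rw [← map_nhds_subtype_coe_eq_nhds hz (hQ.mem_nhds hz), Filter.map_map] at h1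
    exact h1
  let e₀ : OpenPartialHomeomorph ℂ X := OpenPartialHomeomorph.ofContinuousOpenRestrict
    (hinj.toPartialEquiv f Q) (fun z hz => (hf z hz).continuousAt.continuousWithinAt) hopen hQ
  have he₀ : ∀ z, e₀ z = f z := fun z => rfl
  let e : OpenPartialHomeomorph X ℂ := e₀.symm.transHomeomorph Lh
  have he : e ∈ F.charts := by
    apply hF.mem_charts
    intro x hx
    have hx' : x ∈ e₀.target := hx
    have hz : e₀.symm x ∈ Q := e₀.map_target hx'
    have hfz : f (e₀.symm x) = x := e₀.right_inv hx'
    obtain ⟨φ, hφ, h1, h2⟩ := hf _ hz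
    rw [hfz] at h1 h2
    refine ⟨φ, hφ, h1, 1, Or.inl rfl, shearMap w (e₀.symm x) - φ x, ?_⟩
    have h3 := (e₀.continuousAt_symm hx').eventually h2
    filter_upwards [h3, e₀.open_target.mem_nhds hx'] with y h4 h5
    have hfy : f (e₀.symm y) = y := e₀.right_inv h5
    rw [hfy] at h4
    change shearMap w (e₀.symm y) = _
    rw [h4.2, one_smul, map_sub]
    ring
  have htarget : e.target = shearMap w '' Q := by
    change Lh.symm ⁻¹' Q = _
    rw [← Lh.image_eq_preimage_symm]
    rfl
  have hvol : volume e.target = ENNReal.ofReal |w.re| * volume Q := by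
    rw [htarget]
    have := Measure.addHaar_image_linearMap volume (shearMap w : ℂ →ₗ[ℝ] ℂ) Q
    rw [det_shearMap] at this
    exact this
  rw [← hvol, area]
  refine le_trans ?_ (le_iSup_of_le ({e} : Finset _) (le_iSup_of_le (by simpa using he)
    (le_iSup_of_le (by simp) le_rfl)))
  simp

/-- A finite set of reals containing points on both sides of `x` and not `x` itself has neighbours
of `x`. -/
theorem exists_neighbours {C : Set ℝ} (hC : C.Finite) {x a₀ b₀ : ℝ} (ha₀ : a₀ ∈ C) (hb₀ : b₀ ∈ C)
    (hax : a₀ < x) (hxb : x < b₀) (hx : x ∉ C) :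
    ∃ a ∈ C, ∃ b ∈ C, a < x ∧ x < b ∧ ∀ c ∈ Ioo a b, c ∉ C := by
  obtain ⟨a, ⟨haC, hax'⟩, ha⟩ := (hC.subset (inter_subset_left (t := Iio x))).exists_maximal
    ⟨a₀, ha₀, hax⟩
  obtain ⟨b, ⟨hbC, hbx'⟩, hb⟩ := (hC.subset (inter_subset_left (t := Ioi x))).exists_minimal
    ⟨b₀, hb₀, hxb⟩
  refine ⟨a, haC, b, hbC, hax', hbx', ?_⟩
  intro c hc hcC
  rcases lt_trichotomy c x with h | h | h
  · exact absurd (ha ⟨hcC, h⟩ hc.1.le) (not_le.mpr hc.1)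
  · exact hx (h ▸ hcC)
  · exact absurd (hb ⟨hcC, h⟩ hc.2.le) (not_le.mpr hc.2)

theorem exists_gap {C : Set ℝ} (hC : C.Finite) :
    ∃ g > 0, ∀ a ∈ C, ∀ b ∈ C, a < b → g ≤ b - a := by
  by_cases hn : C.Nontrivial
  · refine ⟨C.infsep, hC.infsep_pos_iff_nontrivial.mpr hn, fun a ha b hb hab => ?_⟩
    have := infsep_le_dist_of_mem hb ha hab.ne'
    rwa [Real.dist_eq, abs_of_pos (sub_pos.mpr hab)] at this
  · rw [not_nontrivial_iff] at hn
    exact ⟨1, one_pos, fun a ha b hb hab => absurd (hn ha hb) hab.ne⟩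

/-- Near the end of a vertical leaf at a singularity, `ξ ^ n` is minus the square of the distance
along the leaf. -/
theorem IsTop.eventually_pow_eq [T2Space X] (hF : F.IsHalfTranslation) {β : ℝ → X}
    (hw : w.re ≠ 0) {x h : ℝ} (ht : F.IsTop β w x h p) {ξ : OpenPartialHomeomorph X ℂ} {r : ℝ}
    {n : ℕ} (hc : F.IsCone p ξ r n) :
    ∃ ε > 0, ∀ s ∈ Ioo 0 ε, s < h ∧ F.devMap β w ⟨x, h - s⟩ ∈ ξ.source ∧
      ξ (F.devMap β w ⟨x, h - s⟩) ^ n = -(s : ℂ) ^ 2 := by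
  obtain ⟨y₁, hy₁, hsub⟩ := (mem_nhdsLT_iff_exists_Ioo_subset' ht.pos).mp
    (ht.tendsto.eventually (ξ.open_source.mem_nhds hc.mem))
  have hy₂ : max 0 y₁ < h := max_lt ht.pos hy₁
  have hdom : ∀ y ∈ Ioo (max 0 y₁) h, (⟨x, y⟩ : ℂ) ∈ F.devDomain β w := fun y hy =>
    ht.dom y ⟨(le_max_left _ _).trans hy.1.le, hy.2⟩
  have hsrc : ∀ y ∈ Ioo (max 0 y₁) h, F.devMap β w ⟨x, y⟩ ∈ ξ.source := fun y hy =>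
    hsub ⟨(le_max_right _ _).trans_lt hy.1, hy.2⟩
  obtain ⟨b, hb⟩ := hc.exists_eq_sq hF vert_injective isPreconnected_Ioo
    (fun y hy => isDevAt_vert hF hw (hdom y hy)) hsrc
  have hb' : ∀ y ∈ Ioo (max 0 y₁) h, ξ (F.devMap β w ⟨x, y⟩) ^ n = (vert y - b) ^ 2 :=
    fun y hy => (hb y hy).self_of_nhds
  have hbh : vert h - b = 0 := by
    have t1 : Tendsto (fun y : ℝ => ξ (F.devMap β w ⟨x, y⟩) ^ n) (𝓝[<] h) (𝓝 0) := by
      have := ((ξ.continuousAt hc.mem).tendsto.comp ht.tendsto).pow n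
      simpa [hc.map_zero, hc.n_pos.ne'] using this
    have t2 : Tendsto (fun y : ℝ => (vert y - b) ^ 2) (𝓝[<] h) (𝓝 ((vert h - b) ^ 2)) := by
      have : Continuous (fun y : ℝ => (vert y - b) ^ 2) := by fun_prop
      exact (this.tendsto h).mono_left nhdsWithin_le_nhds
    have t3 : Tendsto (fun y : ℝ => (vert y - b) ^ 2) (𝓝[<] h) (𝓝 0) := by
      refine t1.congr' ?_
      filter_upwards [Ioo_mem_nhdsLT hy₂] with y hy
      exact hb' y hy
    exact pow_eq_zero_iff (two_ne_zero) |>.mp (tendsto_nhds_unique t2 t3)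
  refine ⟨h - max 0 y₁, sub_pos.mpr hy₂, fun s hs => ?_⟩
  have hm : h - s ∈ Ioo (max 0 y₁) h := ⟨by linarith [hs.2], by linarith [hs.1]⟩
  refine ⟨by linarith [hs.2, le_max_left 0 y₁], hsrc _ hm, ?_⟩
  rw [hb' _ hm, ← sub_eq_zero.mp hbh]
  simp only [ContinuousLinearMap.toSpanSingleton_apply, Complex.real_smul]
  push_cast
  linear_combination (s : ℂ) ^ 2 * Complex.I_sq

namespace SaddleConnection

variable {γ : F.SaddleConnection}

/-- If the leaves going up from an interval of positions, finitely many excepted, do not return to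
`γ` before height `M`, then the area is at least half that of the rectangle they sweep out: the
lower half of the rectangle is embedded. -/
theorem mul_le_area [T2Space X] (hF : F.IsHalfTranslation) (hw : γ.hol.re ≠ 0) {A : ℝ≥0}
    (hA : F.area ≤ A) {a b M : ℝ} (hab : a < b) (hM : 0 < M) (hsub : Ioo a b ⊆ Ioo 0 1)
    {E : Set ℝ} (hE : E.Finite)
    (h : ∀ x ∈ Ioo a b, x ∉ E → (⟨x, M⟩ : ℂ) ∈ γ.dom ∧ ∀ y ∈ Ioo 0 M, γ.dev ⟨x, y⟩ ∉ γ.support) :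
    (b - a) * |γ.hol.re| * M ≤ 2 * A := by
  set Q : Set ℂ := (Ioo a b \ E) ×ℂ Ioo 0 (M / 2) with hQ
  have hQo : IsOpen Q := (isOpen_Ioo.sdiff hE.isClosed).reProdIm isOpen_Ioo
  have hdom : ∀ x ∈ Ioo a b, x ∉ E → ∀ y, 0 ≤ y → y ≤ M → (⟨x, y⟩ : ℂ) ∈ γ.dom :=
    fun x hx hxE y h0 h1 => mk_mem_devDomain_of_le (h x hx hxE).1 h0 h1
  -- Where two leaves meet in the lower half, follow the one whose point is lower down to `γ`. The
  -- point reached lies on the other leaf as well, above height `0` and below `M`, unless the two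
  -- points have the same height and both leaves reach `γ` together.
  have key : ∀ z ∈ Q, ∀ z' ∈ Q, z'.im ≤ z.im → γ.dev z = γ.dev z' → z = z' := by
    rintro ⟨x, y⟩ ⟨⟨hx, hxE⟩, hy0, hyM⟩ ⟨x', y'⟩ ⟨⟨hx', hxE'⟩, hy0', hyM'⟩ hle heq
    simp only at hx hxE hx' hxE' hy0 hyM hy0' hyM' hle
    have hd : ∀ s ∈ Icc 0 M, F.IsDevAt vert (fun y : ℝ => γ.dev ⟨x, y⟩) s := fun s hs =>
      isDevAt_vert hF hw (hdom x hx hxE s hs.1 hs.2)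
    have hd' : ∀ s ∈ Icc 0 M, F.IsDevAt vert (fun y : ℝ => γ.dev ⟨x', y⟩) s := fun s hs =>
      isDevAt_vert hF hw (hdom x' hx' hxE' s hs.1 hs.2)
    have hbase : γ.dev ⟨x', 0⟩ = γ.path x' := dev_ofReal hF hw (hsub hx')
    have hsupp : γ.dev ⟨x', 0⟩ ∈ γ.support := hbase ▸ γ.path_mem_support (hsub hx')
    rcases (hd' y' ⟨hy0'.le, by linarith⟩).eventually_add_or_sub hF
      (hd y ⟨hy0.le, by linarith⟩) heq.symm with hev | hev
    · have h1 := eq_of_eventually_add hF vert_injective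
        (isPreconnected_Icc (a := -y') (b := 0)) ⟨by linarith, le_rfl⟩
        (fun v hv => hd' _ ⟨by linarith [hv.1], by linarith [hv.2]⟩)
        (fun v hv => hd _ ⟨by linarith [hv.1], by linarith [hv.2]⟩) hev (-y')
        ⟨le_rfl, by linarith⟩
      simp only [add_neg_cancel] at h1
      rcases hle.eq_or_lt with h2 | h2
      · rw [← h2, add_neg_cancel, hbase, dev_ofReal hF hw (hsub hx)] at h1
        rw [γ.path_injOn hF (hsub hx') (hsub hx) h1, h2]
      · exact absurd (h1 ▸ hsupp) ((h x hx hxE).2 _ ⟨by linarith, by linarith⟩)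
    · have h1 := eq_of_eventually_sub hF vert_injective
        (isPreconnected_Icc (a := -y') (b := 0)) ⟨by linarith, le_rfl⟩
        (fun v hv => hd' _ ⟨by linarith [hv.1], by linarith [hv.2]⟩)
        (fun v hv => hd _ ⟨by linarith [hv.2], by linarith [hv.1]⟩) hev (-y')
        ⟨le_rfl, by linarith⟩
      simp only [add_neg_cancel] at h1
      exact absurd (h1 ▸ hsupp) ((h x hx hxE).2 _ ⟨by linarith, by linarith⟩)
  have hinj : InjOn γ.dev Q := by
    intro z hz z' hz' heq
    rcases le_total z'.im z.im with hle | hle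
    · exact key z hz z' hz' hle heq
    · exact (key z' hz' z hz hle heq.symm).symm
  have h1 := (volume_image_le_area hF hw hQo (fun z hz => isDevAt_devMap hF hw (by
    have hyM : z.im < M / 2 := hz.2.2
    exact hdom z.re hz.1.1 hz.1.2 z.im (le_of_lt hz.2.1) (by linarith))) hinj).trans hA
  rw [hQ, volume_reProdIm, measure_sdiff_null (hE.measure_zero _), Real.volume_Ioo,
    Real.volume_Ioo, ← ENNReal.ofReal_mul (by linarith), ← ENNReal.ofReal_mul (abs_nonneg _),
    ← ENNReal.ofReal_coe_nnreal] at h1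
  have h2 := (ENNReal.ofReal_le_ofReal_iff A.2).mp h1
  calc (b - a) * |γ.hol.re| * M = 2 * (|γ.hol.re| * ((b - a) * (M / 2 - 0))) := by ring
    _ ≤ 2 * A := mul_le_mul_of_nonneg_left h2 zero_le_two

/-- Only finitely many leaves going up from `γ` meet a singularity before they return to `γ`: they
arrive at the singularity from different directions, and there are finitely many vertical
directions at each singularity. -/
theorem finite_blocked [T2Space X] (hF : F.IsHalfTranslation) (hw : γ.hol.re ≠ 0)
    (hsing : F.sing.Finite) : γ.blocked.Finite := by
  have hsub : γ.blocked ⊆ ⋃ p ∈ F.sing, {x | x ∈ Ioo (0 : ℝ) 1 ∧ ∃ h,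
      F.IsTop γ.path γ.hol x h p ∧ ∀ y ∈ Ioo 0 h, γ.dev ⟨x, y⟩ ∉ γ.support} := by
    rintro x ⟨hx, h, p, ht, hno⟩
    simp only [mem_iUnion]
    exact ⟨p, ht.sing, hx, h, ht, hno⟩
  refine (hsing.biUnion fun p hp => ?_).subset hsub
  obtain ⟨ξ, r, n, hc⟩ := hF.exists_cone p hp
  by_contra hinf
  obtain ⟨t, hts, htc⟩ := Set.Infinite.exists_subset_card_eq hinf (n + 1)
  have hch : ∀ x ∈ t, ∃ h, F.IsTop γ.path γ.hol x h p ∧ ∀ y ∈ Ioo 0 h, γ.dev ⟨x, y⟩ ∉ γ.support :=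
    fun x hx => (hts hx).2
  choose! h ht hno using hch
  have hx01 : ∀ x ∈ t, x ∈ Ioo (0 : ℝ) 1 := fun x hx => (hts hx).1
  have hε : ∀ x ∈ t, ∃ ε > 0, ∀ s ∈ Ioo 0 ε, s < h x ∧ γ.dev ⟨x, h x - s⟩ ∈ ξ.source ∧
      ξ (γ.dev ⟨x, h x - s⟩) ^ n = -(s : ℂ) ^ 2 := fun x hx => (ht x hx).eventually_pow_eq hF hw hc
  choose! ε hε0 hε using hε
  obtain ⟨s, hs0, hs⟩ : ∃ s > 0, ∀ x ∈ t, s < ε x := by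
    have h1 : ∀ᶠ s in 𝓝[>] (0 : ℝ), ∀ x ∈ t, s < ε x := by
      rw [Filter.eventually_all_finset]
      intro x hx
      filter_upwards [Ioo_mem_nhdsGT (hε0 x hx)] with s hs
      exact hs.2
    obtain ⟨s, h2, h3⟩ := (h1.and self_mem_nhdsWithin).exists
    exact ⟨s, h3, h2⟩
  -- Two of the leaves pass through the same point at distance `s` from the singularity.
  have hcard : (Polynomial.nthRoots n (-(s : ℂ) ^ 2)).toFinset.card < t.card := by
    rw [htc, Nat.lt_succ_iff]
    exact (Multiset.toFinset_card_le _).trans (Polynomial.card_nthRoots n _)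
  obtain ⟨x, hx, x', hx', hne, heq⟩ := Finset.exists_ne_map_eq_of_card_lt_of_maps_to hcard
    (f := fun x => ξ (γ.dev ⟨x, h x - s⟩)) (by
      intro x hx
      simp only [Finset.mem_coe, Multiset.mem_toFinset, Polynomial.mem_nthRoots hc.n_pos]
      exact (hε x hx s ⟨hs0, hs x hx⟩).2.2)
  clear hcard htc
  wlog hle : h x ≤ h x' generalizing x x'
  · exact this x' hx' x hx hne.symm heq.symm (le_of_not_ge hle)
  obtain ⟨g1, g2, -⟩ := hε x hx s ⟨hs0, hs x hx⟩
  obtain ⟨g1', g2', -⟩ := hε x' hx' s ⟨hs0, hs x' hx'⟩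
  have heq' : γ.dev ⟨x, h x - s⟩ = γ.dev ⟨x', h x' - s⟩ := ξ.injOn g2 g2' heq
  have hd : ∀ y ∈ Ico 0 (h x), F.IsDevAt vert (fun y : ℝ => γ.dev ⟨x, y⟩) y := fun y hy =>
    isDevAt_vert hF hw ((ht x hx).dom y hy)
  have hd' : ∀ y ∈ Ico 0 (h x'), F.IsDevAt vert (fun y : ℝ => γ.dev ⟨x', y⟩) y := fun y hy =>
    isDevAt_vert hF hw ((ht x' hx').dom y hy)
  rcases (hd (h x - s) ⟨by linarith, by linarith⟩).eventually_add_or_sub hF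
    (hd' (h x' - s) ⟨by linarith, by linarith⟩) heq' with hev | hev
  · have h1 := eq_of_eventually_add hF vert_injective
      (isPreconnected_Icc (a := -(h x - s)) (b := 0)) ⟨by linarith, le_rfl⟩
      (fun v hv => hd _ ⟨by linarith [hv.1], by linarith [hv.2]⟩)
      (fun v hv => hd' _ ⟨by linarith [hv.1], by linarith [hv.2]⟩) hev (-(h x - s))
      ⟨le_rfl, by linarith⟩
    have e1 : h x - s + -(h x - s) = 0 := by ring
    have e2 : h x' - s + -(h x - s) = h x' - h x := by ring
    rw [e1, e2, dev_ofReal hF hw (hx01 x hx)] at h1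
    rcases hle.eq_or_lt with h2 | h2
    · rw [h2, sub_self, dev_ofReal hF hw (hx01 x' hx')] at h1
      exact hne (γ.path_injOn hF (hx01 x hx) (hx01 x' hx') h1)
    · refine hno x' hx' (h x' - h x) ⟨by linarith, by linarith [(ht x hx).pos]⟩ ?_
      rw [← h1]
      exact γ.path_mem_support (hx01 x hx)
  · -- The distances to the singularity would vary in opposite directions.
    have h1 : ∀ᶠ v in 𝓝[>] (0 : ℝ), v < s ∧ v < ε x' - s ∧
        γ.dev ⟨x, h x - s + v⟩ = γ.dev ⟨x', h x' - s - v⟩ := by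
      filter_upwards [hev.filter_mono nhdsWithin_le_nhds, Ioo_mem_nhdsGT hs0,
        Ioo_mem_nhdsGT (show 0 < ε x' - s by linarith [hs x' hx'])] with v k1 k2 k3
      exact ⟨k2.2, k3.2, k1⟩
    obtain ⟨v, ⟨k1, k2, k3⟩, hv0⟩ := (h1.and self_mem_nhdsWithin).exists
    have hv0' : 0 < v := hv0
    have m1 := (hε x hx (s - v) ⟨by linarith, by linarith [hs x hx]⟩).2.2
    have m2 := (hε x' hx' (s + v) ⟨by linarith, by linarith⟩).2.2
    have e1 : h x - (s - v) = h x - s + v := by ring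
    have e2 : h x' - (s + v) = h x' - s - v := by ring
    rw [e1, k3] at m1
    rw [e2, m1] at m2
    have m3 : (s - v) ^ 2 = (s + v) ^ 2 := by
      have := neg_injective m2
      exact_mod_cast this
    nlinarith [mul_pos hs0 hv0']

theorem finite_ends [T2Space X] (hF : F.IsHalfTranslation) (hw : γ.hol.re ≠ 0)
    (hsing : F.sing.Finite) : (insert 0 (insert 1 γ.blocked)).Finite :=
  ((finite_blocked hF hw hsing).insert 1).insert 0

/-- A position that is not blocked lies in an interval of positions that are not blocked whose
endpoints are blocked or endpoints of `γ`. -/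
theorem exists_interval [T2Space X] (hF : F.IsHalfTranslation) (hw : γ.hol.re ≠ 0)
    (hsing : F.sing.Finite) {x : ℝ} (hx : x ∈ Ioo (0 : ℝ) 1) (hb : x ∉ γ.blocked) :
    ∃ a ∈ insert 0 (insert 1 γ.blocked), ∃ b ∈ insert 0 (insert 1 γ.blocked), a < x ∧ x < b ∧
      Ioo a b ⊆ Ioo 0 1 ∧ ∀ c ∈ Ioo a b, c ∉ γ.blocked := by
  have hxC : x ∉ insert 0 (insert 1 γ.blocked) := by
    rintro (h | h | h)
    · exact hx.1.ne' h
    · exact hx.2.ne h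
    · exact hb h
  obtain ⟨a, ha, b, hb, h1, h2, h3⟩ := exists_neighbours (finite_ends hF hw hsing)
    (mem_insert _ _) (mem_insert_of_mem _ (mem_insert _ _)) hx.1 hx.2 hxC
  refine ⟨a, ha, b, hb, h1, h2, ?_, fun c hc h =>
    h3 c hc (mem_insert_of_mem _ (mem_insert_of_mem _ h))⟩
  intro c hc
  constructor
  · by_contra h
    exact h3 0 ⟨hc.1.trans_le (not_lt.mp h), hx.1.trans h2⟩ (mem_insert _ _)
  · by_contra h
    exact h3 1 ⟨h1.trans hx.2, (not_lt.mp h).trans_lt hc.2⟩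
      (mem_insert_of_mem _ (mem_insert _ _))

/-- All leaves going up from `γ` that are not blocked return to `γ`, after a bounded time. -/
theorem exists_bound_isReturn [T2Space X] [CompactSpace X] (hF : F.IsHalfTranslation)
    (hw : γ.hol.re ≠ 0) (hsing : F.sing.Finite) {A : ℝ≥0} (hA : F.area ≤ A) :
    ∃ B : ℝ, ∀ x ∈ Ioo (0 : ℝ) 1, x ∉ γ.blocked → ∃ R ≤ B, γ.IsReturn x R := by
  obtain ⟨g, hg, hgap⟩ := exists_gap (finite_ends hF hw hsing)
  have hw' : 0 < |γ.hol.re| := abs_pos.mpr hw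
  have hB : 0 < (2 * (A : ℝ) + 1) / (g * |γ.hol.re|) := by positivity
  refine ⟨(2 * A + 1) / (g * |γ.hol.re|), fun x hx hb => ?_⟩
  obtain ⟨a, ha, b, hb', h1, h2, h3, h4⟩ := exists_interval hF hw hsing hx hb
  by_contra hcon
  have hno : ∀ x' ∈ Ioo a b, (⟨x', (2 * (A : ℝ) + 1) / (g * |γ.hol.re|)⟩ : ℂ) ∈ γ.dom ∧
      ∀ y ∈ Ioc 0 ((2 * (A : ℝ) + 1) / (g * |γ.hol.re|)), γ.dev ⟨x', y⟩ ∉ γ.support := by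
    intro x' hx'
    rcases exists_isReturn_or hF hw hB (h3 hx') (fun h => absurd h (h4 x' hx')) with
      ⟨R, hR, hret⟩ | h
    · exact absurd ⟨R, hR, hret.eq_on hF hw isPreconnected_Ioo h3 h4 hx' x ⟨h1, h2⟩⟩ hcon
    · exact h
  have := mul_le_area hF hw hA (h1.trans h2) hB h3 finite_empty
    (fun x' hx' _ => ⟨(hno x' hx').1, fun y hy => (hno x' hx').2 y ⟨hy.1, hy.2.le⟩⟩)
  have hgba := hgap a ha b hb' (h1.trans h2)
  have h5 : g * |γ.hol.re| * ((2 * (A : ℝ) + 1) / (g * |γ.hol.re|)) ≤ 2 * A :=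
    le_trans (by gcongr) this
  rw [mul_div_cancel₀ _ (by positivity)] at h5
  linarith

end SaddleConnection

end FlatStructure

namespace FlatStructure

variable {X : Type*} [TopologicalSpace X]
variable {F : FlatStructure X} {w : ℂ} {p : X}

/-! ### Vertical leaves meet the saddle connection -/

/-- A half-translation structure with finitely many singularities, area at most `A`, and no
vertical saddle connection. -/
structure IsAdmissible (F : FlatStructure X) (A : ℝ≥0) : Prop where
  half : F.IsHalfTranslation
  finite_sing : F.sing.Finite
  area_le : F.area ≤ A
  re_ne_zero : ∀ γ : F.SaddleConnection, γ.hol.re ≠ 0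

/-- `a`, restricted to `[0, d]`, is a vertical path that meets `S` for the first time, at a positive
time, at its end. -/
structure IsFirstHit (F : FlatStructure X) (S : Set X) (a : ℝ → X) (d : ℝ) : Prop where
  pos : 0 < d
  dev : ∀ v ∈ Icc 0 d, F.IsDevAt vert a v
  mem : a d ∈ S
  notMem : ∀ v ∈ Ioo 0 d, a v ∉ S

theorem IsFirstHit.le [T2Space X] (hF : F.IsHalfTranslation) {S : Set X} {a b : ℝ → X} {d d' : ℝ}
    (ha : F.IsFirstHit S a d) (hb : F.IsFirstHit S b d') (h : a =ᶠ[𝓝 0] b) : d' ≤ d := by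
  by_contra hcon
  push Not at hcon
  have := (IsDevAt.eventuallyEq_of_isPreconnected hF vert_injective isPreconnected_Icc ha.dev
    (fun v hv => hb.dev v ⟨hv.1, hv.2.trans hcon.le⟩) ⟨le_rfl, ha.pos.le⟩ h d
    ⟨ha.pos.le, le_rfl⟩).eq_of_nhds
  exact hb.notMem d ⟨ha.pos, hcon⟩ (this ▸ ha.mem)

theorem IsFirstHit.eq [T2Space X] (hF : F.IsHalfTranslation) {S : Set X} {a b : ℝ → X} {d d' : ℝ}
    (ha : F.IsFirstHit S a d) (hb : F.IsFirstHit S b d') (h : a =ᶠ[𝓝 0] b) : d = d' :=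
  le_antisymm (hb.le hF ha h.symm) (ha.le hF hb h)

/-- `c`, restricted to `[0, R]`, is a vertical path that passes through `q` at time `y` and meets
`S` at its two ends only. -/
structure IsCrossing (F : FlatStructure X) (S : Set X) (c : ℝ → X) (R y : ℝ) (q : X) : Prop where
  mem_Ioo : y ∈ Ioo 0 R
  dev : ∀ v ∈ Icc 0 R, F.IsDevAt vert c v
  left : c 0 ∈ S
  right : c R ∈ S
  notMem : ∀ v ∈ Ioo 0 R, c v ∉ S
  eq : c y = q

namespace IsCrossing

variable {S : Set X} {c c' : ℝ → X} {R R' y y' : ℝ} {q : X}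

theorem up (h : F.IsCrossing S c R y q) : F.IsFirstHit S (fun v => c (y + v)) (R - y) where
  pos := sub_pos.mpr h.mem_Ioo.2
  dev v hv := (h.dev _ ⟨by linarith [hv.1, h.mem_Ioo.1], by linarith [hv.2]⟩).comp_add_left
  mem := by
    rw [add_sub_cancel]
    exact h.right
  notMem v hv := h.notMem _ ⟨by linarith [hv.1, h.mem_Ioo.1], by linarith [hv.2]⟩

theorem down (hF : F.IsHalfTranslation) (h : F.IsCrossing S c R y q) :
    F.IsFirstHit S (fun v => c (y - v)) y where
  pos := h.mem_Ioo.1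
  dev v hv := (h.dev _ ⟨by linarith [hv.2], by linarith [hv.1, h.mem_Ioo.2]⟩).comp_sub_left hF
  mem := by
    rw [sub_self]
    exact h.left
  notMem v hv := h.notMem _ ⟨by linarith [hv.2], by linarith [hv.1, h.mem_Ioo.2]⟩

/-- A vertical path through a point of a crossing meets `S` at one of the ends of the crossing. -/
theorem exists_firstHit (hF : F.IsHalfTranslation) (h : F.IsCrossing S c R y q) {a : ℝ → X}
    (ha : F.IsDevAt vert a 0) (haq : a 0 = q) :
    ∃ b : ℝ → X, ∃ d ≤ R, F.IsFirstHit S b d ∧ a =ᶠ[𝓝 0] b := by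
  rcases ha.eventually_add_or_sub hF (h.dev y (Ioo_subset_Icc_self h.mem_Ioo))
    (haq.trans h.eq.symm) with hev | hev
  · refine ⟨_, R - y, by linarith [h.mem_Ioo.1], h.up, ?_⟩
    filter_upwards [hev] with v hv
    simpa using hv
  · refine ⟨_, y, h.mem_Ioo.2.le, h.down hF, ?_⟩
    filter_upwards [hev] with v hv
    simpa using hv

theorem length_eq [T2Space X] (hF : F.IsHalfTranslation) (h : F.IsCrossing S c R y q)
    (h' : F.IsCrossing S c' R' y' q) : R = R' := by
  have t : Tendsto (fun v : ℝ => -v) (𝓝 0) (𝓝 0) := by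
    simpa using (continuous_neg (G := ℝ)).tendsto 0
  rcases (h.dev y (Ioo_subset_Icc_self h.mem_Ioo)).eventually_add_or_sub hF
    (h'.dev y' (Ioo_subset_Icc_self h'.mem_Ioo)) (h.eq.trans h'.eq.symm) with hev | hev
  · have e1 := h.up.eq hF h'.up hev
    have e2 := (h.down hF).eq hF (h'.down hF) (by
      filter_upwards [t.eventually hev] with v hv
      simpa [sub_eq_add_neg] using hv)
    linarith
  · have e1 := h.up.eq hF (h'.down hF) hev
    have e2 := (h.down hF).eq hF h'.up (by
      filter_upwards [t.eventually hev] with v hv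
      simpa [sub_eq_add_neg] using hv)
    linarith

end IsCrossing

/-- Every nonsingular point is the midpoint of a horizontal straight path. -/
theorem exists_isStraight (hF : F.IsHalfTranslation) {q : X} (hq : q ∉ F.sing) :
    ∃ (β : ℝ → X) (w : ℂ), w.re ≠ 0 ∧ F.IsStraight β w ∧ β (1 / 2) = q := by
  obtain ⟨φ, hφ, hqφ⟩ := hF.exists_chart q hq
  obtain ⟨r, hr, hball⟩ := Metric.isOpen_iff.mp φ.open_target _ (φ.map_source hqφ)
  refine ⟨fun x => φ.symm (φ q + ContinuousLinearMap.toSpanSingleton ℝ (r : ℂ) (x - 1 / 2)), r,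
    by simpa using hr.ne', ?_, by simp [hqφ]⟩
  intro x hx
  refine isDevAt_symm hφ _ (hball ?_)
  rw [Metric.mem_ball, dist_eq_norm, add_sub_cancel_left,
    ContinuousLinearMap.toSpanSingleton_apply, norm_smul, Complex.norm_real,
    Real.norm_of_nonneg hr.le, Real.norm_eq_abs]
  have : |x - 1 / 2| < 1 := abs_lt.mpr ⟨by linarith [hx.1], by linarith [hx.2]⟩
  nlinarith

theorem one_sub_mk (x y : ℝ) : (1 : ℂ) - ⟨x, y⟩ = ⟨1 - x, -y⟩ := by
  apply Complex.ext <;> simp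

theorem mk_reverse_mem (hF : F.IsHalfTranslation) {β : ℝ → X} {x y : ℝ}
    (h : (⟨x, y⟩ : ℂ) ∈ F.devDomain (fun x => β (1 - x)) w) :
    (⟨1 - x, -y⟩ : ℂ) ∈ F.devDomain β w := by
  have h1 := one_sub_mem_devDomain hF h
  rw [one_sub_mk] at h1
  simpa using h1

/-- In the absence of vertical saddle connections, one of the two vertical leaves starting at a
nonsingular point goes on forever. -/
theorem IsAdmissible.exists_infinite_leaf [T2Space X] [CompactSpace X] {A : ℝ≥0}
    (hF : F.IsAdmissible A) {q : X} (hq : q ∉ F.sing) :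
    ∃ (β : ℝ → X) (w : ℂ), w.re ≠ 0 ∧ F.IsStraight β w ∧ β (1 / 2) = q ∧
      ∀ y : ℝ, 0 ≤ y → (⟨1 / 2, y⟩ : ℂ) ∈ F.devDomain β w := by
  obtain ⟨β, w, hw, hβ, hβq⟩ := exists_isStraight hF.half hq
  have hhalf : (1 / 2 : ℝ) ∈ Ioo (0 : ℝ) 1 := by norm_num
  have hβ' := hβ.reverse hF.half
  rcases forall_mem_or_exists_isTop hF.half hw hβ hhalf with h1 | ⟨h, p, ht⟩
  · exact ⟨β, w, hw, hβ, hβq, h1⟩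
  rcases forall_mem_or_exists_isTop hF.half hw hβ' hhalf with h1 | ⟨h', p', ht'⟩
  · refine ⟨_, w, hw, hβ', ?_, h1⟩
    norm_num
    simpa using hβq
  exfalso
  have hpos : 0 < h + h' := add_pos ht.pos ht'.pos
  have hdom : ∀ y ∈ Ioo (-h') h, (⟨1 / 2, y⟩ : ℂ) ∈ F.devDomain β w := by
    intro y hy
    rcases le_total 0 y with h0 | h0
    · exact ht.dom y ⟨h0, hy.2⟩
    · have := mk_reverse_mem hF.half (ht'.dom (-y) ⟨by linarith, by linarith [hy.1]⟩)
      norm_num at this ⊢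
      exact this
  have e : ∀ s : ℝ, (⟨1 / 2, -h'⟩ : ℂ) + s • (⟨0, h + h'⟩ : ℂ) = ⟨1 / 2, -h' + s * (h + h')⟩ :=
    fun s => by apply Complex.ext <;> simp
  obtain ⟨γ, hγ⟩ := exists_saddleConnection (F := F)
    (f := fun s : ℝ => F.devMap β w (⟨1 / 2, -h'⟩ + s • (⟨0, h + h'⟩ : ℂ)))
    (w := shearMap w ⟨0, h + h'⟩) (p₀ := p') (p₁ := p) (by
      rw [Ne, map_eq_zero_iff _ (shearMap_injective hw)]
      intro h0
      exact hpos.ne' (congrArg Complex.im h0)) ht'.sing ht.sing (by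
      intro s hs
      apply IsDevAt.comp_line
      apply isDevAt_devMap hF.half hw
      rw [e]
      exact hdom _ ⟨by nlinarith [hs.1], by nlinarith [hs.2]⟩) (by
      have t : Tendsto (fun s : ℝ => h' - s * (h + h')) (𝓝[>] 0) (𝓝[<] h') := by
        refine tendsto_nhdsWithin_iff.mpr ⟨?_, ?_⟩
        · have : Continuous (fun s : ℝ => h' - s * (h + h')) := by fun_prop
          simpa using (this.tendsto 0).mono_left nhdsWithin_le_nhds
        · filter_upwards [self_mem_nhdsWithin] with s hs
          exact sub_lt_self _ (mul_pos hs hpos)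
      refine (ht'.tendsto.comp t).congr' ?_
      filter_upwards [Ioo_mem_nhdsGT one_pos] with s hs
      have hm := hdom (-h' + s * (h + h')) ⟨by nlinarith [hs.1], by nlinarith [hs.2]⟩
      rw [e, ← devMap_reverse hF.half hw hm, one_sub_mk, Function.comp_apply]
      congr 2
      · norm_num
      · ring) (by
      have t : Tendsto (fun s : ℝ => -h' + s * (h + h')) (𝓝[<] 1) (𝓝[<] h) := by
        refine tendsto_nhdsWithin_iff.mpr ⟨?_, ?_⟩
        · have : Continuous (fun s : ℝ => -h' + s * (h + h')) := by fun_prop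
          simpa using (this.tendsto 1).mono_left nhdsWithin_le_nhds
        · filter_upwards [self_mem_nhdsWithin] with s hs
          have : s < 1 := hs
          simp only [mem_Iio]
          nlinarith
      refine (ht.tendsto.comp t).congr (fun s => ?_)
      rw [e, Function.comp_apply])
  apply hF.re_ne_zero γ
  rw [hγ]
  simp

/-- The leaf that ends at a singularity, seen as a segment starting at the singularity. -/
theorem IsTop.exists_isSegment [T2Space X] (hF : F.IsHalfTranslation) {β : ℝ → X} (hw : w.re ≠ 0)
    {x h : ℝ} (ht : F.IsTop β w x h p) :
    ∃ (σ : ℝ → X) (u : ℂ), F.IsSegment σ u ∧ u ≠ 0 ∧ u.re = 0 ∧ σ 0 = p ∧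
      ∀ s ∈ Ioo (0 : ℝ) 1, σ s = F.devMap β w ⟨x, h - s * h⟩ := by
  have e : ∀ s : ℝ, (⟨x, h⟩ : ℂ) + s • (⟨0, -h⟩ : ℂ) = ⟨x, h - s * h⟩ :=
    fun s => by apply Complex.ext <;> simp [sub_eq_add_neg]
  obtain ⟨σ, h1, h2, -, h3⟩ := IsStraight.exists_isSegment (F := F)
    (f := fun s : ℝ => F.devMap β w (⟨x, h⟩ + s • (⟨0, -h⟩ : ℂ)))
    (w := shearMap w ⟨0, -h⟩) (p₀ := p) (p₁ := F.devMap β w ⟨x, 0⟩) (by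
      intro s hs
      apply IsDevAt.comp_line
      apply isDevAt_devMap hF hw
      rw [e]
      exact ht.dom _ ⟨by nlinarith [hs.2, ht.pos], by nlinarith [hs.1, ht.pos]⟩) (by
      have t : Tendsto (fun s : ℝ => h - s * h) (𝓝[>] 0) (𝓝[<] h) := by
        refine tendsto_nhdsWithin_iff.mpr ⟨?_, ?_⟩
        · have : Continuous (fun s : ℝ => h - s * h) := by fun_prop
          simpa using (this.tendsto 0).mono_left nhdsWithin_le_nhds
        · filter_upwards [self_mem_nhdsWithin] with s hs
          exact sub_lt_self _ (mul_pos hs ht.pos)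
      refine (ht.tendsto.comp t).congr (fun s => ?_)
      rw [e, Function.comp_apply]) (by
      have hc := continuousAt_devMap_mk hF hw (ht.dom 0 ⟨le_rfl, ht.pos⟩)
      have t : Tendsto (fun s : ℝ => h - s * h) (𝓝[<] 1) (𝓝 0) := by
        have : Continuous (fun s : ℝ => h - s * h) := by fun_prop
        simpa using (this.tendsto 1).mono_left nhdsWithin_le_nhds
      refine (hc.tendsto.comp t).congr (fun s => ?_)
      rw [e, Function.comp_apply])
  refine ⟨σ, _, h1, ?_, by simp, h2, fun s hs => by rw [h3 s hs, e]⟩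
  rw [Ne, map_eq_zero_iff _ (shearMap_injective hw)]
  intro h0
  exact ht.pos.ne' (neg_eq_zero.mp (congrArg Complex.im h0))

/-- Arbitrarily close to a singularity, some vertical leaf ends at it. -/
theorem exists_prong [T2Space X] [CompactSpace X] (hF : F.IsHalfTranslation) (hp : p ∈ F.sing)
    {U : Set X} (hU : U ∈ 𝓝 p) :
    ∃ (σ : ℝ → X) (u : ℂ), F.IsSegment σ u ∧ u ≠ 0 ∧ u.re = 0 ∧ σ 0 = p ∧
      ∀ s ∈ Ioo (0 : ℝ) 1, σ s ∈ U := by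
  obtain ⟨ξ, r, n, hc⟩ := hF.exists_cone p hp
  obtain ⟨ρ, hρ, hρr, hρU⟩ := hc.exists_radius hU
  obtain ⟨s₀, hs₀, hsρ⟩ : ∃ s₀ > 0, (2 * s₀) ^ 2 < ρ ^ n := by
    have h1 : Tendsto (fun s : ℝ => (2 * s) ^ 2) (𝓝[>] 0) (𝓝 0) := by
      have : Continuous (fun s : ℝ => (2 * s) ^ 2) := by fun_prop
      simpa using (this.tendsto 0).mono_left nhdsWithin_le_nhds
    obtain ⟨s, h2, h3⟩ := ((h1.eventually (gt_mem_nhds (pow_pos hρ n))).and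
      self_mem_nhdsWithin).exists
    exact ⟨s, h3, h2⟩
  obtain ⟨ζ, hζ⟩ := IsAlgClosed.exists_pow_nat_eq (-(s₀ : ℂ) ^ 2) hc.n_pos
  have hζn : ‖ζ‖ ^ n = s₀ ^ 2 := by
    rw [← norm_pow, hζ, norm_neg, norm_pow, Complex.norm_real, Real.norm_of_nonneg hs₀.le]
  have hζρ : ‖ζ‖ < ρ := lt_of_pow_lt_pow_left₀ n hρ.le (by rw [hζn]; nlinarith)
  have hζt : ζ ∈ ξ.target := by
    rw [hc.target]
    simpa using hζρ.trans hρr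
  set z := ξ.symm ζ with hz
  have hzs : z ∈ ξ.source := ξ.map_target hζt
  have hξz : ξ z = ζ := ξ.right_inv hζt
  have hzp : z ≠ p := by
    intro h
    have h1 : ζ = 0 := by rw [← hξz, h, hc.map_zero]
    rw [h1, zero_pow hc.n_pos.ne'] at hζ
    have := neg_eq_zero.mp hζ.symm
    exact hs₀.ne' (by exact_mod_cast pow_eq_zero_iff two_ne_zero |>.mp this)
  have hhalf : (1 / 2 : ℝ) ∈ Ioo (0 : ℝ) 1 := by norm_num
  -- A horizontal path through `z`, oriented so that the upward leaf from `z` approaches `p`.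
  have hbase : ∃ (β : ℝ → X) (w : ℂ), w.re ≠ 0 ∧ F.IsStraight β w ∧ β (1 / 2) = z ∧
      ∀ᶠ y : ℝ in 𝓝 0, ξ (F.devMap β w ⟨1 / 2, y⟩) ^ n = (vert y - vert s₀) ^ 2 := by
    obtain ⟨β, w, hw, hβ, hβz⟩ := exists_isStraight hF (hc.notMem_sing hF hzs hzp)
    have h0 : (⟨1 / 2, 0⟩ : ℂ) ∈ F.devDomain β w := ofReal_mem_devDomain hβ hhalf
    have h0z : F.devMap β w ⟨1 / 2, 0⟩ = z :=
      (devMap_ofReal hF hw (ofReal_mem_devDomain hβ hhalf)).trans hβz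
    obtain ⟨b, hb⟩ := hc.exists_eq_sq hF vert_injective (isPreconnected_singleton (x := (0 : ℝ)))
      (f := fun y : ℝ => F.devMap β w ⟨1 / 2, y⟩)
      (by rintro y rfl; exact isDevAt_vert hF hw h0) (by rintro y rfl; rw [h0z]; exact hzs)
    have hb0 := hb 0 rfl
    have hbs : b ^ 2 = (vert s₀) ^ 2 := by
      have h1 := hb0.self_of_nhds
      rw [h0z, hξz, hζ] at h1
      simp only [map_zero, zero_sub, even_two, Even.neg_pow] at h1
      rw [← h1]
      simp only [ContinuousLinearMap.toSpanSingleton_apply, Complex.real_smul, mul_pow,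
        Complex.I_sq]
      ring
    rcases sq_eq_sq_iff_eq_or_eq_neg.mp hbs with rfl | rfl
    · exact ⟨β, w, hw, hβ, hβz, hb0⟩
    · refine ⟨_, w, hw, hβ.reverse hF, by norm_num; simpa using hβz, ?_⟩
      have t : Tendsto (fun v : ℝ => -v) (𝓝 0) (𝓝 0) := by
        simpa using (continuous_neg (G := ℝ)).tendsto 0
      have hm := ((continuous_mk (1 / 2)).tendsto 0).eventually (isOpen_devDomain.mem_nhds h0)
      filter_upwards [t.eventually hb0, t.eventually hm] with y h1 h2
      have h3 := devMap_reverse hF hw h2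
      rw [one_sub_mk, neg_neg] at h3
      norm_num at h3 h1 ⊢
      rw [h3, h1]
      ring
  obtain ⟨β, w, hw, hβ, hβz, hev⟩ := hbase
  have h0z : F.devMap β w ⟨1 / 2, 0⟩ = z :=
    (devMap_ofReal hF hw (ofReal_mem_devDomain hβ hhalf)).trans hβz
  -- The leaf stays in the disc of radius `ρ` up to time `s₀`, as long as it is defined.
  have hstay : ∀ y : ℝ, 0 ≤ y → y ≤ s₀ → (⟨1 / 2, y⟩ : ℂ) ∈ F.devDomain β w →
      F.devMap β w ⟨1 / 2, y⟩ ∈ ξ.source ∧ ‖ξ (F.devMap β w ⟨1 / 2, y⟩)‖ < ρ := by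
    intro y hy0 hys hy
    rcases hy0.eq_or_lt with rfl | hy0'
    · rw [h0z, hξz]
      exact ⟨hzs, hζρ⟩
    have e : ∀ θ : ℝ, (⟨1 / 2, 0⟩ : ℂ) + θ • (⟨0, y⟩ : ℂ) = ⟨1 / 2, θ * y⟩ :=
      fun θ => by apply Complex.ext <;> simp
    have h1 := hc.stay hF (b := shearMap w ⟨0, y⟩) (by
      rw [Ne, map_eq_zero_iff _ (shearMap_injective hw)]
      intro h
      exact hy0'.ne' (congrArg Complex.im h))
      (c := fun θ : ℝ => F.devMap β w (⟨1 / 2, 0⟩ + θ • (⟨0, y⟩ : ℂ))) (by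
      intro θ hθ
      apply IsDevAt.comp_line
      apply isDevAt_devMap hF hw
      rw [e]
      exact mk_mem_devDomain_of_le hy (mul_nonneg hθ.1 hy0) (mul_le_of_le_one_left hy0 hθ.2))
      (by rw [e, zero_mul, h0z]; exact hzs) hs₀.le
      (by rw [e, zero_mul, h0z, hξz, hζn]) hρ.le hρr.le (by
      have e2 : shearMap w ⟨0, y⟩ = y • Complex.I := by simp [shearMap_apply]
      rw [e2, norm_smul, Complex.norm_I, mul_one, Real.norm_of_nonneg hy0]
      refine lt_of_le_of_lt ?_ hsρ
      exact pow_le_pow_left₀ (by linarith) (by linarith) 2) 1 ⟨zero_le_one, le_rfl⟩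
    rw [e, one_mul] at h1
    exact h1
  have hnot : (⟨1 / 2, s₀⟩ : ℂ) ∉ F.devDomain β w := by
    intro hm
    have hd : ∀ y ∈ Icc 0 s₀, (⟨1 / 2, y⟩ : ℂ) ∈ F.devDomain β w := fun y hy =>
      mk_mem_devDomain_of_le hm hy.1 hy.2
    obtain ⟨b, hb⟩ := hc.exists_eq_sq hF vert_injective (isPreconnected_Icc (a := 0) (b := s₀))
      (f := fun y : ℝ => F.devMap β w ⟨1 / 2, y⟩)
      (fun y hy => isDevAt_vert hF hw (hd y hy)) (fun y hy => (hstay y hy.1 hy.2 (hd y hy)).1)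
    have hbs : vert s₀ = b := by
      by_contra hne
      have h4 : ∀ᶠ y : ℝ in 𝓝 0, vert y = (b + vert s₀) / 2 := by
        filter_upwards [hev, hb 0 ⟨le_rfl, hs₀.le⟩] with y h5 h6
        have h7 : (b - vert s₀) * (2 * vert y - (b + vert s₀)) = 0 := by
          linear_combination h6 - h5
        rcases mul_eq_zero.mp h7 with h8 | h8
        · exact absurd (sub_eq_zero.mp h8).symm hne
        · linear_combination h8 / 2
      obtain ⟨y, h6, h7⟩ := ((h4.filter_mono nhdsWithin_le_nhds).and
        (self_mem_nhdsWithin (a := (0 : ℝ)) (s := {0}ᶜ))).exists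
      exact h7 (vert_injective (h6.trans h4.self_of_nhds.symm))
    have h1 := (hb s₀ ⟨hs₀.le, le_rfl⟩).self_of_nhds
    rw [hbs, sub_self, zero_pow two_ne_zero, pow_eq_zero_iff hc.n_pos.ne'] at h1
    have h2 := hstay s₀ hs₀.le le_rfl hm
    have h3 : F.devMap β w ⟨1 / 2, s₀⟩ = p := ξ.injOn h2.1 hc.mem (h1.trans hc.map_zero.symm)
    exact (isDevAt_devMap hF hw hm).notMem_sing hF (h3 ▸ hp)
  rcases forall_mem_or_exists_isTop hF hw hβ hhalf with h1 | ⟨h, p', ht⟩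
  · exact absurd (h1 s₀ hs₀.le) hnot
  have hhs : h ≤ s₀ := by
    by_contra hcon
    exact hnot (ht.dom s₀ ⟨hs₀.le, not_le.mp hcon⟩)
  have hp' : p' = p := by
    have hK : IsCompact {x | x ∈ ξ.source ∧ ξ x ∈ Metric.closedBall (0 : ℂ) ρ} :=
      hc.isCompact_preimage (isCompact_closedBall _ _) (fun z hz => by
        rw [mem_closedBall_zero_iff] at hz
        exact hz.trans_lt hρr)
    have hm := hK.isClosed.mem_of_tendsto ht.tendsto (by
      filter_upwards [Ico_mem_nhdsLT ht.pos] with y hy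
      have h2 := hstay y hy.1 (hy.2.le.trans hhs) (ht.dom y hy)
      exact ⟨h2.1, by simpa using h2.2.le⟩)
    by_contra hne
    exact hc.notMem_sing hF hm.1 hne ht.sing
  subst hp'
  obtain ⟨σ, u, k1, k2, k3, k4, k5⟩ := ht.exists_isSegment hF hw
  refine ⟨σ, u, k1, k2, k3, k4, fun s hs => ?_⟩
  have hy : h - s * h ∈ Ico 0 h := ⟨by nlinarith [hs.2, ht.pos], by nlinarith [hs.1, ht.pos]⟩
  rw [k5 s hs]
  have h2 := hstay _ hy.1 (hy.2.le.trans hhs) (ht.dom _ hy)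
  exact hρU _ h2.1 h2.2

end FlatStructure

namespace FlatStructure

variable {X : Type*} [TopologicalSpace X]
variable {F : FlatStructure X} {w : ℂ} {p : X}

/-! ### The region swept out by the leaves between returns -/

/-- The points on vertical paths of length `R` that meet `S` at their two ends only. -/
def swept (F : FlatStructure X) (S : Set X) (R : ℝ) : Set X :=
  {q | ∃ c y, F.IsCrossing S c R y q}

theorem swept_subset_compl {S : Set X} {R : ℝ} : F.swept S R ⊆ Sᶜ := by
  rintro q ⟨c, y, h⟩ hq
  exact h.notMem y h.mem_Ioo (h.eq ▸ hq)

theorem swept_length_eq [T2Space X] (hF : F.IsHalfTranslation) {S : Set X} {R R' : ℝ} {q : X}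
    (h : q ∈ F.swept S R) (h' : q ∈ F.swept S R') : R = R' := by
  obtain ⟨c, y, h⟩ := h
  obtain ⟨c', y', h'⟩ := h'
  exact h.length_eq hF h'

namespace SaddleConnection

variable {γ g : F.SaddleConnection}

variable (γ) in
/-- The saddle connection and its reverse: the two sides from which leaves can leave it upwards. -/
def sides (hF : F.IsHalfTranslation) : Set F.SaddleConnection := {γ, γ.reverse hF}

theorem support_of_mem_sides {hF : F.IsHalfTranslation} (hg : g ∈ γ.sides hF) :
    g.support = γ.support := by
  rcases hg with rfl | hg
  · rfl
  · rw [mem_singleton_iff.mp hg, reverse_support]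

theorem hol_of_mem_sides {hF : F.IsHalfTranslation} (hg : g ∈ γ.sides hF) : g.hol = γ.hol := by
  rcases hg with rfl | hg
  · rfl
  · rw [mem_singleton_iff.mp hg]
    rfl

theorem reverse_mem_dom {hF : F.IsHalfTranslation} {x y : ℝ} (h : (⟨x, y⟩ : ℂ) ∈ γ.dom) :
    (⟨1 - x, -y⟩ : ℂ) ∈ (γ.reverse hF).dom := by
  have := one_sub_mem_devDomain hF h
  rwa [one_sub_mk] at this

theorem reverse_dev [T2Space X] {hF : F.IsHalfTranslation} (hw : γ.hol.re ≠ 0) {x y : ℝ}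
    (h : (⟨x, y⟩ : ℂ) ∈ γ.dom) : (γ.reverse hF).dev ⟨1 - x, -y⟩ = γ.dev ⟨x, y⟩ := by
  have := devMap_reverse hF hw h
  rwa [one_sub_mk] at this

variable [T2Space X]

theorem dev_eq_of_eventuallyEq [CompactSpace X] (hF : F.IsHalfTranslation) (hw : γ.hol.re ≠ 0)
    {a : ℝ → X} {τ x : ℝ}
    (hτ : 0 ≤ τ) (ha : ∀ v ∈ Icc 0 τ, F.IsDevAt vert a v) (hx : x ∈ Ioo (0 : ℝ) 1)
    (h : a =ᶠ[𝓝 0] fun y => γ.dev ⟨x, y⟩) :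
    (⟨x, τ⟩ : ℂ) ∈ γ.dom ∧ ∀ v ∈ Icc 0 τ, γ.dev ⟨x, v⟩ = a v := by
  have hdom : (⟨x, τ⟩ : ℂ) ∈ γ.dom := by
    rcases forall_mem_or_exists_isTop hF hw γ.isStraight hx with hall | ⟨k, p, ht⟩
    · exact hall τ hτ
    · by_contra hcon
      have hk : k ≤ τ := by
        by_contra hk
        exact hcon (ht.dom τ ⟨hτ, not_le.mp hk⟩)
      have heq := IsDevAt.eventuallyEq_of_isPreconnected hF vert_injective
        (isPreconnected_Ico (a := (0 : ℝ)) (b := k))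
        (fun v hv => ha v ⟨hv.1, hv.2.le.trans hk⟩)
        (fun v hv => isDevAt_vert hF hw (ht.dom v hv)) ⟨le_rfl, ht.pos⟩ h
      have hak := ha k ⟨ht.pos.le, hk⟩
      have t1 : Tendsto a (𝓝[<] k) (𝓝 (a k)) :=
        hak.continuousAt.tendsto.mono_left nhdsWithin_le_nhds
      have t2 : Tendsto a (𝓝[<] k) (𝓝 p) := by
        refine ht.tendsto.congr' ?_
        filter_upwards [Ico_mem_nhdsLT ht.pos] with v hv
        exact ((heq v hv).eq_of_nhds).symm
      exact hak.notMem_sing hF (tendsto_nhds_unique t1 t2 ▸ ht.sing)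
  refine ⟨hdom, fun v hv => ?_⟩
  exact (IsDevAt.eventuallyEq_of_isPreconnected hF vert_injective isPreconnected_Icc ha
    (fun v hv => isDevAt_vert hF hw (mk_mem_devDomain_of_le hdom hv.1 hv.2)) ⟨le_rfl, hτ⟩ h v
    hv).eq_of_nhds.symm

/-- A vertical path that starts on `γ` is a leaf of one of the two developments. -/
theorem exists_dev_eq [CompactSpace X] (hF : F.IsHalfTranslation) (hw : γ.hol.re ≠ 0) {a : ℝ → X}
    {τ : ℝ}
    (hτ : 0 ≤ τ) (ha : ∀ v ∈ Icc 0 τ, F.IsDevAt vert a v) (h0 : a 0 ∈ γ.support) :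
    ∃ g ∈ γ.sides hF, ∃ x, (⟨x, τ⟩ : ℂ) ∈ g.dom ∧ ∀ v ∈ Icc 0 τ, g.dev ⟨x, v⟩ = a v := by
  have ha0 := ha 0 ⟨le_rfl, hτ⟩
  obtain ⟨x, hx, hxa⟩ := exists_of_mem_support h0 (ha0.notMem_sing hF)
  have hd := ofReal_mem_dom (γ := γ) hx
  rcases ha0.eventually_add_or_sub hF (isDevAt_vert hF hw hd)
    (hxa.symm.trans (dev_ofReal hF hw hx).symm) with hev | hev
  · refine ⟨γ, Or.inl rfl, x, dev_eq_of_eventuallyEq hF hw hτ ha hx ?_⟩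
    simpa [Filter.EventuallyEq] using hev
  · refine ⟨γ.reverse hF, Or.inr rfl, 1 - x, dev_eq_of_eventuallyEq (γ := γ.reverse hF) hF hw hτ ha
      ⟨by linarith [hx.2], by linarith [hx.1]⟩ ?_⟩
    have t : Tendsto (fun v : ℝ => -v) (𝓝 0) (𝓝 0) := by
      simpa using (continuous_neg (G := ℝ)).tendsto 0
    have hm := t.eventually (((continuous_mk x).tendsto 0).eventually
      (isOpen_devDomain.mem_nhds hd))
    filter_upwards [hev, hm] with v h1 h2
    have h3 := reverse_dev (hF := hF) hw h2
    rw [neg_neg] at h3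
    rw [h3]
    simpa using h1

theorem mem_image_dev [CompactSpace X] (hF : F.IsHalfTranslation) (hw : γ.hol.re ≠ 0) {a : ℝ → X}
    {τ : ℝ}
    (hτ : 0 ≤ τ) (ha : ∀ v ∈ Icc 0 τ, F.IsDevAt vert a v) (h0 : a 0 ∈ γ.support) :
    a τ ∈ γ.dev '' γ.dom := by
  obtain ⟨g, hg, x, h1, h2⟩ := exists_dev_eq hF hw hτ ha h0
  rw [← h2 τ ⟨hτ, le_rfl⟩]
  rcases hg with rfl | hg
  · exact ⟨_, h1, rfl⟩
  · rw [mem_singleton_iff] at hg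
    subst hg
    have h3 := mk_reverse_mem hF h1
    refine ⟨_, h3, ?_⟩
    have h4 := reverse_dev (hF := hF) hw h3
    rw [neg_neg, sub_sub_cancel] at h4
    exact h4.symm

theorem isOpen_image_dev (hF : F.IsHalfTranslation) (hw : γ.hol.re ≠ 0) :
    IsOpen (γ.dev '' γ.dom) := by
  rw [isOpen_iff_mem_nhds]
  rintro _ ⟨z, hz, rfl⟩
  exact (isDevAt_devMap hF hw hz).nhds_le_map (shearMap_surjective hw)
    (image_mem_map (isOpen_devDomain.mem_nhds hz))

/-- A point off `γ` that is reached by a leaf from `γ` is reached by one that does not meet `γ`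
again before. -/
theorem exists_dev_eq_of_notMem [CompactSpace X] (hF : F.IsHalfTranslation) (hw : γ.hol.re ≠ 0)
    {q : X}
    (hq : q ∈ γ.dev '' γ.dom) (hqs : q ∉ γ.support) :
    ∃ g ∈ γ.sides hF, ∃ x τ, 0 < τ ∧ (⟨x, τ⟩ : ℂ) ∈ g.dom ∧ g.dev ⟨x, τ⟩ = q ∧
      ∀ y ∈ Ioc 0 τ, g.dev ⟨x, y⟩ ∉ γ.support := by
  have key : ∀ g ∈ γ.sides hF, g.hol.re ≠ 0 → ∀ x τ, 0 ≤ τ → (⟨x, τ⟩ : ℂ) ∈ g.dom →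
      g.dev ⟨x, τ⟩ = q → ∃ g ∈ γ.sides hF, ∃ x τ, 0 < τ ∧ (⟨x, τ⟩ : ℂ) ∈ g.dom ∧
      g.dev ⟨x, τ⟩ = q ∧ ∀ y ∈ Ioc 0 τ, g.dev ⟨x, y⟩ ∉ γ.support := by
    intro g hg hgw x τ hτ hd hdq
    have hcont : ContinuousOn (fun s : ℝ => g.dev ⟨x, s⟩) (Icc 0 τ) := fun s hs =>
      (continuousAt_devMap_mk hF hgw (mk_mem_devDomain_of_le hd hs.1 hs.2)).continuousWithinAt
    have hcl : IsClosed (Icc 0 τ ∩ (fun s : ℝ => g.dev ⟨x, s⟩) ⁻¹' γ.support) :=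
      hcont.preimage_isClosed_of_isClosed isClosed_Icc γ.isCompact_support.isClosed
    obtain ⟨τ₀, hτ₀, hmax⟩ := (isCompact_Icc.of_isClosed_subset hcl
      inter_subset_left).exists_isGreatest ⟨0, ⟨le_rfl, hτ⟩, by
        have hx : x ∈ Ioo (0 : ℝ) 1 := re_mem_of_mem_devDomain hd
        change g.dev ⟨x, 0⟩ ∈ γ.support
        rw [dev_ofReal hF hgw hx, ← support_of_mem_sides hg]
        exact g.path_mem_support hx⟩
    have hlt : τ₀ < τ := by
      refine lt_of_le_of_ne hτ₀.1.2 ?_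
      rintro rfl
      exact hqs (hdq ▸ hτ₀.2)
    obtain ⟨g', hg', x', h1, h2⟩ := exists_dev_eq (γ := γ) hF hw
      (a := fun v => g.dev ⟨x, τ₀ + v⟩) (τ := τ - τ₀) (by linarith)
      (fun v hv => (isDevAt_vert hF hgw (mk_mem_devDomain_of_le hd
        (by linarith [hv.1, hτ₀.1.1]) (by linarith [hv.2]))).comp_add_left)
      (by simpa using hτ₀.2)
    refine ⟨g', hg', x', τ - τ₀, by linarith, h1, ?_, ?_⟩
    · rw [h2 _ ⟨by linarith, le_rfl⟩, add_sub_cancel, hdq]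
    · intro y hy hys
      rw [h2 y ⟨hy.1.le, hy.2⟩] at hys
      have := hmax ⟨⟨by linarith [hy.1, hτ₀.1.1], by linarith [hy.2]⟩, hys⟩
      linarith [hy.1]
  obtain ⟨⟨x, y⟩, hz, rfl⟩ := hq
  rcases le_total 0 y with h0 | h0
  · exact key γ (Or.inl rfl) hw x y h0 hz rfl
  · exact key (γ.reverse hF) (Or.inr rfl) hw (1 - x) (-y) (by linarith) (reverse_mem_dom hz)
      (reverse_dev hw hz)

/-- The leaf between consecutive returns. -/
theorem IsReturn.isCrossing {hF : F.IsHalfTranslation} (hw : g.hol.re ≠ 0) (hg : g ∈ γ.sides hF)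
    {x R y : ℝ} (h : g.IsReturn x R) (hy : y ∈ Ioo 0 R) :
    F.IsCrossing γ.support (fun v => g.dev ⟨x, v⟩) R y (g.dev ⟨x, y⟩) where
  mem_Ioo := hy
  dev v hv := isDevAt_vert hF hw (mk_mem_devDomain_of_le h.mem_dom hv.1 hv.2)
  left := by
    rw [dev_ofReal hF hw h.mem_Ioo, ← support_of_mem_sides hg]
    exact g.path_mem_support h.mem_Ioo
  right := by
    rw [← support_of_mem_sides hg]
    exact h.mem
  notMem v hv := by
    rw [← support_of_mem_sides hg]
    exact h.notMem v hv
  eq := rfl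

theorem mem_swept_iff [CompactSpace X] (hF : F.IsHalfTranslation) (hw : γ.hol.re ≠ 0) {q : X}
    {R : ℝ} :
    q ∈ F.swept γ.support R ↔
      ∃ g ∈ γ.sides hF, ∃ x y, g.IsReturn x R ∧ y ∈ Ioo 0 R ∧ g.dev ⟨x, y⟩ = q := by
  constructor
  · rintro ⟨c, y, h⟩
    have hR : 0 < R := h.mem_Ioo.1.trans h.mem_Ioo.2
    obtain ⟨g, hg, x, h1, h2⟩ := exists_dev_eq hF hw hR.le h.dev h.left
    refine ⟨g, hg, x, y, ⟨hR, h1, ?_, ?_⟩, h.mem_Ioo, ?_⟩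
    · rw [h2 R ⟨hR.le, le_rfl⟩, support_of_mem_sides hg]
      exact h.right
    · intro v hv
      rw [h2 v (Ioo_subset_Icc_self hv), support_of_mem_sides hg]
      exact h.notMem v hv
    · rw [h2 y (Ioo_subset_Icc_self h.mem_Ioo), h.eq]
  · rintro ⟨g, hg, x, y, h1, h2, rfl⟩
    have hgw : g.hol.re ≠ 0 := hol_of_mem_sides hg ▸ hw
    exact ⟨_, y, h1.isCrossing hgw hg h2⟩

theorem isOpen_swept [CompactSpace X] (hF : F.IsHalfTranslation) (hw : γ.hol.re ≠ 0) (R : ℝ) :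
    IsOpen (F.swept γ.support R) := by
  rw [isOpen_iff_mem_nhds]
  intro q hq
  obtain ⟨g, hg, x, y, h1, h2, rfl⟩ := (mem_swept_iff hF hw).mp hq
  have hgw : g.hol.re ≠ 0 := hol_of_mem_sides hg ▸ hw
  have hz := mk_mem_devDomain_of_le h1.mem_dom h2.1.le h2.2.le
  refine (isDevAt_devMap hF hgw hz).nhds_le_map (shearMap_surjective hgw) ?_
  have e1 : ∀ᶠ z : ℂ in 𝓝 ⟨x, y⟩, g.IsReturn z.re R :=
    (Complex.continuous_re.tendsto (⟨x, y⟩ : ℂ)).eventually (h1.eventually hF hgw)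
  have e2 : ∀ᶠ z : ℂ in 𝓝 ⟨x, y⟩, z.im ∈ Ioo 0 R :=
    (Complex.continuous_im.tendsto (⟨x, y⟩ : ℂ)).eventually (isOpen_Ioo.mem_nhds h2)
  change ∀ᶠ z in 𝓝 (⟨x, y⟩ : ℂ), g.dev z ∈ F.swept γ.support R
  filter_upwards [e1, e2] with z h3 h4
  exact (mem_swept_iff hF hw).mpr ⟨g, hg, z.re, z.im, h3, h4, rfl⟩

end SaddleConnection

end FlatStructure

namespace FlatStructure

variable {X : Type*} [TopologicalSpace X]
variable {F : FlatStructure X} {w : ℂ} {p : X}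

/-! ### Every regular point lies on a leaf from the saddle connection -/

theorem IsCone.isPreconnected_punctured {ξ : OpenPartialHomeomorph X ℂ} {r : ℝ} {n : ℕ}
    (hc : F.IsCone p ξ r n) : IsPreconnected (ξ.source \ {p}) := by
  have h1 : IsPreconnected (Metric.ball (0 : ℂ) r \ {0}) := by
    have h2 : Metric.ball (0 : ℂ) r \ {0} = Complex.exp '' {z | z.re < Real.log r} := by
      ext z
      constructor
      · rintro ⟨h3, h4⟩
        refine ⟨Complex.log z, ?_, Complex.exp_log h4⟩
        rw [Set.mem_ofPred_eq, Complex.log_re]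
        exact Real.log_lt_log (norm_pos_iff.mpr h4) (by simpa using h3)
      · rintro ⟨u, hu, rfl⟩
        refine ⟨?_, Complex.exp_ne_zero u⟩
        rw [mem_ball_zero_iff, Complex.norm_exp, ← Real.lt_log_iff_exp_lt hc.pos]
        exact hu
    rw [h2]
    exact (convex_halfSpace_re_lt _).isPreconnected.image _ Complex.continuous_exp.continuousOn
  have h3 : ξ.source \ {p} = ξ.symm '' (Metric.ball (0 : ℂ) r \ {0}) := by
    rw [← hc.target]
    ext x
    constructor
    · rintro ⟨hx, hxp⟩
      refine ⟨ξ x, ⟨ξ.map_source hx, fun h => hxp ?_⟩, ξ.left_inv hx⟩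
      exact ξ.injOn hx hc.mem (h.trans hc.map_zero.symm)
    · rintro ⟨z, ⟨hz, hz0⟩, rfl⟩
      refine ⟨ξ.map_target hz, fun h => hz0 ?_⟩
      rw [mem_singleton_iff] at h ⊢
      rw [← ξ.right_inv hz, h, hc.map_zero]
  rw [h3]
  refine h1.image _ (ξ.continuousOn_symm.mono ?_)
  rw [hc.target]
  exact sdiff_subset

namespace SaddleConnection

variable {γ g : F.SaddleConnection} {A : ℝ≥0}

variable (γ) in
/-- The union of the leaves between consecutive returns. -/
def returning : Set X := ⋃ R, F.swept γ.support R

theorem returning_notMem_sing (hF : F.IsHalfTranslation) {q : X}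
    (hq : q ∈ γ.returning) : q ∉ F.sing := by
  obtain ⟨R, c, y, h⟩ := mem_iUnion.mp hq
  rw [← h.eq]
  exact (h.dev y (Ioo_subset_Icc_self h.mem_Ioo)).notMem_sing hF

variable [T2Space X]

theorem isOpen_returning [CompactSpace X] (hF : F.IsHalfTranslation) (hw : γ.hol.re ≠ 0) :
    IsOpen γ.returning :=
  isOpen_iUnion (isOpen_swept hF hw)

/-- Every point on a leaf from `γ` is a limit of points on leaves that return, as all leaves but
finitely many do. -/
theorem image_dev_subset_closure [CompactSpace X] (hF : F.IsAdmissible A) :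
    γ.dev '' γ.dom ⊆ closure γ.returning := by
  have hw := hF.re_ne_zero γ
  have hns : ∀ q ∈ γ.dev '' γ.dom, q ∉ γ.support → q ∈ closure γ.returning := by
    intro q hq hqs
    obtain ⟨g, hg, x, τ, hτ, hd, rfl, hno⟩ := exists_dev_eq_of_notMem hF.half hw hq hqs
    have hgw := hF.re_ne_zero g
    rw [← support_of_mem_sides hg] at hno hqs
    obtain ⟨B, hB⟩ := exists_bound_isReturn hF.half hgw hF.finite_sing hF.area_le
    have t : Tendsto (fun x' : ℝ => g.dev ⟨x', τ⟩) (𝓝[≠] x) (𝓝 (g.dev ⟨x, τ⟩)) :=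
      ((isDevAt_devMap hF.half hgw hd).continuousAt.tendsto.comp
        ((continuous_mk' τ).tendsto x)).mono_left nhdsWithin_le_nhds
    refine mem_closure_of_tendsto t ?_
    have e1 : ∀ᶠ x' in 𝓝[≠] x, x' ∉ g.blocked := by
      have h1 : IsClosed (g.blocked \ {x}) :=
        ((finite_blocked hF.half hgw hF.finite_sing).subset sdiff_subset).isClosed
      filter_upwards [nhdsWithin_le_nhds
        (h1.isOpen_compl.mem_nhds (show x ∈ (g.blocked \ {x})ᶜ by simp)), self_mem_nhdsWithin]
        with x' h2 h3 h4
      exact h2 ⟨h4, h3⟩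
    have e2 := (eventually_initial hF.half hgw hd
      (fun y hy => hno y ⟨hy.1, hy.2.le⟩)).filter_mono (nhdsWithin_le_nhds (s := {x}ᶜ))
    filter_upwards [e1, e2] with x' h1 h2
    obtain ⟨R, -, hR⟩ := hB x' (re_mem_of_mem_devDomain h2.1) h1
    refine mem_iUnion.mpr ⟨R, (mem_swept_iff hF.half hw).mpr ⟨g, hg, x', τ, hR, ⟨hτ, ?_⟩, rfl⟩⟩
    by_contra hcon
    rcases (not_lt.mp hcon).lt_or_eq with h3 | h3
    · exact h2.2.1 R ⟨hR.pos, h3⟩ hR.mem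
    · subst h3
      exact hqs (h2.2.2.mp hR.mem)
  intro q hq
  by_cases hqs : q ∈ γ.support
  · obtain ⟨z, hz, rfl⟩ := hq
    obtain ⟨x, hx, hxq⟩ := exists_of_mem_support hqs
      ((isDevAt_devMap hF.half hw hz).notMem_sing hF.half)
    rw [← hxq, ← dev_ofReal hF.half hw hx]
    have hd := ofReal_mem_dom (γ := γ) hx
    have tc := (continuous_mk x).tendsto 0
    have t : Tendsto (fun y : ℝ => γ.dev ⟨x, y⟩) (𝓝[≠] 0) (𝓝 (γ.dev ⟨x, 0⟩)) :=
      ((isDevAt_devMap hF.half hw hd).continuousAt.tendsto.comp tc).mono_left nhdsWithin_le_nhds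
    refine isClosed_closure.mem_of_tendsto t ?_
    filter_upwards [(tc.eventually (eventually_dev_mem_support hF.half hw hx)).filter_mono
      nhdsWithin_le_nhds, (tc.eventually (isOpen_devDomain.mem_nhds hd)).filter_mono
      nhdsWithin_le_nhds, self_mem_nhdsWithin] with y h1 h2 h3
    exact hns _ ⟨_, h2, rfl⟩ (fun h => h3 (h1.mp h))
  · exact hns q hq hqs

/-- The return times on the two sides of `γ` are bounded. -/
theorem exists_bound_swept [CompactSpace X] (hF : F.IsAdmissible A) :
    ∃ B : ℝ, 0 ≤ B ∧ ∀ R, (F.swept γ.support R).Nonempty → R ≤ B := by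
  have hw := hF.re_ne_zero γ
  obtain ⟨B, hB⟩ := exists_bound_isReturn hF.half hw hF.finite_sing hF.area_le
  obtain ⟨B', hB'⟩ := exists_bound_isReturn (γ := γ.reverse hF.half) hF.half hw hF.finite_sing
    hF.area_le
  refine ⟨max 0 (max B B'), le_max_left _ _, ?_⟩
  rintro R ⟨q, hq⟩
  obtain ⟨g, hg, x, y, h1, -, -⟩ := (mem_swept_iff hF.half hw).mp hq
  rcases hg with rfl | hg
  · obtain ⟨R', h2, h3⟩ := hB x h1.mem_Ioo (h1.notMem_blocked hF.half hw)
    exact (h1.le h3).trans (h2.trans ((le_max_left _ _).trans (le_max_right _ _)))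
  · rw [mem_singleton_iff] at hg
    subst hg
    obtain ⟨R', h2, h3⟩ := hB' x h1.mem_Ioo (h1.notMem_blocked hF.half (hF.re_ne_zero _))
    exact (h1.le h3).trans (h2.trans ((le_max_right _ _).trans (le_max_right _ _)))

/-- Through a regular point in the closure there is an infinite half-leaf; if it missed `γ` for a
time longer than all return times, then so would the half-leaves through nearby points. -/
theorem mem_image_dev_of_mem_closure [CompactSpace X] (hF : F.IsAdmissible A) {q : X}
    (hq : q ∈ closure γ.returning) (hqs : q ∉ F.sing) : q ∈ γ.dev '' γ.dom := by
  have hw := hF.re_ne_zero γ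
  obtain ⟨B, hB0, hB⟩ := exists_bound_swept (γ := γ) hF
  obtain ⟨β, u, hu, hβ, hβq, hinf⟩ := hF.exists_infinite_leaf hqs
  have hhalf : (1 / 2 : ℝ) ∈ Ioo (0 : ℝ) 1 := by norm_num
  have h0q : F.devMap β u ⟨1 / 2, 0⟩ = q :=
    (devMap_ofReal hF.half hu (ofReal_mem_devDomain hβ hhalf)).trans hβq
  by_cases hit : ∃ τ ∈ Icc 0 B, F.devMap β u ⟨1 / 2, τ⟩ ∈ γ.support
  · obtain ⟨τ, hτ, hm⟩ := hit
    have := mem_image_dev (γ := γ) hF.half hw (a := fun v => F.devMap β u ⟨1 / 2, τ - v⟩) hτ.1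
      (fun v hv => (isDevAt_vert hF.half hu (hinf _ (by linarith [hv.2]))).comp_sub_left hF.half)
      (by simpa using hm)
    simp only [sub_self] at this
    rwa [h0q] at this
  · exfalso
    push Not at hit
    set z₀ : ℂ := ⟨1 / 2, 0⟩ with hz₀
    have hcont : Continuous (fun s : ℂ × ℝ => s.1 + s.2 • Complex.I) := by fun_prop
    have e : ∀ v : ℝ, z₀ + v • Complex.I = ⟨1 / 2, v⟩ := fun v => by
      apply Complex.ext <;> simp [hz₀]
    have hloc : ∀ v ∈ Icc 0 B, ∀ᶠ s : ℂ × ℝ in 𝓝 (z₀, v),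
        s.1 + s.2 • Complex.I ∈ F.devDomain β u ∧
          F.devMap β u (s.1 + s.2 • Complex.I) ∉ γ.support := by
      intro v hv
      have hd : z₀ + v • Complex.I ∈ F.devDomain β u := by
        rw [e]
        exact hinf v hv.1
      have h1 := (isDevAt_devMap hF.half hu hd).continuousAt.eventually
        (γ.isCompact_support.isClosed.isOpen_compl.mem_nhds (by rw [e]; exact hit v hv))
      have h2 := (hcont.tendsto (z₀, v)).eventually (isOpen_devDomain.mem_nhds hd)
      exact h2.and ((hcont.tendsto (z₀, v)).eventually h1)
    have hev := isCompact_Icc.eventually_forall_of_forall_eventually (x₀ := z₀)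
      (P := fun z v => z + v • Complex.I ∈ F.devDomain β u ∧
        F.devMap β u (z + v • Complex.I) ∉ γ.support) hloc
    have hz₀d : z₀ ∈ F.devDomain β u := hinf 0 le_rfl
    have hfreq : ∃ᶠ z in 𝓝 z₀, F.devMap β u z ∈ γ.returning := by
      have h1 : ∃ᶠ q' in 𝓝 (F.devMap β u z₀), q' ∈ γ.returning := by
        rw [h0q]
        exact mem_closure_iff_frequently.mp hq
      exact h1.filter_mono ((isDevAt_devMap hF.half hu hz₀d).nhds_le_map (shearMap_surjective hu))
    obtain ⟨z, hz, hno⟩ := (hfreq.and_eventually hev).exists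
    obtain ⟨R, c, y, hcr⟩ := mem_iUnion.mp hz
    have hdev : ∀ v ∈ Icc 0 B,
        F.IsDevAt vert (fun v : ℝ => F.devMap β u (z + v • Complex.I)) v := by
      intro v hv
      have h1 := IsDevAt.comp_line (L := shearMap u) (f := F.devMap β u) (z := z) (v := Complex.I)
        (s := v) (isDevAt_devMap hF.half hu (hno v hv).1)
      have e2 : shearMap u Complex.I = Complex.I := by simp [shearMap_apply]
      rwa [e2] at h1
    -- The half-leaf through `z` runs along a leaf between returns, and meets `γ` by time `B`.
    obtain ⟨b, d, hdR, hb, hab⟩ := hcr.exists_firstHit hF.half (hdev 0 ⟨le_rfl, hB0⟩) (by simp)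
    have hdB : d ≤ B := hdR.trans (hB R ⟨_, c, y, hcr⟩)
    have := (IsDevAt.eventuallyEq_of_isPreconnected hF.half vert_injective isPreconnected_Icc
      (fun v hv => hdev v ⟨hv.1, hv.2.trans hdB⟩) hb.dev ⟨le_rfl, hb.pos.le⟩ hab d
      ⟨hb.pos.le, le_rfl⟩).eq_of_nhds
    exact (hno d ⟨hb.pos.le, hdB⟩).2 (this ▸ hb.mem)

/-- The leaves between consecutive returns are dense. Their closure is open: at a regular point it
contains the open set of points on leaves from `γ`, and a punctured disc around a singularity in
the closure cannot be split between that open set and the complement of the closure. -/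
theorem closure_returning [CompactSpace X] [ConnectedSpace X] (hF : F.IsAdmissible A) :
    closure γ.returning = univ := by
  have hw := hF.re_ne_zero γ
  have hY := isOpen_image_dev (γ := γ) hF.half hw
  refine IsClopen.eq_univ ⟨isClosed_closure, ?_⟩ ?_
  · rw [isOpen_iff_mem_nhds]
    intro q hq
    by_cases hqs : q ∈ F.sing
    · obtain ⟨ξ, r, n, hc⟩ := hF.half.exists_cone q hqs
      have hso := ξ.open_source.mem_nhds hc.mem
      have hD : ξ.source \ {q} ⊆ γ.dev '' γ.dom := by
        refine hc.isPreconnected_punctured.subset_left_of_subset_union hY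
          (isClosed_closure (s := γ.returning)).isOpen_compl ?_ ?_ ?_
        · exact disjoint_left.mpr fun x h1 h2 => h2 (image_dev_subset_closure hF h1)
        · intro x hx
          by_cases h : x ∈ closure γ.returning
          · exact Or.inl (mem_image_dev_of_mem_closure hF h (hc.notMem_sing hF.half hx.1 hx.2))
          · exact Or.inr h
        · obtain ⟨x, hx, hxr⟩ := mem_closure_iff_nhds.mp hq _ hso
          have hxs := returning_notMem_sing hF.half hxr
          exact ⟨x, ⟨hx, fun h => hxs (by rw [mem_singleton_iff.mp h]; exact hqs)⟩,
            mem_image_dev_of_mem_closure hF (subset_closure hxr) hxs⟩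
      filter_upwards [hso] with x hx
      by_cases hxq : x = q
      · exact hxq ▸ hq
      · exact image_dev_subset_closure hF (hD ⟨hx, hxq⟩)
    · exact Filter.mem_of_superset (hY.mem_nhds (mem_image_dev_of_mem_closure hF hq hqs))
        (image_dev_subset_closure hF)
  · exact ⟨_, image_dev_subset_closure hF
      ⟨⟨1 / 2, 0⟩, ofReal_mem_dom (by norm_num), rfl⟩⟩

/-! ### The complement of the critical graph -/

/-- A leaf between consecutive returns meets no critical segment of `Γ`: a point in common could be
followed along the leaf, in the direction of the singularity, and would reach `γ` before it. -/
theorem returning_subset_compl_graph [CompactSpace X] (hF : F.IsAdmissible A) :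
    γ.returning ⊆ γ.graphᶜ := by
  have hw := hF.re_ne_zero γ
  rintro q hq (hqs | ⟨σ, u, hσ, hu, hure, h0, hno, r, hr, rfl⟩)
  · obtain ⟨R, hR⟩ := mem_iUnion.mp hq
    exact swept_subset_compl hR hqs
  -- The region is open, so that `r` may be taken in the interior of the interval.
  obtain ⟨s, hs, hsq⟩ : ∃ s ∈ Ioo (0 : ℝ) 1, σ s ∈ γ.returning := by
    have h1 : σ ⁻¹' γ.returning ∈ 𝓝[Ioo 0 1] r :=
      ((hσ.continuousOn r hr).mono Ioo_subset_Icc_self)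
        ((isOpen_returning hF.half hw).mem_nhds hq)
    have h2 : (𝓝[Ioo (0 : ℝ) 1] r).NeBot := by
      rw [← mem_closure_iff_nhdsWithin_neBot, closure_Ioo zero_ne_one]
      exact hr
    obtain ⟨s, h3, h4⟩ := h2.nonempty_of_mem (inter_mem h1 self_mem_nhdsWithin)
    exact ⟨s, h4, h3⟩
  obtain ⟨R, c, y, hcr⟩ := mem_iUnion.mp hsq
  have huim : u.im ≠ 0 := fun h => hu (Complex.ext hure h)
  have hm : 0 < |u.im| := abs_pos.mpr huim
  -- The path along the critical segment towards the singularity, at unit speed.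
  set a : ℝ → X := fun v => σ (s - v / |u.im|) with ha
  have hadev : ∀ v, s - v / |u.im| ∈ Ioo (0 : ℝ) 1 → F.IsDevAt vert a v := by
    intro v hv
    have h1 := (isSegment_iff.mp hσ).2 _ hv
    have e1 : ∀ v : ℝ, s + (-(1 / |u.im|) • ContinuousLinearMap.id ℝ ℝ) v = s - v / |u.im| := by
      intro v
      simp
      ring
    have h2 := IsDevAt.comp_affine (-(1 / |u.im|) • ContinuousLinearMap.id ℝ ℝ) (z₀ := s) (u := v)
      (by rw [e1]; exact h1)
    simp only [e1] at h2
    have e2 : (ContinuousLinearMap.toSpanSingleton ℝ u).comp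
        (-(1 / |u.im|) • ContinuousLinearMap.id ℝ ℝ) = (-(u.im / |u.im|)) • vert := by
      ext
      apply Complex.ext
      · simp [hure]
      · simp only [one_div, neg_smul, ContinuousLinearMap.comp_apply, smul_apply,
          ContinuousLinearMap.id_apply, ContinuousLinearMap.toSpanSingleton_apply, smul_eq_mul,
          mul_one, Complex.neg_im, Complex.smul_im, Complex.I_im]
        ring
    rw [e2] at h2
    rcases lt_or_gt_of_ne huim with h3 | h3
    · rw [abs_of_neg h3, div_neg, div_self huim, neg_neg, one_smul] at h2
      rwa [ha, abs_of_neg h3]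
    · rw [abs_of_pos h3, div_self huim] at h2
      have h4 := h2.neg hF.half
      rw [show -((-1 : ℝ) • vert) = vert by ext; simp] at h4
      rwa [ha, abs_of_pos h3]
  have ha0 : a 0 = σ s := by simp [ha]
  have hmem : ∀ v, 0 ≤ v → v < s * |u.im| → s - v / |u.im| ∈ Ioo (0 : ℝ) 1 := by
    intro v h1 h2
    have h3 : v / |u.im| < s := (div_lt_iff₀ hm).mpr h2
    have h4 : 0 ≤ v / |u.im| := by positivity
    exact ⟨by linarith, by linarith [hs.2]⟩
  have hT : 0 < s * |u.im| := mul_pos hs.1 hm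
  obtain ⟨b, d, -, hb, hab⟩ := hcr.exists_firstHit hF.half (hadev 0 (hmem 0 le_rfl hT)) ha0
  rcases lt_or_ge d (s * |u.im|) with hd | hd
  · have := (IsDevAt.eventuallyEq_of_isPreconnected hF.half vert_injective isPreconnected_Icc
      (fun v hv => hadev v (hmem v hv.1 (hv.2.trans_lt hd))) hb.dev ⟨le_rfl, hb.pos.le⟩ hab d
      ⟨hb.pos.le, le_rfl⟩).eq_of_nhds
    exact hno _ (hmem d hb.pos.le hd) (by change a d ∈ γ.support; rw [this]; exact hb.mem)
  · have heq := IsDevAt.eventuallyEq_of_isPreconnected hF.half vert_injective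
      (isPreconnected_Ico (a := (0 : ℝ)) (b := s * |u.im|))
      (fun v hv => hadev v (hmem v hv.1 hv.2))
      (fun v hv => hb.dev v ⟨hv.1, hv.2.le.trans hd⟩) ⟨le_rfl, hT⟩ hab
    have hbT := hb.dev (s * |u.im|) ⟨hT.le, hd⟩
    have t1 : Tendsto b (𝓝[<] (s * |u.im|)) (𝓝 (b (s * |u.im|))) :=
      hbT.continuousAt.tendsto.mono_left nhdsWithin_le_nhds
    have t2 : Tendsto b (𝓝[<] (s * |u.im|)) (𝓝 (σ 0)) := by
      have h1 : Tendsto σ (𝓝[>] 0) (𝓝 (σ 0)) :=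
        ((hσ.continuousOn 0 ⟨le_rfl, zero_le_one⟩).mono_of_mem_nhdsWithin
          (Icc_mem_nhdsGT_of_mem ⟨le_rfl, zero_lt_one⟩))
      have h2 : Tendsto (fun v => s - v / |u.im|) (𝓝[<] (s * |u.im|)) (𝓝[>] 0) := by
        refine tendsto_nhdsWithin_iff.mpr ⟨?_, ?_⟩
        · have : Continuous (fun v => s - v / |u.im|) := by fun_prop
          have h3 := (this.tendsto (s * |u.im|)).mono_left (nhdsWithin_le_nhds
            (s := Iio (s * |u.im|)))
          rwa [mul_div_cancel_right₀ _ hm.ne', sub_self] at h3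
        · filter_upwards [self_mem_nhdsWithin] with v hv
          have h3 : v / |u.im| < s := (div_lt_iff₀ hm).mpr hv
          simpa using h3
      refine (h1.comp h2).congr' ?_
      filter_upwards [Ico_mem_nhdsLT hT] with v hv
      exact (heq v hv).eq_of_nhds
    exact hbT.notMem_sing hF.half (tendsto_nhds_unique t1 t2 ▸ h0)

/-- The complement of `Γ` is the union of the leaves between consecutive returns. -/
theorem compl_graph [CompactSpace X] [ConnectedSpace X] (hF : F.IsAdmissible A) :
    γ.graphᶜ = γ.returning := by
  have hw := hF.re_ne_zero γ
  refine Subset.antisymm ?_ (returning_subset_compl_graph hF)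
  intro q hq
  have hqs : q ∉ γ.support := fun h => hq (Or.inl h)
  have hsing : q ∉ F.sing := by
    intro h
    obtain ⟨σ, u, h1, h2, h3, h4, h5⟩ := exists_prong hF.half h
      (γ.isCompact_support.isClosed.isOpen_compl.mem_nhds hqs)
    exact hq (Or.inr ⟨σ, u, h1, h2, h3, h4 ▸ h, h5, 0, ⟨le_rfl, zero_le_one⟩, h4⟩)
  have hqY : q ∈ γ.dev '' γ.dom :=
    mem_image_dev_of_mem_closure hF (by rw [closure_returning hF]; trivial) hsing
  obtain ⟨g, hg, x, τ, hτ, hd, rfl, hno⟩ := exists_dev_eq_of_notMem hF.half hw hqY hqs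
  have hgw := hF.re_ne_zero g
  have hx : x ∈ Ioo (0 : ℝ) 1 := re_mem_of_mem_devDomain hd
  by_cases hb : x ∈ g.blocked
  · exfalso
    obtain ⟨-, k, p, ht, hk⟩ := hb
    have hτk := ht.lt_of_mem hF.half hgw hd
    obtain ⟨σ, u, h1, h2, h3, h4, h5⟩ := ht.exists_isSegment hF.half hgw
    refine hq (Or.inr ⟨σ, u, h1, h2, h3, h4 ▸ ht.sing, ?_, (k - τ) / k, ?_, ?_⟩)
    · intro s hs
      rw [h5 s hs, ← support_of_mem_sides hg]
      exact hk _ ⟨by nlinarith [hs.2, ht.pos], by nlinarith [hs.1, ht.pos]⟩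
    · exact ⟨div_nonneg (by linarith) ht.pos.le, (div_le_one ht.pos).mpr (by linarith)⟩
    · rw [h5 _ ⟨div_pos (by linarith) ht.pos, (div_lt_one ht.pos).mpr (by linarith)⟩,
        div_mul_cancel₀ _ ht.pos.ne', sub_sub_cancel]
  · obtain ⟨B, hB⟩ := exists_bound_isReturn hF.half hgw hF.finite_sing hF.area_le
    obtain ⟨R, -, hR⟩ := hB x hx hb
    refine mem_iUnion.mpr ⟨R, (mem_swept_iff hF.half hw).mpr ⟨g, hg, x, τ, hR, ⟨hτ, ?_⟩, rfl⟩⟩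
    by_contra hcon
    exact hno R ⟨hR.pos, not_lt.mp hcon⟩ (support_of_mem_sides hg ▸ hR.mem)

end SaddleConnection

end FlatStructure

namespace FlatStructure

/-- Finitely many reals, at most `m`, one of which exceeds the last of `m + 1` thresholds, miss one
of the `m` intervals between the thresholds. -/
theorem exists_forall_notMem_Ioc {Q : Set ℝ} (hQ : Q.Finite) {M : ℕ → ℝ} (hM : Monotone M) {m : ℕ}
    (hm : Q.ncard ≤ m) {R₀ : ℝ} (h₀ : R₀ ∈ Q) (hlt : M m < R₀) :
    ∃ k < m, ∀ R ∈ Q, R ∉ Ioc (M k) (M (k + 1)) := by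
  by_contra hcon
  push Not at hcon
  choose! f hfQ hf using hcon
  have hinj : InjOn (fun k => if k < m then f k else R₀) (Finset.range (m + 1) : Set ℕ) := by
    have key : ∀ i j : ℕ, i < j → j ≤ m →
        (if i < m then f i else R₀) ≠ if j < m then f j else R₀ := by
      intro i j hij hjm
      have hi := hf i (hij.trans_le hjm)
      have h1 : M (i + 1) ≤ M j := hM hij
      rw [if_pos (hij.trans_le hjm)]
      split_ifs with hj
      · exact (hi.2.trans_lt (h1.trans_lt (hf j hj).1)).ne
      · have : M j ≤ M m := hM hjm
        exact (hi.2.trans_lt ((h1.trans this).trans_lt hlt)).ne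
    intro i hi j hj hij
    rw [Finset.coe_range, mem_Iio, Nat.lt_succ_iff] at hi hj
    rcases lt_trichotomy i j with h | h | h
    · exact absurd hij (key i j h hj)
    · exact h
    · exact absurd hij.symm (key j i h hi)
  have h1 := ncard_le_ncard_of_injOn (t := Q) _ (fun k hk => by
    rw [Finset.coe_range, mem_Iio, Nat.lt_succ_iff] at hk
    split_ifs with h
    · exact hfQ k h
    · exact h₀) hinj hQ
  rw [ncard_coe_finset, Finset.card_range] at h1
  omega

variable {X : Type*} [TopologicalSpace X]
variable {F : FlatStructure X} {w : ℂ} {p : X}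

/-! ### Vertical strips -/

namespace SaddleConnection

variable {γ g : F.SaddleConnection} {A : ℝ≥0} {P : Set X}

theorem isPreconnected_of_mem_strips (hP : P ∈ γ.strips) : IsPreconnected P := by
  obtain ⟨x, -, rfl⟩ := hP
  exact isPreconnected_connectedComponentIn

theorem subset_of_mem_strips (hP : P ∈ γ.strips) : P ⊆ γ.graphᶜ := by
  obtain ⟨x, -, rfl⟩ := hP
  exact connectedComponentIn_subset _ _

theorem nonempty_of_mem_strips (hP : P ∈ γ.strips) : P.Nonempty := by
  obtain ⟨x, hx, rfl⟩ := hP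
  exact ⟨x, mem_connectedComponentIn hx⟩

theorem eq_of_mem_strips (hP : P ∈ γ.strips) {q : X} (hq : q ∈ P) :
    P = connectedComponentIn γ.graphᶜ q := by
  obtain ⟨x, -, rfl⟩ := hP
  exact connectedComponentIn_eq hq

variable [T2Space X]

/-- All leaves in a strip have the same return time. -/
theorem strip_subset_swept [CompactSpace X] [ConnectedSpace X] (hF : F.IsAdmissible A)
    (hP : P ∈ γ.strips) {q : X} (hq : q ∈ P) {R : ℝ}
    (hR : q ∈ F.swept γ.support R) : P ⊆ F.swept γ.support R := by
  have hw := hF.re_ne_zero γ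
  refine (isPreconnected_of_mem_strips hP).subset_left_of_subset_union
    (isOpen_swept hF.half hw R)
    (isOpen_iUnion fun R' : {R' : ℝ // R' ≠ R} => isOpen_swept hF.half hw R'.1) ?_ ?_ ⟨q, hq, hR⟩
  · refine disjoint_left.mpr fun x h1 h2 => ?_
    obtain ⟨⟨R', hne⟩, h3⟩ := mem_iUnion.mp h2
    exact hne (swept_length_eq hF.half h3 h1)
  · intro x hx
    have h1 := subset_of_mem_strips hP hx
    rw [compl_graph hF] at h1
    obtain ⟨R', h2⟩ := mem_iUnion.mp h1
    by_cases h : R' = R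
    · exact Or.inl (h ▸ h2)
    · exact Or.inr (mem_iUnion.mpr ⟨⟨R', h⟩, h2⟩)

theorem exists_isReturn_of_mem_strips [CompactSpace X] [ConnectedSpace X] (hF : F.IsAdmissible A)
    (hP : P ∈ γ.strips) :
    ∃ g ∈ γ.sides hF.half, ∃ x y R, g.IsReturn x R ∧ y ∈ Ioo 0 R ∧ g.dev ⟨x, y⟩ ∈ P := by
  obtain ⟨q, hq⟩ := nonempty_of_mem_strips hP
  have h1 := subset_of_mem_strips hP hq
  rw [compl_graph hF] at h1
  obtain ⟨R, h2⟩ := mem_iUnion.mp h1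
  obtain ⟨g, hg, x, y, h3, h4, rfl⟩ := (mem_swept_iff hF.half (hF.re_ne_zero γ)).mp h2
  exact ⟨g, hg, x, y, R, h3, h4, hq⟩

/-- The leaves going up from an interval without blocked positions lie in one strip. -/
theorem dev_mem_strip [CompactSpace X] [ConnectedSpace X] (hF : F.IsAdmissible A)
    (hP : P ∈ γ.strips) (hg : g ∈ γ.sides hF.half)
    {a b : ℝ} (hab : Ioo a b ⊆ Ioo 0 1) (hb : ∀ c ∈ Ioo a b, c ∉ g.blocked) {x y R : ℝ}
    (hx : x ∈ Ioo a b) (hret : g.IsReturn x R) (hy : y ∈ Ioo 0 R) (hmem : g.dev ⟨x, y⟩ ∈ P) :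
    ∀ x' ∈ Ioo a b, ∀ y' ∈ Ioo 0 R, g.dev ⟨x', y'⟩ ∈ P := by
  have hgw := hF.re_ne_zero g
  have hall := hret.eq_on hF.half hgw isPreconnected_Ioo hab hb hx
  have hconv : Convex ℝ (Ioo a b ×ℂ Ioo 0 R) :=
    ((convex_Ioo a b).linear_preimage Complex.reLm).inter
      ((convex_Ioo 0 R).linear_preimage Complex.imLm)
  have hcont : ContinuousOn g.dev (Ioo a b ×ℂ Ioo 0 R) := fun z hz =>
    (isDevAt_devMap hF.half hgw (mk_mem_devDomain_of_le (hall z.re hz.1).mem_dom hz.2.1.le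
      hz.2.2.le)).continuousAt.continuousWithinAt
  have hsub : g.dev '' (Ioo a b ×ℂ Ioo 0 R) ⊆ γ.graphᶜ := by
    rintro _ ⟨z, hz, rfl⟩
    rw [compl_graph hF]
    exact mem_iUnion.mpr ⟨R, (mem_swept_iff hF.half (hF.re_ne_zero γ)).mpr
      ⟨g, hg, z.re, z.im, hall z.re hz.1, hz.2, rfl⟩⟩
  have h1 := (hconv.isPreconnected.image _ hcont).subset_connectedComponentIn
    (x := g.dev ⟨x, y⟩) ⟨⟨x, y⟩, ⟨hx, hy⟩, rfl⟩ hsub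
  rw [← eq_of_mem_strips hP hmem] at h1
  exact fun x' hx' y' hy' => h1 ⟨⟨x', y'⟩, ⟨hx', hy'⟩, rfl⟩

/-- A strip is determined by a side of `γ` together with the interval of positions between two
consecutive blocked ones from which its leaves start. -/
theorem finite_strips [CompactSpace X] [ConnectedSpace X]
    (hF : F.IsAdmissible A) : γ.strips.Finite := by
  let T : F.SaddleConnection × ℝ × ℝ → Set (Set X) := fun i =>
    {P | P ∈ γ.strips ∧ i.1 ∈ γ.sides hF.half ∧ Ioo i.2.1 i.2.2 ⊆ Ioo 0 1 ∧
      (∀ c ∈ Ioo i.2.1 i.2.2, c ∉ i.1.blocked) ∧ ∃ x ∈ Ioo i.2.1 i.2.2, ∃ y R,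
        i.1.IsReturn x R ∧ y ∈ Ioo 0 R ∧ i.1.dev ⟨x, y⟩ ∈ P}
  have hT : ∀ i, (T i).Subsingleton := by
    rintro i P ⟨hP, hg, hab, hb, x, hx, y, R, hret, hy, hm⟩
      P' ⟨hP', -, -, -, x', hx', y', R', hret', hy', hm'⟩
    have hR := (hret.eq_on hF.half (hF.re_ne_zero i.1) isPreconnected_Ioo hab hb hx x' hx').eq hret'
    subst hR
    have h1 := dev_mem_strip hF hP hg hab hb hx hret hy hm x' hx' y' hy'
    rw [eq_of_mem_strips hP h1, eq_of_mem_strips hP' hm']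
  have hfin : (⋃ g ∈ γ.sides hF.half, ⋃ a ∈ insert 0 (insert 1 g.blocked),
      ⋃ b ∈ insert 0 (insert 1 g.blocked), T (g, a, b)).Finite := by
    refine ((finite_singleton _).insert _).biUnion fun g _ => ?_
    have hE := finite_ends hF.half (hF.re_ne_zero g) hF.finite_sing
    exact hE.biUnion fun a _ => hE.biUnion fun b _ => (hT _).finite
  refine hfin.subset fun P hP => ?_
  obtain ⟨g, hg, x, y, R, h1, h2, h3⟩ := exists_isReturn_of_mem_strips hF hP
  obtain ⟨a, ha, b, hb, hax, hxb, hab, hno⟩ := exists_interval hF.half (hF.re_ne_zero g)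
    hF.finite_sing h1.mem_Ioo (h1.notMem_blocked hF.half (hF.re_ne_zero g))
  simp only [mem_iUnion]
  exact ⟨g, hg, a, ha, b, hb, hP, hg, hab, hno, x, ⟨hax, hxb⟩, y, R, h1, h2, h3⟩

theorem nonempty_swept_of_isReturn [CompactSpace X] (hF : F.IsAdmissible A)
    (hg : g ∈ γ.sides hF.half) {x R : ℝ}
    (h : g.IsReturn x R) : (F.swept γ.support R).Nonempty :=
  ⟨_, (mem_swept_iff hF.half (hF.re_ne_zero γ)).mpr
    ⟨g, hg, x, R / 2, h, ⟨half_pos h.pos, half_lt_self h.pos⟩, rfl⟩⟩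

/-- There are at most as many return times as strips. -/
theorem ncard_returnTimes_le [CompactSpace X] [ConnectedSpace X] (hF : F.IsAdmissible A) :
    {R | (F.swept γ.support R).Nonempty}.Finite ∧
      {R | (F.swept γ.support R).Nonempty}.ncard ≤ γ.strips.ncard := by
  have h : ∀ R ∈ {R | (F.swept γ.support R).Nonempty}, ∃ P ∈ γ.strips,
      (P ∩ F.swept γ.support R).Nonempty := by
    rintro R ⟨q, hq⟩
    have hqc : q ∈ γ.graphᶜ := by
      rw [compl_graph hF]
      exact mem_iUnion.mpr ⟨R, hq⟩
    exact ⟨_, ⟨q, hqc, rfl⟩, q, mem_connectedComponentIn hqc, hq⟩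
  choose! f hf hfR using h
  have hinj : InjOn f {R | (F.swept γ.support R).Nonempty} := by
    intro R hR R' hR' heq
    obtain ⟨q, h1, h2⟩ := hfR R hR
    obtain ⟨q', h3, h4⟩ := hfR R' hR'
    exact swept_length_eq hF.half (strip_subset_swept hF (hf R hR) h1 h2 (heq ▸ h3)) h4
  exact ⟨(finite_strips hF).of_injOn hf hinj, ncard_le_ncard_of_injOn f hf hinj (finite_strips hF)⟩

/-- The horizontal segments inside a strip over an interval without blocked positions fill the
interval. -/
theorem mul_le_of_forall_segment (hF : F.IsAdmissible A) {w₀ : ℝ}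
    (hwid : ∀ σ u, F.IsSegment σ u → σ '' Icc 0 1 ⊆ P → |u.re| ≤ w₀) {a b R : ℝ} (hR : 0 < R)
    (hdom : ∀ x ∈ Ioo a b, ∀ y ∈ Ioo 0 R, (⟨x, y⟩ : ℂ) ∈ g.dom)
    (hmem : ∀ x ∈ Ioo a b, ∀ y ∈ Ioo 0 R, g.dev ⟨x, y⟩ ∈ P) (hab : a < b) :
    (b - a) * |g.hol.re| ≤ w₀ := by
  have hgw := hF.re_ne_zero g
  have key : ∀ η ∈ Ioo 0 ((b - a) / 2), (b - a - 2 * η) * |g.hol.re| ≤ w₀ := by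
    intro η hη
    have e : ∀ s : ℝ, (⟨a + η, R / 2⟩ : ℂ) + s • (⟨b - a - 2 * η, 0⟩ : ℂ) =
        ⟨a + η + s * (b - a - 2 * η), R / 2⟩ := fun s => by
      apply Complex.ext <;> simp
    have hx : ∀ s ∈ Icc (0 : ℝ) 1, a + η + s * (b - a - 2 * η) ∈ Ioo a b := by
      intro s hs
      have h1 : 0 < b - a - 2 * η := by linarith [hη.2]
      exact ⟨by nlinarith [hs.1, hη.1], by nlinarith [hs.2, hη.1]⟩
    have hy : R / 2 ∈ Ioo 0 R := ⟨half_pos hR, half_lt_self hR⟩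
    have hdev : ∀ s ∈ Icc (0 : ℝ) 1,
        F.IsDevAt (ContinuousLinearMap.toSpanSingleton ℝ (shearMap g.hol ⟨b - a - 2 * η, 0⟩))
        (fun s : ℝ => g.dev ((⟨a + η, R / 2⟩ : ℂ) + s • (⟨b - a - 2 * η, 0⟩ : ℂ))) s := by
      intro s hs
      apply IsDevAt.comp_line
      apply isDevAt_devMap hF.half hgw
      rw [e]
      exact hdom _ (hx s hs) _ hy
    have h2 := hwid _ _ (isSegment_iff.mpr
      ⟨fun s hs => (hdev s hs).continuousAt.continuousWithinAt,
        fun s hs => hdev s (Ioo_subset_Icc_self hs)⟩) (by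
      rintro _ ⟨s, hs, rfl⟩
      beta_reduce
      rw [e]
      exact hmem _ (hx s hs) _ hy)
    rwa [shearMap_re, abs_mul, abs_of_pos (show 0 < b - a - 2 * η by linarith [hη.2])] at h2
  have t : Tendsto (fun η : ℝ => (b - a - 2 * η) * |g.hol.re|) (𝓝[>] 0)
      (𝓝 ((b - a) * |g.hol.re|)) := by
    have : Continuous (fun η : ℝ => (b - a - 2 * η) * |g.hol.re|) := by fun_prop
    simpa using (this.tendsto 0).mono_left (nhdsWithin_le_nhds (s := Ioi 0))
  refine le_of_tendsto t ?_
  filter_upwards [Ioo_mem_nhdsGT (show (0 : ℝ) < (b - a) / 2 by linarith)] with η hη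
  exact key η hη

/-- A chord between two ends at height at most `M`. -/
theorem exists_chord_le (hF : F.IsAdmissible A) {a b M : ℝ} (hab : a < b) (hsub : Ioo a b ⊆ Ioo 0 1)
    (ha : ∃ h, g.IsEnd a h ∧ 0 ≤ h ∧ h ≤ M) (hb : ∃ h, g.IsEnd b h ∧ 0 ≤ h ∧ h ≤ M)
    (hdom : ∀ x ∈ Ioo a b, ∀ y ∈ Icc 0 M, (⟨x, y⟩ : ℂ) ∈ g.dom) :
    ∃ γ' : F.SaddleConnection, |γ'.hol.re| = (b - a) * |g.hol.re| ∧
      |γ'.hol.im| ≤ M + |g.hol.im| := by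
  obtain ⟨h, ha, h1, h2⟩ := ha
  obtain ⟨k, hb, h3, h4⟩ := hb
  obtain ⟨γ', hγ'⟩ := exists_chord hF.half (hF.re_ne_zero g) ha hb hab h2 h4 hdom
  refine ⟨γ', ?_, ?_⟩
  · rw [hγ', shearMap_re, abs_mul, abs_of_pos (sub_pos.mpr hab)]
  · rw [hγ', shearMap_im]
    have h5 : b - a ≤ 1 := by
      have := (Ioo_subset_Ioo_iff hab).mp hsub
      linarith
    have h6 : |(b - a) * g.hol.im| ≤ |g.hol.im| := by
      rw [abs_mul, abs_of_pos (sub_pos.mpr hab)]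
      exact mul_le_of_le_one_left (abs_nonneg _) h5
    have h7 : |k - h| ≤ M := abs_le.mpr ⟨by linarith, by linarith⟩
    exact (abs_add_le _ _).trans (by linarith)

/-- The dichotomy behind the estimate. If the return time of the strip `P` is at most the last
threshold, a diagonal of `P` is a saddle connection. Otherwise, some interval `(M k, M (k + 1)]`
contains no return time; the leaves going up from the maximal interval around `P` without
singularities below height `M k` all avoid `γ` up to height `M (k + 1)`, so that this interval is
short, and its ends span a saddle connection of vertical extent of the order of `M k`. -/
theorem exists_short_saddleConnection [CompactSpace X] [ConnectedSpace X] (hF : F.IsAdmissible A)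
    (hP : P ∈ γ.strips) {M : ℕ → ℝ} (hM : Monotone M) (hM0 : 0 < M 0) {w₀ : ℝ}
    (hwid : ∀ σ u, F.IsSegment σ u → σ '' Icc 0 1 ⊆ P → |u.re| ≤ w₀) :
    ∃ γ' : F.SaddleConnection,
      (|γ'.hol.re| ≤ w₀ ∧ |γ'.hol.im| ≤ M γ.strips.ncard + |γ.hol.im|) ∨
      ∃ k < γ.strips.ncard, |γ'.hol.re| ≤ 2 * A / M (k + 1) ∧
        |γ'.hol.im| ≤ M k + |γ.hol.im| := by
  obtain ⟨g, hg, x₀, y₀, R₀, hret, hy₀, hm⟩ := exists_isReturn_of_mem_strips hF hP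
  have hgw := hF.re_ne_zero g
  have hx₀ := hret.mem_Ioo
  have hx₀b := hret.notMem_blocked hF.half hgw
  rw [← hol_of_mem_sides hg]
  by_cases hR : R₀ ≤ M γ.strips.ncard
  · obtain ⟨a, ha, b, hb, hax, hxb, hab, hno⟩ := exists_interval hF.half hgw hF.finite_sing hx₀ hx₀b
    have hall := hret.eq_on hF.half hgw isPreconnected_Ioo hab hno ⟨hax, hxb⟩
    have hdom : ∀ x ∈ Ioo a b, ∀ y ∈ Icc 0 R₀, (⟨x, y⟩ : ℂ) ∈ g.dom := fun x hx y hy =>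
      mk_mem_devDomain_of_le (hall x hx).mem_dom hy.1 hy.2
    have hlt : a < b := hax.trans hxb
    have hend : ∀ c ∈ insert 0 (insert 1 g.blocked), (∃ᶠ x in 𝓝 c, x ∈ Ioo a b) →
        ∃ h, g.IsEnd c h ∧ 0 ≤ h ∧ h ≤ R₀ := by
      rintro c (rfl | rfl | hc) hfreq
      · exact ⟨0, .left, le_rfl, hret.pos.le⟩
      · exact ⟨0, .right, le_rfl, hret.pos.le⟩
      · obtain ⟨hc01, h, p, ht, hh⟩ := id hc
        exact ⟨h, .top hc01 ht, ht.pos.le, top_le_of_frequently hF.half hgw hc ht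
          (hfreq.mono fun x hx => ⟨R₀, le_rfl, hall x hx⟩)⟩
    have hfa : ∃ᶠ x in 𝓝 a, x ∈ Ioo a b :=
      mem_closure_iff_frequently.mp (by rw [closure_Ioo hlt.ne]; exact ⟨le_rfl, hlt.le⟩)
    have hfb : ∃ᶠ x in 𝓝 b, x ∈ Ioo a b :=
      mem_closure_iff_frequently.mp (by rw [closure_Ioo hlt.ne]; exact ⟨hlt.le, le_rfl⟩)
    obtain ⟨γ', h1, h2⟩ := exists_chord_le hF hlt hab (hend a ha hfa) (hend b hb hfb) hdom
    refine ⟨γ', Or.inl ⟨?_, by linarith⟩⟩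
    rw [h1]
    exact mul_le_of_forall_segment hF hwid hret.pos
      (fun x hx y hy => hdom x hx y (Ioo_subset_Icc_self hy))
      (dev_mem_strip hF hP hg hab hno ⟨hax, hxb⟩ hret hy₀ hm) hlt
  · push Not at hR
    obtain ⟨hfin, hcard⟩ := ncard_returnTimes_le (γ := γ) hF
    obtain ⟨k, hk, hgap⟩ := exists_forall_notMem_Ioc hfin hM hcard
      (nonempty_swept_of_isReturn hF hg hret) hR
    have hMk : 0 < M k := hM0.trans_le (hM (Nat.zero_le k))
    have hMk1 : 0 < M (k + 1) := hM0.trans_le (hM (Nat.zero_le _))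
    have hMkR : M k < R₀ := (hM hk.le).trans_lt hR
    -- The endpoints of `γ` and the positions whose leaf is blocked at height at most `M k`.
    set C : Set ℝ := insert 0 (insert 1 {x | x ∈ g.blocked ∧
      ∃ h p, F.IsTop g.path g.hol x h p ∧ h ≤ M k}) with hC
    have hCf : C.Finite := (((finite_blocked hF.half hgw hF.finite_sing).subset
      (fun x hx => hx.1)).insert 1).insert 0
    have hx₀C : x₀ ∉ C := by
      rintro (h | h | h)
      · exact hx₀.1.ne' h
      · exact hx₀.2.ne h
      · exact hx₀b h.1
    obtain ⟨a, ha, b, hb, hax, hxb, hno⟩ := exists_neighbours hCf (Or.inl rfl)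
      (Or.inr (Or.inl rfl)) hx₀.1 hx₀.2 hx₀C
    have hlt : a < b := hax.trans hxb
    have hC01 : ∀ c ∈ C, 0 ≤ c ∧ c ≤ 1 := by
      rintro c (rfl | rfl | hc)
      · exact ⟨le_rfl, zero_le_one⟩
      · exact ⟨zero_le_one, le_rfl⟩
      · exact ⟨hc.1.1.1.le, hc.1.1.2.le⟩
    have hab : Ioo a b ⊆ Ioo 0 1 := Ioo_subset_Ioo (hC01 a ha).1 (hC01 b hb).2
    have htop : ∀ x ∈ Ioo a b, x ∈ g.blocked → ∀ h p, F.IsTop g.path g.hol x h p → M k < h := by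
      intro x hx hxb h p ht
      by_contra hcon
      exact hno x hx (Or.inr (Or.inr ⟨hxb, h, p, ht, not_lt.mp hcon⟩))
    -- No leaf over `(a, b)` returns by height `M (k + 1)`: it would return by height `M k`, and
    -- then so would the leaf from `x₀`, whose return time is `R₀`.
    have hlong : ∀ x ∈ Ioo a b, ∀ R, g.IsReturn x R → M (k + 1) < R := by
      intro x hx R hxR
      by_contra hcon
      have h1 := hgap R (nonempty_swept_of_isReturn hF hg hxR)
      have h2 : R ≤ M k := by
        by_contra h3
        exact h1 ⟨not_le.mp h3, not_lt.mp hcon⟩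
      obtain ⟨R', h3, h4⟩ := forall_exists_isReturn hF.half hgw isPreconnected_Ioo hab htop hx h2
        hxR x₀ ⟨hax, hxb⟩
      exact (hMkR.trans_le (hret.le h4)).not_ge h3
    obtain ⟨B, hB⟩ := exists_bound_isReturn hF.half hgw hF.finite_sing hF.area_le
    have harea := mul_le_area hF.half hgw hF.area_le hlt hMk1 hab
      (finite_blocked hF.half hgw hF.finite_sing) (fun x hx hxb => by
      obtain ⟨R, -, hxR⟩ := hB x (hab hx) hxb
      have h1 := hlong x hx R hxR
      exact ⟨mk_mem_devDomain_of_le hxR.mem_dom hMk1.le h1.le,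
        fun y hy => hxR.notMem y ⟨hy.1, hy.2.trans h1⟩⟩)
    have hdom : ∀ x ∈ Ioo a b, ∀ y ∈ Icc 0 (M k), (⟨x, y⟩ : ℂ) ∈ g.dom := by
      intro x hx y hy
      rcases exists_isReturn_or hF.half hgw hMk (hab hx) (htop x hx) with ⟨R, h1, h2⟩ | h
      · exact absurd ((hM (Nat.le_succ k)).trans_lt (hlong x hx R h2)) (not_lt.mpr h1)
      · exact mk_mem_devDomain_of_le h.1 hy.1 hy.2
    have hend : ∀ c ∈ C, ∃ h, g.IsEnd c h ∧ 0 ≤ h ∧ h ≤ M k := by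
      rintro c (rfl | rfl | ⟨hc, h, p, ht, hh⟩)
      · exact ⟨0, .left, le_rfl, hMk.le⟩
      · exact ⟨0, .right, le_rfl, hMk.le⟩
      · exact ⟨h, .top hc.1 ht, ht.pos.le, hh⟩
    obtain ⟨γ', h1, h2⟩ := exists_chord_le hF hlt hab (hend a ha) (hend b hb) hdom
    refine ⟨γ', Or.inr ⟨k, hk, ?_, h2⟩⟩
    rw [h1, le_div_iff₀ hMk1]
    exact harea

end SaddleConnection

end FlatStructure

/-! ### Local normal form of a quadratic differential -/

/-- Nonvanishing holomorphic functions have local holomorphic roots. -/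
theorem AnalyticAt.exists_pow_eq {g : ℂ → ℂ} {z₀ : ℂ} (hg : AnalyticAt ℂ g z₀) (h0 : g z₀ ≠ 0)
    {n : ℕ} (hn : 0 < n) :
    ∃ R : ℂ → ℂ, AnalyticAt ℂ R z₀ ∧ R z₀ ≠ 0 ∧ ∀ᶠ z in 𝓝 z₀, R z ^ n = g z := by
  obtain ⟨c, hc⟩ := IsAlgClosed.exists_pow_nat_eq (g z₀) hn
  have hc0 : c ≠ 0 := by
    rintro rfl
    rw [zero_pow hn.ne'] at hc
    exact h0 hc.symm
  refine ⟨fun z => c * Complex.exp (Complex.log (g z / g z₀) / n), ?_,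
    mul_ne_zero hc0 (Complex.exp_ne_zero _), ?_⟩
  · have h1 : AnalyticAt ℂ (fun z => g z / g z₀) z₀ := hg.div analyticAt_const h0
    have h2 : AnalyticAt ℂ (fun z => Complex.log (g z / g z₀)) z₀ :=
      h1.clog (by simp [div_self h0])
    exact analyticAt_const.mul (h2.div analyticAt_const (by exact_mod_cast hn.ne')).cexp
  · filter_upwards [hg.continuousAt.eventually_ne h0] with z hz
    rw [mul_pow, ← Complex.exp_nat_mul, mul_div_cancel₀ _ (by exact_mod_cast hn.ne'),
      Complex.exp_log (div_ne_zero hz h0), hc, mul_div_cancel₀ _ h0]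

/-- The differential equation `n v + 2 (z - z₀) v' = 2 h` has a holomorphic solution, namely
`v z = ∫ θ in 0..1, 2 θ ^ (n - 1) h (z₀ + θ² (z - z₀))`. -/
theorem AnalyticAt.exists_add_mul_deriv_eq {h : ℂ → ℂ} {z₀ : ℂ} (hh : AnalyticAt ℂ h z₀) (n : ℕ) :
    ∃ v : ℂ → ℂ, AnalyticAt ℂ v z₀ ∧
      ∀ᶠ z in 𝓝 z₀, (n + 1) * v z + 2 * (z - z₀) * deriv v z = 2 * h z := by
  obtain ⟨r, hr, hd⟩ : ∃ r > 0, DifferentiableOn ℂ h (Metric.ball z₀ r) := by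
    obtain ⟨r, hr, hball⟩ := Metric.eventually_nhds_iff_ball.mp hh.eventually_analyticAt
    exact ⟨r, hr, fun z hz => (hball z hz).differentiableAt.differentiableWithinAt⟩
  have hd' : ContinuousOn (deriv h) (Metric.ball z₀ r) :=
    (hd.deriv Metric.isOpen_ball).continuousOn
  have hpath : ∀ {ρ : ℝ} {z : ℂ} {θ : ℝ}, z ∈ Metric.ball z₀ ρ → θ ∈ Icc (0 : ℝ) 1 →
      z₀ + (θ : ℂ) ^ 2 * (z - z₀) ∈ Metric.ball z₀ ρ := by
    intro ρ z θ hz hθ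
    rw [mem_ball_iff_norm] at hz ⊢
    rw [add_sub_cancel_left, norm_mul, norm_pow, Complex.norm_real, Real.norm_of_nonneg hθ.1]
    exact (mul_le_of_le_one_left (norm_nonneg _) (pow_le_one₀ hθ.1 hθ.2)).trans_lt hz
  have hpc : ∀ z : ℂ, Continuous (fun θ : ℝ => z₀ + (θ : ℂ) ^ 2 * (z - z₀)) := fun z => by fun_prop
  have hI : uIcc (0 : ℝ) 1 = Icc 0 1 := uIcc_of_le zero_le_one
  have hc1 : ∀ z ∈ Metric.ball z₀ r, ContinuousOn
      (fun θ : ℝ => 2 * (θ : ℂ) ^ n * h (z₀ + (θ : ℂ) ^ 2 * (z - z₀))) (Icc 0 1) := fun z hz =>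
    (by fun_prop : Continuous fun θ : ℝ => 2 * (θ : ℂ) ^ n).continuousOn.mul
      (hd.continuousOn.comp (hpc z).continuousOn fun θ hθ => hpath hz hθ)
  have hc2 : ∀ z ∈ Metric.ball z₀ r, ContinuousOn
      (fun θ : ℝ => 2 * (θ : ℂ) ^ n * (deriv h (z₀ + (θ : ℂ) ^ 2 * (z - z₀)) * (θ : ℂ) ^ 2))
      (Icc 0 1) := fun z hz =>
    (by fun_prop : Continuous fun θ : ℝ => 2 * (θ : ℂ) ^ n).continuousOn.mul
      ((hd'.comp (hpc z).continuousOn fun θ hθ => hpath hz hθ).mul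
      (by fun_prop : Continuous fun θ : ℝ => (θ : ℂ) ^ 2).continuousOn)
  have hderiv : ∀ z ∈ Metric.ball z₀ r, HasDerivAt
      (fun z => ∫ θ in (0 : ℝ)..1, 2 * (θ : ℂ) ^ n * h (z₀ + (θ : ℂ) ^ 2 * (z - z₀)))
      (∫ θ in (0 : ℝ)..1,
        2 * (θ : ℂ) ^ n * (deriv h (z₀ + (θ : ℂ) ^ 2 * (z - z₀)) * (θ : ℂ) ^ 2)) z := by
    intro z hz
    obtain ⟨ρ, h1, h2⟩ := exists_between (mem_ball_iff_norm.mp hz)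
    have hsub : Metric.closedBall z₀ ρ ⊆ Metric.ball z₀ r := Metric.closedBall_subset_ball h2
    have hsub' : Metric.ball z₀ ρ ⊆ Metric.ball z₀ r := Metric.ball_subset_ball h2.le
    have hzρ : z ∈ Metric.ball z₀ ρ := mem_ball_iff_norm.mpr h1
    obtain ⟨C, hC⟩ := (isCompact_closedBall z₀ ρ).exists_bound_of_continuousOn (hd'.mono hsub)
    refine (intervalIntegral.hasDerivAt_integral_of_dominated_loc_of_deriv_le (𝕜 := ℂ)
      (s := Metric.ball z₀ ρ) (bound := fun _ => 2 * C)
      (F := fun z θ => 2 * (θ : ℂ) ^ n * h (z₀ + (θ : ℂ) ^ 2 * (z - z₀)))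
      (F' := fun z θ => 2 * (θ : ℂ) ^ n * (deriv h (z₀ + (θ : ℂ) ^ 2 * (z - z₀)) * (θ : ℂ) ^ 2))
      (Metric.isOpen_ball.mem_nhds hzρ) ?_ ?_ ?_ ?_ ?_ ?_).2
    · filter_upwards [Metric.isOpen_ball.mem_nhds hz] with z' hz'
      rw [uIoc_of_le zero_le_one]
      exact ((hc1 z' hz').mono Ioc_subset_Icc_self).aestronglyMeasurable measurableSet_Ioc
    · exact ContinuousOn.intervalIntegrable (by rw [hI]; exact hc1 z hz)
    · rw [uIoc_of_le zero_le_one]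
      exact ((hc2 z hz).mono Ioc_subset_Icc_self).aestronglyMeasurable measurableSet_Ioc
    · refine ae_of_all _ fun θ hθ z' hz' => ?_
      rw [uIoc_of_le zero_le_one] at hθ
      have hθ' : θ ∈ Icc (0 : ℝ) 1 := Ioc_subset_Icc_self hθ
      have h3 := hC _ (Metric.ball_subset_closedBall (hpath hz' hθ'))
      have hC0 : 0 ≤ C := (norm_nonneg _).trans h3
      rw [norm_mul, norm_mul, norm_mul, norm_pow, norm_pow, Complex.norm_real,
        Real.norm_of_nonneg hθ'.1, Complex.norm_ofNat]
      have h4 : θ ^ n ≤ 1 := pow_le_one₀ hθ'.1 hθ'.2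
      have h5 : θ ^ 2 ≤ 1 := pow_le_one₀ hθ'.1 hθ'.2
      calc 2 * θ ^ n * (‖deriv h (z₀ + (θ : ℂ) ^ 2 * (z' - z₀))‖ * θ ^ 2)
          ≤ 2 * 1 * (C * 1) := by gcongr
        _ = 2 * C := by ring
    · simp
    · refine ae_of_all _ fun θ hθ z' hz' => ?_
      rw [uIoc_of_le zero_le_one] at hθ
      have h3 := hpath (hsub' hz') (Ioc_subset_Icc_self hθ)
      have h4 : HasDerivAt (fun z : ℂ => z₀ + (θ : ℂ) ^ 2 * (z - z₀)) ((θ : ℂ) ^ 2) z' := by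
        simpa using (((hasDerivAt_id z').sub_const z₀).const_mul ((θ : ℂ) ^ 2)).const_add z₀
      exact (((hd.differentiableAt (Metric.isOpen_ball.mem_nhds h3)).hasDerivAt.comp z'
        h4).const_mul _)
  refine ⟨_, DifferentiableOn.analyticAt (fun z hz =>
    (hderiv z hz).differentiableAt.differentiableWithinAt) (Metric.ball_mem_nhds z₀ hr), ?_⟩
  filter_upwards [Metric.ball_mem_nhds z₀ hr] with z hz
  rw [(hderiv z hz).deriv, ← intervalIntegral.integral_const_mul,
    ← intervalIntegral.integral_const_mul, ← intervalIntegral.integral_add]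
  · have hF : ∀ θ ∈ uIcc (0 : ℝ) 1, HasDerivAt
        (fun θ : ℝ => 2 * (θ : ℂ) ^ (n + 1) * h (z₀ + (θ : ℂ) ^ 2 * (z - z₀)))
        ((n + 1) * (2 * (θ : ℂ) ^ n * h (z₀ + (θ : ℂ) ^ 2 * (z - z₀))) +
          2 * (z - z₀) * (2 * (θ : ℂ) ^ n *
          (deriv h (z₀ + (θ : ℂ) ^ 2 * (z - z₀)) * (θ : ℂ) ^ 2))) θ := by
      intro θ hθ
      rw [hI] at hθ
      have hid : HasDerivAt (fun θ : ℝ => (θ : ℂ)) 1 θ := Complex.ofRealCLM.hasDerivAt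
      have h3 : HasDerivAt (fun θ : ℝ => z₀ + (θ : ℂ) ^ 2 * (z - z₀))
          (2 * (θ : ℂ) * (z - z₀)) θ := by
        simpa using ((hid.pow 2).mul_const (z - z₀)).const_add z₀
      have h4 := (hd.differentiableAt (Metric.isOpen_ball.mem_nhds
        (hpath hz hθ))).hasDerivAt.comp θ h3
      have h5 := ((hid.pow (n + 1)).const_mul 2).mul h4
      refine h5.congr_deriv ?_
      simp only [Pi.pow_apply, Function.comp_apply, Nat.add_sub_cancel]
      push_cast
      ring
    rw [intervalIntegral.integral_eq_sub_of_hasDerivAt hF]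
    · simp
    · refine ContinuousOn.intervalIntegrable ?_
      rw [hI]
      exact (continuousOn_const.mul (hc1 z hz)).add (continuousOn_const.mul (hc2 z hz))
  · exact ContinuousOn.intervalIntegrable (by rw [hI]; exact continuousOn_const.mul (hc1 z hz))
  · exact ContinuousOn.intervalIntegrable (by rw [hI]; exact continuousOn_const.mul (hc2 z hz))

/-- Local normal form of `u dz²` at a zero of order `n - 2`: a coordinate `G` for which `G ^ n` is
the square of a primitive of a square root of `u`. -/
theorem AnalyticAt.exists_normalForm {u : ℂ → ℂ} {z₀ : ℂ} (hu : AnalyticAt ℂ u z₀)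
    (h0 : ¬ ∀ᶠ z in 𝓝 z₀, u z = 0) :
    ∃ (n : ℕ) (G : ℂ → ℂ), 0 < n ∧ (u z₀ ≠ 0 → n = 2) ∧ AnalyticAt ℂ G z₀ ∧ G z₀ = 0 ∧
      deriv G z₀ ≠ 0 ∧ ∀ᶠ z in 𝓝 z₀, (n * G z ^ (n - 1) * deriv G z) ^ 2 = 4 * G z ^ n * u z := by
  obtain ⟨k, g, hg, hg0, hug⟩ := hu.exists_eventuallyEq_pow_smul_nonzero_iff.mpr h0
  obtain ⟨h, hh, hh0, hhg⟩ := hg.exists_pow_eq hg0 two_pos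
  obtain ⟨v, hv, hode⟩ := hh.exists_add_mul_deriv_eq (k + 1)
  have hv0 : v z₀ ≠ 0 := by
    intro h1
    have h2 := hode.self_of_nhds
    simp only [h1, sub_self, mul_zero, zero_mul, add_zero] at h2
    exact hh0 (by simpa using h2.symm)
  obtain ⟨V, hV, hV0, hVv⟩ := (hv.pow 2).exists_pow_eq (pow_ne_zero 2 hv0) (Nat.succ_pos (k + 1))
  have hGd : ∀ᶠ z in 𝓝 z₀, HasDerivAt (fun z => (z - z₀) * V z) (V z + (z - z₀) * deriv V z) z := by
    filter_upwards [hV.eventually_analyticAt] with z hz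
    have := ((hasDerivAt_id z).sub_const z₀).mul hz.differentiableAt.hasDerivAt
    rw [one_mul] at this
    exact this
  refine ⟨k + 2, fun z => (z - z₀) * V z, Nat.succ_pos _, ?_,
    (analyticAt_id.sub analyticAt_const).mul hV, by simp, ?_, ?_⟩
  · intro hu0
    have h1 := hug.self_of_nhds
    rw [sub_self] at h1
    by_contra hk
    rw [zero_pow (by omega), zero_smul] at h1
    exact hu0 h1
  · rw [hGd.self_of_nhds.deriv]
    simpa using hV0
  · have hpow : ∀ᶠ z in 𝓝 z₀, ((z - z₀) * V z) ^ (k + 2) = (z - z₀) ^ (k + 2) * v z ^ 2 := by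
      filter_upwards [hVv] with z hz
      rw [mul_pow, hz]
      rfl
    filter_upwards [hpow.eventually_nhds, hGd, hv.eventually_analyticAt, hode, hug, hhg]
      with z h1 h2 h3 h4 h5 h6
    have d1 := (h2.pow (k + 2)).congr_of_eventuallyEq (h1.mono fun z hz => hz.symm)
    have d2 := (((hasDerivAt_id z).sub_const z₀).pow (k + 2)).mul
      (h3.differentiableAt.hasDerivAt.pow 2)
    have h7 := d1.unique d2
    rw [h2.deriv, h1.self_of_nhds]
    simp only [id, Pi.pow_apply] at h7
    rw [h7, h5, smul_eq_mul, ← h6]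
    have h8 : h z = (((k + 1 : ℕ) + 1) * v z + 2 * (z - z₀) * deriv v z) / 2 := by
      rw [h4]
      ring
    rw [h8]
    simp only [Nat.add_succ_sub_one, Nat.cast_add, Nat.cast_ofNat, Nat.cast_one]
    ring

/-- Holomorphic functions with the same squared derivative differ locally by a sign and a
constant. -/
theorem eventually_eq_sign_mul_add {f g : ℂ → ℂ} {z₀ : ℂ} (hf : AnalyticAt ℂ f z₀)
    (hg : AnalyticAt ℂ g z₀) (h : ∀ᶠ z in 𝓝 z₀, deriv g z ^ 2 = deriv f z ^ 2) :
    ∃ s : ℝ, (s = 1 ∨ s = -1) ∧ ∀ᶠ z in 𝓝 z₀, g z = g z₀ + s • (f z - f z₀) := by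
  obtain ⟨s, hs, hsd⟩ : ∃ s : ℝ, (s = 1 ∨ s = -1) ∧ ∀ᶠ z in 𝓝 z₀, deriv g z = s • deriv f z := by
    have hfr : ∃ᶠ z in 𝓝[≠] z₀, deriv g z = deriv f z ∨ deriv g z = -deriv f z :=
      ((h.filter_mono nhdsWithin_le_nhds).mono fun z hz =>
        sq_eq_sq_iff_eq_or_eq_neg.mp hz).frequently
    rcases frequently_or_distrib.mp hfr with h1 | h1
    · refine ⟨1, Or.inl rfl, ?_⟩
      filter_upwards [(hg.deriv.frequently_eq_iff_eventually_eq hf.deriv).mp h1] with z hz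
      rw [one_smul, hz]
    · refine ⟨-1, Or.inr rfl, ?_⟩
      filter_upwards [(hg.deriv.frequently_eq_iff_eventually_eq hf.deriv.neg).mp h1] with z hz
      rw [neg_one_smul, hz]
      rfl
  refine ⟨s, hs, ?_⟩
  obtain ⟨r, hr, hball⟩ := Metric.eventually_nhds_iff_ball.mp
    (hsd.and (hf.eventually_analyticAt.and hg.eventually_analyticAt))
  have hD : ∀ z ∈ Metric.ball z₀ r, HasDerivAt (fun z => g z - s • f z)
      (deriv g z - s • deriv f z) z := fun z hz =>
    (hball z hz).2.2.differentiableAt.hasDerivAt.sub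
      ((hball z hz).2.1.differentiableAt.hasDerivAt.const_smul s)
  filter_upwards [Metric.ball_mem_nhds z₀ hr] with z hz
  have := Metric.isOpen_ball.is_const_of_deriv_eq_zero (convex_ball z₀ r).isPreconnected
    (fun z hz => (hD z hz).differentiableAt.differentiableWithinAt) (fun z hz => by
      rw [(hD z hz).deriv, (hball z hz).1, sub_self]
      rfl) hz (Metric.mem_ball_self hr)
  rw [smul_sub]
  linear_combination this

/-! ### The flat structure of a quadratic differential -/

/-- A conformal function of a chart restricts to a homeomorphism onto a disc. -/
theorem AnalyticAt.exists_homeomorph_ball {X : Type*} [TopologicalSpace X]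
    {φ : OpenPartialHomeomorph X ℂ} {p : X} (hp : p ∈ φ.source) {G : ℂ → ℂ}
    (hG : AnalyticAt ℂ G (φ p))
    (hG0 : G (φ p) = 0) (hG1 : deriv G (φ p) ≠ 0) {Q : X → Prop} (hQ : ∀ᶠ y in 𝓝 p, Q y) :
    ∃ (ξ : OpenPartialHomeomorph X ℂ) (r : ℝ), 0 < r ∧ p ∈ ξ.source ∧
      ξ.target = Metric.ball 0 r ∧ ∀ x ∈ ξ.source, x ∈ φ.source ∧ ξ x = G (φ x) ∧ Q x := by
  have hst := hG.hasStrictDerivAt.hasStrictFDerivAt_equiv hG1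
  set E := φ ≫ₕ hst.toOpenPartialHomeomorph G with hE
  have hEp : p ∈ E.source := by
    rw [hE, OpenPartialHomeomorph.trans_source]
    exact ⟨hp, hst.mem_toOpenPartialHomeomorph_source⟩
  have hEa : ∀ y, E y = G (φ y) := fun y => rfl
  have hEp0 : E p = 0 := (hEa p).trans hG0
  have h0t : (0 : ℂ) ∈ E.target := hEp0 ▸ E.map_source hEp
  have hs0 : E.symm 0 = p := by rw [← hEp0, E.left_inv hEp]
  have hc := E.continuousAt_symm h0t
  rw [ContinuousAt, hs0] at hc
  have ht : ∀ᶠ z in 𝓝 (0 : ℂ), z ∈ E.target := E.open_target.mem_nhds h0t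
  obtain ⟨r, hr, hball⟩ := Metric.eventually_nhds_iff_ball.mp (ht.and (hc.eventually hQ))
  set T := E.symm.restrOpen (Metric.ball 0 r) Metric.isOpen_ball with hT
  have hTs : T.source = Metric.ball 0 r := inter_eq_right.mpr fun z hz => (hball z hz).1
  have hTa : ∀ z, T z = E.symm z := fun z => rfl
  refine ⟨T.symm, r, hr, ?_, hTs, ?_⟩
  · have h1 := T.map_source (hTs ▸ Metric.mem_ball_self hr : (0 : ℂ) ∈ T.source)
    rwa [hTa, hs0] at h1
  · intro x hx
    have h1 : E x ∈ T.source := T.map_target hx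
    have h2 : E.symm (E x) = x := T.right_inv hx
    rw [hTs] at h1
    have h3 := hball _ h1
    have h4 := E.map_target h3.1
    rw [h2] at h3 h4
    rw [hE, OpenPartialHomeomorph.trans_source] at h4
    exact ⟨h4.1, rfl, h3.2⟩

namespace QuadraticDifferential

variable {X : Type*} [TopologicalSpace X] [ChartedSpace ℂ X] [IsManifold 𝓘(ℂ) 1 X]
variable {q : QuadraticDifferential X} {φ ψ e : OpenPartialHomeomorph X ℂ} {p x : X}

theorem analyticAt_coeff (hφ : φ ∈ IsManifold.maximalAtlas 𝓘(ℂ) 1 X) (hp : p ∈ φ.source) :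
    AnalyticAt ℂ (q.coeff φ) (φ p) :=
  (q.holomorphic φ hφ).analyticAt (φ.open_target.mem_nhds (φ.map_source hp))

theorem analyticAt_transition (hφ : φ ∈ IsManifold.maximalAtlas 𝓘(ℂ) 1 X)
    (hψ : ψ ∈ IsManifold.maximalAtlas 𝓘(ℂ) 1 X) (hp : p ∈ φ.source ∩ ψ.source) :
    AnalyticAt ℂ (fun z => ψ (φ.symm z)) (φ p) := by
  have h1 := (contMDiffOn_symm_of_mem_maximalAtlas hφ).contMDiffAt
    (φ.open_target.mem_nhds (φ.map_source hp.1))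
  have h2 := (contMDiffOn_of_mem_maximalAtlas hψ).contMDiffAt (ψ.open_source.mem_nhds hp.2)
  rw [← φ.left_inv hp.1] at h2
  have h3 := contMDiffAt_iff_contDiffAt.mp (h2.comp (φ p) h1)
  refine Complex.analyticAt_iff_eventually_differentiableAt.mpr ?_
  filter_upwards [h3.eventually (by simp)] with z hz
  exact hz.differentiableAt one_ne_zero

theorem coeff_eq_zero_of_coeff_eq_zero (hφ : φ ∈ IsManifold.maximalAtlas 𝓘(ℂ) 1 X)
    (hψ : ψ ∈ IsManifold.maximalAtlas 𝓘(ℂ) 1 X) (hp : p ∈ φ.source ∩ ψ.source)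
    (h : q.coeff ψ (ψ p) = 0) : q.coeff φ (φ p) = 0 := by
  rw [q.transform φ hφ ψ hψ p hp, h, zero_mul]

theorem mem_sing_iff (hφ : φ ∈ IsManifold.maximalAtlas 𝓘(ℂ) 1 X) (hp : p ∈ φ.source) :
    p ∈ q.flat.sing ↔ q.coeff φ (φ p) = 0 :=
  ⟨coeff_eq_zero_of_coeff_eq_zero hφ (IsManifold.chart_mem_maximalAtlas p)
    ⟨hp, mem_chart_source ℂ p⟩,
  coeff_eq_zero_of_coeff_eq_zero (IsManifold.chart_mem_maximalAtlas p) hφ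
    ⟨mem_chart_source ℂ p, hp⟩⟩

/-- A homeomorphism that is locally a conformal function of a holomorphic chart is a holomorphic
chart. -/
theorem mem_maximalAtlas_of_eventually (h : ∀ x ∈ e.source, ∃ φ ∈ IsManifold.maximalAtlas 𝓘(ℂ) 1 X,
    x ∈ φ.source ∧ ∃ f : ℂ → ℂ, AnalyticAt ℂ f (φ x) ∧ deriv f (φ x) ≠ 0 ∧
      ∀ᶠ y in 𝓝 x, e y = f (φ y)) : e ∈ IsManifold.maximalAtlas 𝓘(ℂ) 1 X := by
  refine OpenPartialHomeomorph.mem_maximalAtlas_of_contMDiffOn e ?_ ?_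
  · intro x hx
    obtain ⟨φ, hφ, hxφ, f, hf, -, hev⟩ := h x hx
    have h1 := (contMDiffOn_of_mem_maximalAtlas hφ).contMDiffAt (φ.open_source.mem_nhds hxφ)
    have h2 : ContMDiffAt 𝓘(ℂ) 𝓘(ℂ) 1 f (φ x) := hf.contDiffAt.contMDiffAt
    exact ((h2.comp x h1).congr_of_eventuallyEq hev).contMDiffWithinAt
  · intro y hy
    obtain ⟨φ, hφ, hxφ, f, hf, hf0, hev⟩ := h (e.symm y) (e.map_target hy)
    have hT : (φ.symm ≫ₕ e : ℂ → ℂ) =ᶠ[𝓝 (φ (e.symm y))] f := by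
      have hc := φ.continuousAt_symm (φ.map_source hxφ)
      rw [ContinuousAt, φ.left_inv hxφ] at hc
      filter_upwards [hc.eventually hev, φ.open_target.mem_nhds (φ.map_source hxφ)] with z h1 h2
      change e (φ.symm z) = f z
      rw [h1, φ.right_inv h2]
    have hyT : y ∈ (φ.symm ≫ₕ e).target := by
      rw [OpenPartialHomeomorph.trans_target]
      exact ⟨hy, hxφ⟩
    have h1 := (φ.symm ≫ₕ e).contDiffAt_symm_deriv hf0 hyT
      (hf.differentiableAt.hasDerivAt.congr_of_eventuallyEq hT)
      (hf.contDiffAt.congr_of_eventuallyEq hT : ContDiffAt ℂ 1 _ _)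
    have h2 := (contMDiffOn_symm_of_mem_maximalAtlas hφ).contMDiffAt
      (φ.open_target.mem_nhds (φ.map_source hxφ))
    have h3 : ContMDiffAt 𝓘(ℂ) 𝓘(ℂ) 1 (φ.symm ≫ₕ e).symm y := h1.contMDiffAt
    have h4 := ContMDiffAt.comp (x := y) (g := φ.symm) h2 h3
    refine (h4.congr_of_eventuallyEq ?_).contMDiffWithinAt
    filter_upwards [(e.continuousAt_symm hy).eventually (φ.open_source.mem_nhds hxφ)] with z hz
    change e.symm z = φ.symm (φ (e.symm z))
    rw [φ.left_inv hz]

theorem coeff_eq_mul_deriv_sq (hφ : φ ∈ IsManifold.maximalAtlas 𝓘(ℂ) 1 X)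
    (he : e ∈ IsManifold.maximalAtlas 𝓘(ℂ) 1 X) (hx : x ∈ φ.source ∩ e.source) {f : ℂ → ℂ}
    (h : ∀ᶠ y in 𝓝 x, e y = f (φ y)) :
    q.coeff φ (φ x) = q.coeff e (e x) * deriv f (φ x) ^ 2 := by
  rw [q.transform φ hφ e he x hx]
  congr 2
  refine Filter.EventuallyEq.deriv_eq ?_
  have hc := φ.continuousAt_symm (φ.map_source hx.1)
  rw [ContinuousAt, φ.left_inv hx.1] at hc
  filter_upwards [hc.eventually h, φ.open_target.mem_nhds (φ.map_source hx.1)] with z h1 h2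
  rw [h1, φ.right_inv h2]

/-- The coefficient of `q` in a chart is the squared derivative of a flat coordinate. -/
theorem eventually_coeff_eq_deriv_sq (hφ : φ ∈ IsManifold.maximalAtlas 𝓘(ℂ) 1 X)
    (hψ : ψ ∈ q.flat.charts) (hx : x ∈ φ.source ∩ ψ.source) :
    ∀ᶠ z in 𝓝 (φ x), q.coeff φ z = deriv (fun z => ψ (φ.symm z)) z ^ 2 := by
  have hc := φ.continuousAt_symm (φ.map_source hx.1)
  rw [ContinuousAt, φ.left_inv hx.1] at hc
  filter_upwards [hc.eventually (ψ.open_source.mem_nhds hx.2),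
    φ.open_target.mem_nhds (φ.map_source hx.1)] with z h1 h2
  have h3 := q.transform φ hφ ψ hψ.1 (φ.symm z) ⟨φ.map_target h2, h1⟩
  rwa [φ.right_inv h2, hψ.2 _ (ψ.map_source h1), one_mul] at h3

/-- Flat charts differ locally by `z ↦ ± z + b`, the solutions of `f' ^ 2 = 1`. -/
theorem flat_transition (hφ : φ ∈ q.flat.charts) (hψ : ψ ∈ q.flat.charts)
    (hx : x ∈ φ.source ∩ ψ.source) :
    ∃ s : ℝ, (s = 1 ∨ s = -1) ∧ ∀ᶠ y in 𝓝 x, ψ y = ψ x + s • (φ y - φ x) := by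
  obtain ⟨s, hs, hev⟩ := eventually_eq_sign_mul_add (f := id) (g := fun z => ψ (φ.symm z))
    analyticAt_id (analyticAt_transition hφ.1 hψ.1 hx) (by
    filter_upwards [eventually_coeff_eq_deriv_sq hφ.1 hψ hx,
      φ.open_target.mem_nhds (φ.map_source hx.1)] with z h1 h2
    rw [← h1, hφ.2 z h2, deriv_id, one_pow])
  refine ⟨s, hs, ?_⟩
  filter_upwards [(φ.continuousAt hx.1).eventually hev, φ.open_source.mem_nhds hx.1] with y h1 h2
  simpa only [φ.left_inv h2, φ.left_inv hx.1, id] using h1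

/-- The flat charts form a maximal atlas for coordinate changes `z ↦ ± z + b`. -/
theorem mem_flat_charts (h : ∀ x ∈ e.source, ∃ φ ∈ q.flat.charts, x ∈ φ.source ∧
      ∃ s : ℝ, (s = 1 ∨ s = -1) ∧ ∃ b : ℂ, ∀ᶠ y in 𝓝 x, e y = s • φ y + b) :
    e ∈ q.flat.charts := by
  have hd : ∀ (s : ℝ) (b z : ℂ), HasDerivAt (fun z : ℂ => s • z + b) (s : ℂ) z := fun s b z => by
    simpa using ((hasDerivAt_id z).const_smul s).add_const b
  have he : e ∈ IsManifold.maximalAtlas 𝓘(ℂ) 1 X := by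
    refine mem_maximalAtlas_of_eventually fun x hx => ?_
    obtain ⟨φ, hφ, hxφ, s, hs, b, hev⟩ := h x hx
    refine ⟨φ, hφ.1, hxφ, fun z => s • z + b, ?_, ?_, hev⟩
    · exact Differentiable.analyticAt (fun z => (hd s b z).differentiableAt) _
    · rw [(hd s b _).deriv]
      rcases hs with rfl | rfl <;> simp
  refine ⟨he, fun z hz => ?_⟩
  obtain ⟨φ, hφ, hxφ, s, hs, b, hev⟩ := h (e.symm z) (e.map_target hz)
  have h1 := coeff_eq_mul_deriv_sq (q := q) (f := fun z => s • z + b) hφ.1 he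
    ⟨hxφ, e.map_target hz⟩ hev
  rw [hφ.2 _ (φ.map_source hxφ), (hd s b _).deriv, e.right_inv hz] at h1
  rcases hs with rfl | rfl <;> simpa using h1.symm

variable (q) in
/-- `q` does not vanish identically near any point. -/
def Nondegenerate : Prop := ∀ p, ¬ ∀ᶠ y in 𝓝 p, y ∈ q.flat.sing

theorem Nondegenerate.coeff_ne_zero (hq : q.Nondegenerate)
    (hφ : φ ∈ IsManifold.maximalAtlas 𝓘(ℂ) 1 X) (hp : p ∈ φ.source) :
    ¬ ∀ᶠ z in 𝓝 (φ p), q.coeff φ z = 0 := by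
  intro h
  apply hq p
  filter_upwards [(φ.continuousAt hp).eventually h, φ.open_source.mem_nhds hp] with y h1 h2
  exact (mem_sing_iff hφ h2).mpr h1

theorem Nondegenerate.eventually_notMem_sing (hq : q.Nondegenerate) (p : X) :
    ∀ᶠ y in 𝓝[≠] p, y ∉ q.flat.sing := by
  have hφ := IsManifold.chart_mem_maximalAtlas (I := 𝓘(ℂ)) (n := 1) p
  have hp := mem_chart_source ℂ p
  have h1 := (analyticAt_coeff (q := q) hφ hp).eventually_eq_zero_or_eventually_ne_zero.resolve_left
    (hq.coeff_ne_zero hφ hp)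
  have t : Tendsto (chartAt ℂ p) (𝓝[≠] p) (𝓝[≠] (chartAt ℂ p p)) := by
    refine tendsto_nhdsWithin_iff.mpr
      ⟨((chartAt ℂ p).continuousAt hp).tendsto.mono_left nhdsWithin_le_nhds, ?_⟩
    filter_upwards [self_mem_nhdsWithin, nhdsWithin_le_nhds ((chartAt ℂ p).open_source.mem_nhds hp)]
      with y h2 h3 h4
    exact h2 ((chartAt ℂ p).injOn h3 hp h4)
  filter_upwards [t.eventually h1, nhdsWithin_le_nhds ((chartAt ℂ p).open_source.mem_nhds hp)]
    with y h2 h3 h4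
  exact h2 ((mem_sing_iff hφ h3).mp h4)

theorem Nondegenerate.finite_sing [CompactSpace X] (hq : q.Nondegenerate) :
    q.flat.sing.Finite := by
  by_contra h
  obtain ⟨p, hp⟩ := (show q.flat.sing.Infinite from h).exists_accPt_principal
  rw [accPt_iff_frequently_nhdsNE] at hp
  exact hp (hq.eventually_notMem_sing p)

/-- Zeros of `q` are isolated unless `q = 0`. -/
theorem nondegenerate_of_notMem_sing [PreconnectedSpace X] (hp : p ∉ q.flat.sing) :
    q.Nondegenerate := by
  by_contra hcon
  have hcl : IsClopen {p | ∀ᶠ y in 𝓝 p, y ∈ q.flat.sing} := by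
    refine ⟨?_, isOpen_setOfPred_eventually_nhds⟩
    rw [← closure_subset_iff_isClosed]
    intro x hx
    have hφ := IsManifold.chart_mem_maximalAtlas (I := 𝓘(ℂ)) (n := 1) x
    have hxs := mem_chart_source ℂ x
    rcases (analyticAt_coeff (q := q) hφ hxs).eventually_eq_zero_or_eventually_ne_zero with h | h
    · filter_upwards [((chartAt ℂ x).continuousAt hxs).eventually h,
        (chartAt ℂ x).open_source.mem_nhds hxs] with y h1 h2
      exact (mem_sing_iff hφ h2).mpr h1
    · exfalso
      rw [eventually_nhdsWithin_iff] at h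
      have h1 := ((chartAt ℂ x).continuousAt hxs).eventually h
      obtain ⟨y, hy, h2, h3⟩ := ((mem_closure_iff_frequently.mp hx).and_eventually
        (h1.eventually_nhds.and
          ((chartAt ℂ x).open_source.eventually_mem hxs))).exists
      -- Near `y` the coefficient vanishes, but it is nonzero off `x`.
      have h4 : ∀ᶠ z in 𝓝 y, z = x := by
        filter_upwards [hy, h2, (chartAt ℂ x).open_source.mem_nhds h3] with z g1 g2 g3
        by_contra hne
        exact g2 (fun g4 => hne ((chartAt ℂ x).injOn g3 hxs g4)) ((mem_sing_iff hφ g3).mp g1)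
      have hc := (chartAt ℂ x).continuousAt_symm ((chartAt ℂ x).map_source h3)
      rw [ContinuousAt, (chartAt ℂ x).left_inv h3] at hc
      have h5 : ∀ᶠ z in 𝓝 (chartAt ℂ x y), z = chartAt ℂ x x := by
        filter_upwards [hc.eventually h4,
          (chartAt ℂ x).open_target.mem_nhds ((chartAt ℂ x).map_source h3)] with z g1 g2
        rw [← (chartAt ℂ x).right_inv g2]
        exact congrArg _ g1
      obtain ⟨z, g1, g2⟩ := ((h5.filter_mono nhdsWithin_le_nhds).and
        (self_mem_nhdsWithin (a := chartAt ℂ x y) (s := {chartAt ℂ x y}ᶜ))).exists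
      exact g2 (g1.trans h5.self_of_nhds.symm)
  unfold Nondegenerate at hcon
  push Not at hcon
  have h1 := hcl.eq_univ hcon
  have h2 : p ∈ {p | ∀ᶠ y in 𝓝 p, y ∈ q.flat.sing} := h1 ▸ mem_univ p
  exact hp h2.self_of_nhds

theorem Nondegenerate.exists_flat_chart (hq : q.Nondegenerate) (hp : p ∉ q.flat.sing) :
    ∃ φ ∈ q.flat.charts, p ∈ φ.source := by
  have hφ := IsManifold.chart_mem_maximalAtlas (I := 𝓘(ℂ)) (n := 1) p
  have hps := mem_chart_source ℂ p
  set φ := chartAt ℂ p with hφd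
  have hu := analyticAt_coeff (q := q) hφ hps
  have hu0 : q.coeff φ (φ p) ≠ 0 := fun h => hp ((mem_sing_iff hφ hps).mpr h)
  obtain ⟨n, G, -, hn, hG, hG0, hG1, hode⟩ := hu.exists_normalForm (hq.coeff_ne_zero hφ hps)
  obtain rfl := hn hu0
  have hGne : ∀ᶠ z in 𝓝[≠] (φ p), G z ≠ 0 := by
    have := hG.differentiableAt.hasDerivAt.eventually_ne hG1 (c := 0)
    exact this
  have hsq : ∀ᶠ z in 𝓝 (φ p), deriv G z ^ 2 = q.coeff φ z := by
    refine ((hG.deriv.pow 2).frequently_eq_iff_eventually_eq hu).mp (Eventually.frequently ?_)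
    filter_upwards [hGne, nhdsWithin_le_nhds hode] with z h1 h2
    have h3 : 4 * G z ^ 2 ≠ 0 := mul_ne_zero (by norm_num) (pow_ne_zero 2 h1)
    apply mul_left_cancel₀ h3
    rw [← h2, Pi.pow_apply]
    push_cast
    ring
  obtain ⟨ξ, r, hr, hpξ, htar, hξ⟩ := hG.exists_homeomorph_ball hps hG0 hG1
    (Q := fun y => AnalyticAt ℂ G (φ y) ∧ deriv G (φ y) ≠ 0 ∧ deriv G (φ y) ^ 2 = q.coeff φ (φ y))
    ((φ.continuousAt hps).eventually (hG.eventually_analyticAt.and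
      ((hG.deriv.continuousAt.eventually_ne hG1).and hsq)))
  have hev : ∀ x ∈ ξ.source, ∀ᶠ y in 𝓝 x, ξ y = G (φ y) := fun x hx => by
    filter_upwards [ξ.open_source.mem_nhds hx] with y hy
    exact (hξ y hy).2.1
  have hξm : ξ ∈ IsManifold.maximalAtlas 𝓘(ℂ) 1 X := mem_maximalAtlas_of_eventually fun x hx =>
    ⟨φ, hφ, (hξ x hx).1, G, (hξ x hx).2.2.1, (hξ x hx).2.2.2.1, hev x hx⟩
  refine ⟨ξ, ⟨hξm, fun z hz => ?_⟩, hpξ⟩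
  have hx := ξ.map_target hz
  obtain ⟨h1, -, -, h2, h3⟩ := hξ _ hx
  have h4 := coeff_eq_mul_deriv_sq (q := q) hφ hξm ⟨h1, hx⟩ (hev _ hx)
  rw [ξ.right_inv hz, ← h3] at h4
  exact (mul_eq_right₀ (pow_ne_zero 2 h2)).mp h4.symm

theorem Nondegenerate.exists_cone (hq : q.Nondegenerate) (hp : p ∈ q.flat.sing) :
    ∃ ξ r n, q.flat.IsCone p ξ r n := by
  have hφ := IsManifold.chart_mem_maximalAtlas (I := 𝓘(ℂ)) (n := 1) p
  have hps := mem_chart_source ℂ p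
  set φ := chartAt ℂ p with hφd
  have hu := analyticAt_coeff (q := q) hφ hps
  obtain ⟨n, G, hn, -, hG, hG0, hG1, hode⟩ := hu.exists_normalForm (hq.coeff_ne_zero hφ hps)
  obtain ⟨ξ, r, hr, hpξ, htar, hξ⟩ := hG.exists_homeomorph_ball hps hG0 hG1
    (Q := fun y => AnalyticAt ℂ G (φ y) ∧ (y ≠ p → y ∉ q.flat.sing) ∧ ∀ᶠ z in 𝓝 (φ y),
      (n * G z ^ (n - 1) * deriv G z) ^ 2 = 4 * G z ^ n * q.coeff φ z)
    (((φ.continuousAt hps).eventually hG.eventually_analyticAt).and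
      ((eventually_nhdsWithin_iff.mp (hq.eventually_notMem_sing p)).and
        ((φ.continuousAt hps).eventually hode.eventually_nhds)))
  have hξp : ξ p = 0 := by rw [(hξ p hpξ).2.1, hG0]
  refine ⟨ξ, r, n, hp, hr, hn, hpξ, hξp, htar, fun x hx hxp => ?_⟩
  obtain ⟨hxφ, hxG, hGx, hxs, hodex⟩ := hξ x hx
  obtain ⟨ψ, hψ, hxψ⟩ := hq.exists_flat_chart (hxs hxp)
  have hGx0 : G (φ x) ≠ 0 := fun h => hxp (ξ.injOn hx hpξ (by rw [hxG, h, hξp]))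
  -- A square root `ρ` of `G ^ n` has the same squared derivative as the flat coordinate.
  obtain ⟨ρ, hρ, hρ0, hρG⟩ := (hGx.pow n).exists_pow_eq (pow_ne_zero n hGx0) two_pos
  have hρd : ∀ᶠ z in 𝓝 (φ x), deriv ρ z ^ 2 = deriv (fun z => ψ (φ.symm z)) z ^ 2 := by
    filter_upwards [hρG.eventually_nhds, hodex, eventually_coeff_eq_deriv_sq hφ hψ ⟨hxφ, hxψ⟩,
      hρ.eventually_analyticAt, hGx.eventually_analyticAt, hρ.continuousAt.eventually_ne hρ0]
      with z h1 h2 h3 h4 h5 h6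
    have d1 := (h4.differentiableAt.hasDerivAt.pow 2).congr_of_eventuallyEq
      (h1.mono fun z hz => hz.symm)
    have h7 := d1.unique (h5.differentiableAt.hasDerivAt.pow n)
    have h8 := h1.self_of_nhds
    rw [← h7, h3] at h2
    apply mul_left_cancel₀ (mul_ne_zero (by norm_num : (4 : ℂ) ≠ 0) (pow_ne_zero 2 h6))
    rw [Pi.pow_apply] at h8
    rw [← h8] at h2
    rw [← h2]
    push_cast
    ring
  obtain ⟨s, hs, hev⟩ := eventually_eq_sign_mul_add
    (analyticAt_transition hφ hψ.1 ⟨hxφ, hxψ⟩) hρ hρd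
  refine ⟨ψ, hψ, hxψ, ψ x - s • ρ (φ x), ?_⟩
  filter_upwards [(φ.continuousAt hxφ).eventually hev, (φ.continuousAt hxφ).eventually hρG,
    ξ.open_source.mem_nhds hx] with y h1 h2 h3
  obtain ⟨g1, g2, -⟩ := hξ y h3
  rw [Pi.pow_apply] at h2
  rw [g2, ← h2, h1, φ.left_inv g1, φ.left_inv hxφ]
  rcases hs with rfl | rfl
  · simp only [one_smul]
    ring
  · simp only [neg_one_smul]
    ring

theorem Nondegenerate.isHalfTranslation (hq : q.Nondegenerate) : q.flat.IsHalfTranslation where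
  transition _ hφ _ hψ _ hx := flat_transition hφ hψ hx
  mem_charts _ h := mem_flat_charts h
  exists_chart _ hp := hq.exists_flat_chart hp
  notMem_sing φ hφ p hp h := by
    have h1 := (mem_sing_iff hφ.1 hp).mp h
    rw [hφ.2 _ (φ.map_source hp)] at h1
    exact one_ne_zero h1
  exists_cone _ hp := hq.exists_cone hp

end QuadraticDifferential

/-! ### Pulling back along the Teichmüller flow -/

theorem teichmullerStretch_re (t : ℝ) (z : ℂ) :
    (teichmullerStretch t z).re = Real.exp (t / 2) * z.re := rfl

theorem teichmullerStretch_symm_im (t : ℝ) (z : ℂ) :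
    ((teichmullerStretch t).symm z).im = Real.exp (t / 2) * z.im := rfl

theorem teichmullerStretch_zero (t : ℝ) : teichmullerStretch t 0 = 0 := by
  apply Complex.ext <;> simp [teichmullerStretch]

theorem teichmullerStretch_add_ofReal_mul (t r : ℝ) (a w : ℂ) :
    teichmullerStretch t (a + r * w) = teichmullerStretch t a + r * teichmullerStretch t w := by
  apply Complex.ext <;> simp [teichmullerStretch] <;> ring

namespace FlatStructure

variable {X : Type*} [TopologicalSpace X] {F : FlatStructure X} {t : ℝ}

theorem isSegment_evolve {σ : ℝ → X} {w : ℂ} :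
    (F.evolve t).IsSegment σ (teichmullerStretch t w) ↔ F.IsSegment σ w := by
  have key : ∀ (φ : OpenPartialHomeomorph X ℂ) (s r : ℝ),
      (φ.transHomeomorph (teichmullerStretch t)) (σ r) =
        (φ.transHomeomorph (teichmullerStretch t)) (σ s) +
          ((r - s : ℝ) : ℂ) * teichmullerStretch t w ↔
      φ (σ r) = φ (σ s) + ((r - s : ℝ) : ℂ) * w := by
    intro φ s r
    change teichmullerStretch t (φ (σ r)) = teichmullerStretch t (φ (σ s)) + _ ↔ _
    rw [← teichmullerStretch_add_ofReal_mul, (teichmullerStretch t).injective.eq_iff]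
  constructor
  · rintro ⟨h1, h2⟩
    refine ⟨h1, fun s hs => ?_⟩
    obtain ⟨_, ⟨φ, hφ, rfl⟩, h3, h4⟩ := h2 s hs
    exact ⟨φ, hφ, h3, h4.mono fun r hr => (key φ s r).mp hr⟩
  · rintro ⟨h1, h2⟩
    refine ⟨h1, fun s hs => ?_⟩
    obtain ⟨φ, hφ, h3, h4⟩ := h2 s hs
    exact ⟨_, ⟨φ, hφ, rfl⟩, h3, h4.mono fun r hr => (key φ s r).mpr hr⟩

namespace SaddleConnection

/-- A saddle connection of `X_t`, seen in `X`. -/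
def ofEvolve (γ : (F.evolve t).SaddleConnection) : F.SaddleConnection where
  path := γ.path
  hol := (teichmullerStretch t).symm γ.hol
  hol_ne_zero h := γ.hol_ne_zero (by
    rw [← (teichmullerStretch t).apply_symm_apply γ.hol, h, teichmullerStretch_zero])
  isSegment := isSegment_evolve.mp (by
    rw [(teichmullerStretch t).apply_symm_apply]
    exact γ.isSegment)
  start_mem := γ.start_mem
  end_mem := γ.end_mem

theorem ofEvolve_graph (γ : (F.evolve t).SaddleConnection) : γ.ofEvolve.graph = γ.graph := by
  have h0 : ∀ w : ℂ, teichmullerStretch t w ≠ 0 ↔ w ≠ 0 := fun w => by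
    conv_lhs => rw [← teichmullerStretch_zero t]
    exact (teichmullerStretch t).injective.ne_iff
  have hre : ∀ w : ℂ, (teichmullerStretch t w).re = 0 ↔ w.re = 0 := fun w => by
    rw [teichmullerStretch_re, mul_eq_zero, or_iff_right (Real.exp_ne_zero _)]
  ext p
  refine or_congr Iff.rfl (exists_congr fun σ => ?_)
  refine Iff.trans ?_ (teichmullerStretch t).surjective.exists.symm
  refine exists_congr fun w => ?_
  rw [isSegment_evolve, h0, hre]
  rfl

theorem ofEvolve_strips (γ : (F.evolve t).SaddleConnection) : γ.ofEvolve.strips = γ.strips := by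
  unfold strips
  rw [ofEvolve_graph]

end SaddleConnection

theorem abs_re_le_of_width_evolve_lt {P : Set X} {T : ℝ}
    (h : (F.evolve t).width P < ENNReal.ofReal T) (σ : ℝ → X) (u : ℂ) (hσ : F.IsSegment σ u)
    (hP : σ '' Icc 0 1 ⊆ P) : |u.re| ≤ Real.exp (-t / 2) * T := by
  have h1 : ENNReal.ofReal |(teichmullerStretch t u).re| ≤ (F.evolve t).width P :=
    le_iSup₂_of_le σ (teichmullerStretch t u) (le_iSup₂_of_le (isSegment_evolve.mpr hσ) hP le_rfl)
  have h2 := (ENNReal.ofReal_lt_ofReal_iff'.mp (h1.trans_lt h)).1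
  rw [teichmullerStretch_re, abs_mul, abs_of_pos (Real.exp_pos _)] at h2
  calc |u.re| = Real.exp (-t / 2) * (Real.exp (t / 2) * |u.re|) := by
        rw [← mul_assoc, ← Real.exp_add, neg_div, neg_add_cancel, Real.exp_zero, one_mul]
    _ ≤ Real.exp (-t / 2) * T := by gcongr

/-! ### The Diophantine condition -/

theorem Diophantine.re_ne_zero {h₀ c ε : ℝ} (hD : F.Diophantine h₀ c ε) (hh₀ : 0 < h₀) (hc : 0 < c)
    (γ : F.SaddleConnection) : γ.hol.re ≠ 0 := by
  intro h0
  have h1 : γ.h = 0 := by rw [SaddleConnection.h, h0, abs_zero]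
  obtain ⟨h2, h3⟩ := hD γ (h1 ▸ hh₀)
  rw [h1] at h3
  have : 0 < c / (γ.v * Real.log γ.v ^ ε) :=
    div_pos hc (mul_pos (one_pos.trans h2) (Real.rpow_pos_of_pos (Real.log_pos h2) _))
  exact h3.not_gt this

/-- The Diophantine condition with `log v` estimated by `t`. -/
theorem Diophantine.lt_mul {h₀ c ε a b : ℝ} (hD : F.Diophantine h₀ c ε) (hε : 0 < ε)
    (γ : F.SaddleConnection) (ha : |γ.hol.re| ≤ a) (hah : a < h₀) (hb : |γ.hol.im| ≤ b)
    (hbt : b ≤ Real.exp t) : c < t ^ ε * (a * b) := by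
  obtain ⟨h2, h3⟩ := hD γ (ha.trans_lt hah)
  have hv : 0 < γ.v := one_pos.trans h2
  have hlog := Real.log_pos h2
  have hlt : Real.log γ.v ≤ t := (Real.log_le_iff_le_exp hv).mpr (hb.trans hbt)
  rw [div_lt_iff₀ (mul_pos hv (Real.rpow_pos_of_pos hlog _))] at h3
  have h4 : Real.log γ.v ^ ε ≤ t ^ ε := Real.rpow_le_rpow hlog.le hlt hε.le
  have ha0 : 0 ≤ a := (abs_nonneg _).trans ha
  calc c < γ.h * (γ.v * Real.log γ.v ^ ε) := h3
    _ ≤ a * (b * t ^ ε) :=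
        mul_le_mul ha (mul_le_mul hb h4 (Real.rpow_nonneg hlog.le _) ((abs_nonneg _).trans hb))
          (mul_nonneg hv.le (Real.rpow_nonneg hlog.le _)) ha0
    _ = t ^ ε * (a * b) := by ring

/-- The inequalities between the constants that hold for all large `t`. -/
theorem eventually_bounds {h₀ c ε κ δ η A : ℝ} (hh₀ : 0 < h₀) (hc : 0 < c) (hε : 0 < ε)
    (hη : 0 < η) : ∀ᶠ t : ℝ in atTop, 1 < t ∧ Real.exp (-t / 2) < h₀ ∧
      2 * A * Real.exp (-t / 2) < h₀ ∧ t ^ δ + κ ≤ Real.exp (t / 2) ∧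
      t ^ (-η) + κ * t ^ (-ε) < c ∧ 2 * A * (t ^ (-ε) + κ * t ^ (-η)) < c := by
  have t1 : Tendsto (fun t : ℝ => Real.exp (-t / 2)) atTop (𝓝 0) := by
    refine Real.tendsto_exp_atBot.comp ?_
    exact (tendsto_neg_atTop_atBot).atBot_div_const two_pos
  have t2 := tendsto_rpow_neg_atTop hη
  have t3 := tendsto_rpow_neg_atTop hε
  have e1 : Tendsto (fun t : ℝ => 2 * A * Real.exp (-t / 2)) atTop (𝓝 0) := by
    simpa using t1.const_mul (2 * A)
  have e2 : Tendsto (fun t : ℝ => t ^ (-η) + κ * t ^ (-ε)) atTop (𝓝 0) := by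
    simpa using t2.add (t3.const_mul κ)
  have e3 : Tendsto (fun t : ℝ => 2 * A * (t ^ (-ε) + κ * t ^ (-η))) atTop (𝓝 0) := by
    simpa using (t3.add (t2.const_mul κ)).const_mul (2 * A)
  have e4 : ∀ᶠ t : ℝ in atTop, t ^ δ ≤ 1 / 2 * Real.exp (t / 2) := by
    have h1 := (isLittleO_rpow_exp_pos_mul_atTop δ (b := 1 / 2) (by norm_num)).bound
      (c := 1 / 2) (by norm_num)
    filter_upwards [h1, eventually_gt_atTop 0] with t h2 h3
    rw [Real.norm_of_nonneg (Real.rpow_nonneg h3.le _), Real.norm_of_nonneg (Real.exp_nonneg _)]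
      at h2
    rw [show t / 2 = 1 / 2 * t by ring]
    linarith
  have e5 : ∀ᶠ t : ℝ in atTop, 2 * κ ≤ Real.exp (t / 2) :=
    (Real.tendsto_exp_atTop.comp (tendsto_id.atTop_div_const two_pos)).eventually_ge_atTop (2 * κ)
  filter_upwards [eventually_gt_atTop 1, t1.eventually (gt_mem_nhds hh₀),
    e1.eventually (gt_mem_nhds hh₀), e2.eventually (gt_mem_nhds hc),
    e3.eventually (gt_mem_nhds hc), e4, e5] with t h1 h2 h3 h4 h5 h6 h7
  exact ⟨h1, h2, h3, by linarith, h4, h5⟩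

/-- The estimate on the surface `X` itself, with the thresholds
`M k = e ^ (t / 2) t ^ (2 k ε - ε + η)`. -/
theorem le_width_evolve [T2Space X] [CompactSpace X] [ConnectedSpace X] {h₀ c ε κ δ η : ℝ}
    {A : ℝ≥0} (hε : 0 < ε) (hκ : 0 ≤ κ) (hη : 0 < η) (hF : F.IsAdmissible A)
    (hD : F.Diophantine h₀ c ε) (h1 : 1 < t) (h2 : Real.exp (-t / 2) < h₀)
    (h3 : 2 * A * Real.exp (-t / 2) < h₀) (h4 : t ^ δ + κ ≤ Real.exp (t / 2))
    (h5 : t ^ (-η) + κ * t ^ (-ε) < c) (h6 : 2 * A * (t ^ (-ε) + κ * t ^ (-η)) < c)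
    (γ : (F.evolve t).SaddleConnection) (hγ : γ.length ≤ κ)
    (hm : 2 * (γ.strips.ncard : ℝ) * ε + 2 * η = δ) {P : Set X} (hP : P ∈ γ.strips) :
    ENNReal.ofReal (t ^ (-δ)) ≤ (F.evolve t).width P := by
  by_contra hcon
  rw [not_le] at hcon
  have ht : 0 < t := one_pos.trans h1
  set E := Real.exp (t / 2) with hE
  have hE0 : 0 < E := Real.exp_pos _
  have hEE : Real.exp (-t / 2) * E = 1 := by
    rw [hE, ← Real.exp_add, neg_div, neg_add_cancel, Real.exp_zero]
  set m := γ.strips.ncard with hmdef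
  have hm1 : (1 : ℝ) ≤ m := by
    have hfin := SaddleConnection.finite_strips (γ := γ.ofEvolve) hF
    rw [SaddleConnection.ofEvolve_strips] at hfin
    exact_mod_cast (ncard_pos hfin).mpr ⟨P, hP⟩
  have hmε : 2 * ε ≤ 2 * m * ε := by nlinarith
  set M : ℕ → ℝ := fun k => E * t ^ (2 * k * ε - ε + η) with hM
  have hMmono : Monotone M := by
    intro j k hjk
    have hjk' : (j : ℝ) ≤ k := by exact_mod_cast hjk
    refine mul_le_mul_of_nonneg_left (Real.rpow_le_rpow_of_exponent_le h1.le ?_) hE0.le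
    nlinarith
  have hMpos : ∀ k, 0 < M k := fun k => mul_pos hE0 (Real.rpow_pos_of_pos ht _)
  have him : |γ.ofEvolve.hol.im| ≤ E * κ := by
    change |((teichmullerStretch t).symm γ.hol).im| ≤ _
    rw [teichmullerStretch_symm_im, abs_mul, abs_of_pos hE0]
    exact mul_le_mul_of_nonneg_left ((Complex.abs_im_le_norm _).trans hγ) hE0.le
  have hMle : ∀ k ≤ m, M k + E * κ ≤ Real.exp t := by
    intro k hk
    have hk' : (k : ℝ) ≤ m := by exact_mod_cast hk
    have h7 : t ^ (2 * k * ε - ε + η) ≤ t ^ δ :=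
      Real.rpow_le_rpow_of_exponent_le h1.le (by nlinarith)
    calc M k + E * κ = E * (t ^ (2 * k * ε - ε + η) + κ) := by ring
      _ ≤ E * E := mul_le_mul_of_nonneg_left (by linarith) hE0.le
      _ = Real.exp t := by rw [hE, ← Real.exp_add, add_halves]
  obtain ⟨γ', ⟨ha, hb⟩ | ⟨k, hk, ha, hb⟩⟩ := SaddleConnection.exists_short_saddleConnection hF
    (γ := γ.ofEvolve) (by rwa [SaddleConnection.ofEvolve_strips]) hMmono (hMpos 0)
    (abs_re_le_of_width_evolve_lt hcon)
  -- A diagonal of the strip: the Diophantine condition contradicts `h5`.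
  · rw [SaddleConnection.ofEvolve_strips, ← hmdef] at hb
    have h7 : Real.exp (-t / 2) * t ^ (-δ) < h₀ := by
      refine lt_of_le_of_lt (mul_le_of_le_one_right (Real.exp_nonneg _) ?_) h2
      exact Real.rpow_le_one_of_one_le_of_nonpos h1.le (by linarith)
    have h8 := hD.lt_mul hε γ' ha h7 (hb.trans (add_le_add_right him _)) (hMle m le_rfl)
    have e1 : t ^ ε * (t ^ (-δ) * t ^ (2 * m * ε - ε + η)) = t ^ (-η) := by
      rw [← Real.rpow_add ht, ← Real.rpow_add ht]
      congr 1
      linarith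
    have e2 : t ^ ε * t ^ (-δ) ≤ t ^ (-ε) := by
      rw [← Real.rpow_add ht]
      exact Real.rpow_le_rpow_of_exponent_le h1.le (by linarith)
    have e3 : t ^ ε * (Real.exp (-t / 2) * t ^ (-δ) * (M m + E * κ)) =
        t ^ (-η) + κ * (t ^ ε * t ^ (-δ)) := by
      rw [← e1]
      linear_combination (t ^ ε * t ^ (-δ) * (t ^ (2 * m * ε - ε + η) + κ)) * hEE
    have := mul_le_mul_of_nonneg_left e2 hκ
    linarith
  -- A saddle connection at the gap between two thresholds, whose ratio is `t ^ (2 ε)`: the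
  -- Diophantine condition contradicts `h6`.
  · rw [SaddleConnection.ofEvolve_strips] at hk
    set a := t ^ (2 * (k + 1 : ℕ) * ε - ε + η) with hadef
    have hk0 : (0 : ℝ) ≤ k := Nat.cast_nonneg k
    have ha0 : 0 < a := Real.rpow_pos_of_pos ht _
    have ha1 : 1 ≤ a := Real.one_le_rpow h1.le (by push_cast; nlinarith)
    have hA : (0 : ℝ) ≤ A := A.2
    have hMk : 2 * A / M (k + 1) = 2 * A * Real.exp (-t / 2) * a⁻¹ := by
      change 2 * A / (E * a) = _
      rw [div_eq_iff (mul_pos hE0 ha0).ne']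
      linear_combination (-(2 * A : ℝ)) * hEE + (-(2 * A : ℝ)) * Real.exp (-t / 2) * E *
        inv_mul_cancel₀ ha0.ne'
    have h7 : 2 * A / M (k + 1) < h₀ := by
      rw [hMk]
      refine lt_of_le_of_lt (mul_le_of_le_one_right (by positivity) (inv_le_one_of_one_le₀ ha1)) h3
    have h8 := hD.lt_mul hε γ' ha h7 (hb.trans (add_le_add_right him _)) (hMle k hk.le)
    have e1 : t ^ ε * (a⁻¹ * t ^ (2 * k * ε - ε + η)) = t ^ (-ε) := by
      rw [hadef, ← Real.rpow_neg ht.le, ← Real.rpow_add ht, ← Real.rpow_add ht]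
      congr 1
      push_cast
      ring
    have e2 : t ^ ε * a⁻¹ ≤ t ^ (-η) := by
      rw [hadef, ← Real.rpow_neg ht.le, ← Real.rpow_add ht]
      refine Real.rpow_le_rpow_of_exponent_le h1.le ?_
      push_cast
      nlinarith
    have e3 : t ^ ε * (2 * A / M (k + 1) * (M k + E * κ)) =
        2 * A * (t ^ (-ε) + κ * (t ^ ε * a⁻¹)) := by
      rw [hMk, ← e1]
      linear_combination (2 * A * t ^ ε * a⁻¹ * (t ^ (2 * k * ε - ε + η) + κ)) * hEE
    have h9 := mul_le_mul_of_nonneg_left (mul_le_mul_of_nonneg_left e2 hκ)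
      (by positivity : (0 : ℝ) ≤ 2 * A)
    rw [e3] at h8
    linarith

end FlatStructure

end

theorem mainTheorem5 (h₀ c ε κ δ : ℝ) (A : ℝ≥0)
    (hh₀ : 0 < h₀) (hc : 0 < c) (hε : 0 < ε) (hκ : 1 < κ) :
    ∃ t₀ : ℝ, 1 < t₀ ∧
      ∀ (X : Type*) [TopologicalSpace X] [T2Space X] [CompactSpace X] [ConnectedSpace X]
        [ChartedSpace ℂ X] [IsManifold 𝓘(ℂ) 1 X] (q : QuadraticDifferential X),
        q.flat.area ≤ A → q.flat.Diophantine h₀ c ε →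
        ∀ t > t₀, ∀ γ : (q.flat.evolve t).SaddleConnection,
          γ.length ≤ κ → 2 * (γ.strips.ncard : ℝ) * ε < δ →
          ∀ P ∈ γ.strips, ENNReal.ofReal (t ^ (-δ)) ≤ (q.flat.evolve t).width P := by
  -- Only finitely many numbers `m` of strips satisfy `2 m ε < δ`, so that `t₀` can be chosen
  -- uniformly.
  have hev : ∀ᶠ t : ℝ in Filter.atTop, ∀ m ∈ Finset.range ⌈δ / (2 * ε)⌉₊, 2 * (m : ℝ) * ε < δ →
      1 < t ∧ Real.exp (-t / 2) < h₀ ∧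
      2 * A * Real.exp (-t / 2) < h₀ ∧ t ^ δ + κ ≤ Real.exp (t / 2) ∧
      t ^ (-((δ - 2 * m * ε) / 2)) + κ * t ^ (-ε) < c ∧
      2 * A * (t ^ (-ε) + κ * t ^ (-((δ - 2 * m * ε) / 2))) < c := by
    rw [Filter.eventually_all_finset]
    intro m _
    by_cases hm : 2 * (m : ℝ) * ε < δ
    · filter_upwards [FlatStructure.eventually_bounds (κ := κ) (δ := δ) (A := A) hh₀ hc hε
        (show 0 < (δ - 2 * m * ε) / 2 by linarith)] with t ht _
      exact ht
    · exact Filter.Eventually.of_forall fun t h => absurd h hm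
  obtain ⟨t₁, ht₁⟩ := Filter.eventually_atTop.mp hev
  refine ⟨max t₁ 2, lt_max_of_lt_right one_lt_two, ?_⟩
  intro X _ _ _ _ _ _ q hA hD t ht γ hγ hm P hP
  have hns : γ.path (1 / 2) ∉ q.flat.sing := by
    obtain ⟨_, ⟨φ, hφ, rfl⟩, h1, -⟩ := γ.isSegment.affine (1 / 2) (by norm_num)
    intro h
    have h2 := (QuadraticDifferential.mem_sing_iff hφ.1 h1).mp h
    rw [hφ.2 _ (φ.map_source h1)] at h2
    exact one_ne_zero h2
  have hq := QuadraticDifferential.nondegenerate_of_notMem_sing hns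
  have hF : q.flat.IsAdmissible A :=
    ⟨hq.isHalfTranslation, hq.finite_sing, hA, hD.re_ne_zero hh₀ hc⟩
  have hmN : γ.strips.ncard ∈ Finset.range ⌈δ / (2 * ε)⌉₊ := by
    rw [Finset.mem_range, Nat.lt_ceil, lt_div_iff₀ (by linarith)]
    linarith
  obtain ⟨h1, h2, h3, h4, h5, h6⟩ := ht₁ t ((le_max_left _ _).trans ht.le) _ hmN hm
  exact FlatStructure.le_width_evolve hε (by linarith) (by linarith) hF hD h1 h2 h3 h4 h5 h6 γ hγ
    (by ring) hP
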